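/- **Market.** On a probability space $(\Omega,\mathcal F,\mathbb P)$ let $0=\tau_0<\tau_1<\tau_2<\dots$ be the trading dates, namely the jump times of a Poisson process with intensity $\lambda>0$, and let $Z_k\in(-1,\infty)$, $k\ge 1$, be the return observed at $\tau_k$ ($Z_0$ is a constant). Each waiting time $\tau_k-\tau_{k-1}$ is independent of $(\tau_i,Z_i)_{i<k}$, and, conditionally on $\tau_k-\tau_{k-1}=t$, $Z_k$ is independent of $(\tau_i,Z_i)_{i<k}$ and has law $p(t,dz)$. There are $\underline z\in(0,1]$, $\bar z\in(0,\infty]$ and $k,b\ge 0$ such that for all $t>0$: the support of $p(t,dz)$ is either an interval with interior $(-\underline z,\bar z)$, or a finite set with minimum $-\underline z$ and maximum $\bar z<\infty$; $\int z\,p(t,dz)\ge 0$ (and $z$ is integrable) and $\int(1+z)\,p(t,dz)\le ke^{bt}$; moreover $t\mapsto\int w(z)\,p(t,dz)$ is continuous on $(0,\infty)$ for every measurable $w$ with linear growth. Put $l(a)=\max(a\underline z,-a\bar z)$ (read as $a\underline z$ if $\bar z=\infty$), and $A=\mathbb R$ if $\bar z<\infty$, $A=[0,\infty)$ if $\bar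 z=\infty$. Assume that for all $a\in A\setminus\{0\}$ and all continuous $w:\mathbb R\to\mathbb R$ with linear growth, $(t,x)\mapsto\lambda\int w(x+az)\,p(t,dz)$ is locally semiconcave on $(0,\infty)\times(l(a),\infty)$. Here $u$ is locally semiconcave on $D$ if for each compact $S\subset D$ there is a nondecreasing upper semicontinuous $\omega:[0,\infty)\to[0,\infty)$ with $\omega(0^+)=0$ such that $\eta u(x_1)+(1-\eta)u(x_2)-u(\eta x_1+(1-\eta)x_2)\le\eta(1-\eta)|x_1-x_2|\,\omega(|x_1-x_2|)$ whenever $[x_1,x_2]\subset S$ and $\eta\in[0,1]$. **Utility.** $U:[0,\infty)\to\mathbb R$ is strictly increasing and strictly concave, $C^1$ on $(0,\infty)$, $U(0)=0$, $U'(0^+)=+\infty$, $U'(+\infty)=0$, and $U(x)\le K_1x^\gamma$ for some $K_1>0$ and $\gamma\in(0,1)$. The discount rate $\rho>0$ satisfies $\rho>b\gamma+\lambda\big(k^\gamma/\underline z^\gamma-1\big)$. **Value functions.** Let $\mathcal G_t=\sigma\{(\tau_k,Z_k):\tau_k\le t\}$. Put $$v(x)=\sup_{(\alpha,c)}\mathbb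 E\int_0^\infty e^{-\rho t}U(c_t)\,dt,\qquad x\ge 0,$$ where $c\ge0$ is $(\mathcal G_t)$-predictable, $\alpha_k$ is real-valued and $\sigma\{(\tau_i,Z_i):i\le k-1\}$-measurable, and for all $k\ge 1$, almost surely, $\int_0^{\tau_k}c_t\,dt<\infty$ and $x-\int_0^{\tau_k}c_t\,dt+\sum_{i=1}^k\alpha_iZ_i\ge 0$. Let $g(t,x,a)=\lambda\int v(x+az)\,p(t,dz)$. For $a\in A$, $t\ge0$, $x\ge l(a)$ let $\mathcal C_a(t,x)$ be the set of measurable, locally integrable $c:[t,\infty)\to[0,\infty)$ with $\int_t^sc_u\,du\le x-l(a)$ for all $s\ge t$, and let $$\hat v(t,x,a)=\sup_{c\in\mathcal C_a(t,x)}\int_t^\infty e^{-(\rho+\lambda)(s-t)}\big[U(c_s)+g(s,Y_s,a)\big]\,ds,\qquad Y_s=x-\int_t^sc_u\,du .$$ A couple $(c,Y)$ with $c\in\mathcal C_a(t,x)$ and this $Y$ is *optimal at $(t,x)$* if it attains the supremum. **Proposition.** Fix $a\in A$. The derivative $U'$ has an inverse $I=(U')^{-1}$, a bijection from $(0,\infty)$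 onto $(0,\infty)$. For all $t\ge0$: $\hat v(t,x,a)$ is finite for $x\ge l(a)$; for $x>l(a)$ it is differentiable in $x$ with $\frac{\partial\hat v}{\partial x}(t,x,a)>0$; and $\frac{\partial\hat v}{\partial x}(t,x,a)\to+\infty$ as $x\downarrow l(a)$. Put $$\hat c(t,x,a)=I\Big(\frac{\partial\hat v}{\partial x}(t,x,a)\Big)\ \text{ for } x>l(a),\qquad \hat c(t,x,a)=0\ \text{ for } x\le l(a).$$ For $x>l(a)$, $\hat c(t,x,a)$ is the unique maximizer of $c\mapsto U(c)-c\,\frac{\partial\hat v}{\partial x}(t,x,a)$ over $c\ge0$, and $\hat c(\cdot,\cdot,a)$ is measurable on $[0,\infty)\times[l(a),\infty)$. Let $t\ge 0$ and $x\ge l(a)$. Then the problem $$Y'_s=-\hat c(s,Y_s,a),\quad s\ge t,\qquad Y_t=x,$$ has a unique solution $\bar Y$ on $[t,\infty)$; it satisfies $\bar Y_s\ge l(a)$ for all $s\ge t$; with $\bar c_s=\hat c(s,\bar Y_s,a)$ the couple $(\bar c,\bar Y)$ is optimal at $(t,x)$; and it is the only one: every optimal couple $(c,Y)$ at $(t,x)$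 has $c_s=\bar c_s$ for almost every $s\ge t$ and $Y_s=\bar Y_s$ for all $s\ge t$. -/

import Mathlib

open MeasureTheory ProbabilityTheory Set Filter Topology
open scoped ENNReal NNReal

/-- The data and standing assumptions of the illiquid market.  `τ k` are the trading dates, `Z k`
(for `1 ≤ k`) is the return observed at date `τ k`, `lam` the trading intensity, `p t` the law of a
return given that the waiting time is `t` (only `t > 0` matters, since waiting times are positive),
and the returns range over `(-zl, zu)` with `zl ∈ (0, 1]` and `zu ∈ (0, ∞]`. -/
structure IlliquidMarket (Ω : Type*) [MeasurableSpace Ω] (P : Measure Ω) where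
  τ : ℕ → Ω → ℝ
  Z : ℕ → Ω → ℝ
  lam : ℝ
  p : Kernel ℝ ℝ
  zl : ℝ
  zu : ℝ≥0∞
  k : ℝ
  b : ℝ
  lam_pos : 0 < lam
  zl_pos : 0 < zl
  zl_le_one : zl ≤ 1
  zu_pos : 0 < zu
  k_nonneg : 0 ≤ k
  b_nonneg : 0 ≤ b
  markov : IsMarkovKernel p
  measurable_τ : ∀ n, Measurable (τ n)
  measurable_Z : ∀ n, Measurable (Z n)
  τ_zero : ∀ ω, τ 0 ω = 0
  τ_strictMono : ∀ ω, StrictMono fun n => τ n ω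
  Z_zero : ∃ z₀ : ℝ, ∀ ω, Z 0 ω = z₀
  neg_one_lt_Z : ∀ n, 1 ≤ n → ∀ ω, -1 < Z n ω
  /-- The waiting times of a Poisson process of intensity `lam` are exponential ... -/
  interarrival_law : ∀ n, P.map (fun ω => τ (n + 1) ω - τ n ω) = expMeasure lam
  /-- ... and independent of what has been observed before. -/
  interarrival_indep : ∀ n, IndepFun (fun ω => τ (n + 1) ω - τ n ω)
    (fun ω (i : Fin (n + 1)) => (τ i ω, Z i ω)) P
  /-- Conditionally on the waiting time being `t`, the next return is independent of the past
  and has law `p t`. -/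
  return_law : ∀ n,
    P.map (fun ω => (((fun i : Fin (n + 1) => (τ i ω, Z i ω)), τ (n + 1) ω - τ n ω), Z (n + 1) ω))
      = (P.map fun ω => ((fun i : Fin (n + 1) => (τ i ω, Z i ω)), τ (n + 1) ω - τ n ω)) ⊗ₘ
        (p.comap Prod.snd measurable_snd)
  /-- The support is an interval with interior `(-zl, zu)`, or it is finite with least element
  `-zl` and greatest element `zu < ∞`. -/
  support_p : ∀ t, 0 < t →
    ((p t).support.OrdConnected ∧
        interior (p t).support = {z : ℝ | -zl < z ∧ ENNReal.ofReal z < zu}) ∨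
      (zu ≠ ⊤ ∧ (p t).support.Finite ∧ IsLeast (p t).support (-zl) ∧
        IsGreatest (p t).support zu.toReal)
  integrable_p : ∀ t, 0 < t → Integrable (fun z => z) (p t)
  mean_nonneg : ∀ t, 0 < t → 0 ≤ ∫ z, z ∂(p t)
  mean_le : ∀ t, 0 < t → ∫ z, (1 + z) ∂(p t) ≤ k * Real.exp (b * t)
  continuous_p : ∀ w : ℝ → ℝ, Measurable w → (∃ C, ∀ z, |w z| ≤ C * (1 + |z|)) →
    ContinuousOn (fun t => ∫ z, w z ∂(p t)) (Ioi 0)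

/-- Assumptions on the utility function `U` (on `[0, ∞)`), with growth exponent `γ`. -/
structure IsUtility (U : ℝ → ℝ) (γ : ℝ) : Prop where
  strictMono : StrictMonoOn U (Ici 0)
  strictConcave : StrictConcaveOn ℝ (Ici 0) U
  contDiff : ContDiffOn ℝ 1 U (Ioi 0)
  map_zero : U 0 = 0
  inada_zero : Tendsto (deriv U) (𝓝[>] 0) atTop
  inada_top : Tendsto (deriv U) atTop (𝓝 0)
  γ_pos : 0 < γ
  γ_lt_one : γ < 1
  growth : ∃ K₁ > 0, ∀ x, 0 ≤ x → U x ≤ K₁ * x ^ γ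

/-- `u` is semiconcave on `S`. -/
def Semiconcave {E : Type*} [NormedAddCommGroup E] [NormedSpace ℝ E] (S : Set E) (u : E → ℝ) :
    Prop :=
  ∃ m : ℝ → ℝ, (∀ r, 0 ≤ r → 0 ≤ m r) ∧ MonotoneOn m (Ici 0) ∧ UpperSemicontinuousOn m (Ici 0) ∧
    Tendsto m (𝓝[>] 0) (𝓝 0) ∧
    ∀ x₁ x₂ : E, segment ℝ x₁ x₂ ⊆ S → ∀ η ∈ Icc (0 : ℝ) 1,
      η * u x₁ + (1 - η) * u x₂ - u (η • x₁ + (1 - η) • x₂)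
        ≤ η * (1 - η) * ‖x₁ - x₂‖ * m ‖x₁ - x₂‖

/-- `u` is locally semiconcave on `S`: semiconcave on every compact subset of `S`. -/
def LocallySemiconcave {E : Type*} [NormedAddCommGroup E] [NormedSpace ℝ E] (S : Set E)
    (u : E → ℝ) : Prop :=
  ∀ K ⊆ S, IsCompact K → Semiconcave K u

/-- The inverse `I = (U')⁻¹ : (0, ∞) → (0, ∞)` of the marginal utility. -/
noncomputable def inverseMarginal (U : ℝ → ℝ) : ℝ → ℝ :=
  Function.invFunOn (deriv U) (Ioi 0)

namespace IlliquidMarket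

variable {Ω : Type*} [MeasurableSpace Ω] {P : Measure Ω}

/-- The continuous observation filtration `𝒢_t = σ{(τ_k, Z_k) : τ_k ≤ t}`. -/
def obs (M : IlliquidMarket Ω P) : Filtration ℝ≥0 (inferInstance : MeasurableSpace Ω) where
  seq t := MeasurableSpace.generateFrom
    {B | ∃ (n : ℕ) (s : ℝ≥0) (C : Set ℝ), s ≤ t ∧ MeasurableSet C ∧
      B = {ω | M.τ n ω ≤ s ∧ M.Z n ω ∈ C}}
  mono' := by
    intro t t' h
    apply MeasurableSpace.generateFrom_mono
    rintro B ⟨n, s, C, hs, hC, rfl⟩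
    exact ⟨n, s, C, hs.trans h, hC, rfl⟩
  le' := by
    intro t
    apply MeasurableSpace.generateFrom_le
    rintro B ⟨n, s, C, -, hC, rfl⟩
    exact (measurableSet_le (M.measurable_τ n) measurable_const).inter (M.measurable_Z n hC)

/-- The discrete observation filtration `𝒢_{τ_n} = σ{(τ_i, Z_i) : i ≤ n}`. -/
abbrev obsDiscrete (M : IlliquidMarket Ω P) (n : ℕ) : MeasurableSpace Ω :=
  MeasurableSpace.comap (fun ω (i : Fin (n + 1)) => (M.τ i ω, M.Z i ω)) inferInstance

/-- The wealth at date `τ n`; `α i` is the amount of stock held on `(τ i, τ (i+1)]`. -/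
noncomputable def wealth (M : IlliquidMarket Ω P) (x : ℝ) (α : ℕ → Ω → ℝ) (c : ℝ≥0 → Ω → ℝ)
    (n : ℕ) (ω : Ω) : ℝ :=
  x - (∫ t in 0..M.τ n ω, c t.toNNReal ω) + ∑ i ∈ Finset.range n, α i ω * M.Z (i + 1) ω

/-- `(α, c)` is an admissible control policy from initial capital `x`. -/
structure IsAdmissiblePolicy (M : IlliquidMarket Ω P) (x : ℝ) (α : ℕ → Ω → ℝ)
    (c : ℝ≥0 → Ω → ℝ) : Prop where
  measurable_α : ∀ n, Measurable[M.obsDiscrete n] (α n)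
  predictable_c : IsStronglyPredictable M.obs c
  c_nonneg : ∀ t ω, 0 ≤ c t ω
  integrable_c : ∀ n, ∀ᵐ ω ∂P, IntegrableOn (fun t : ℝ => c t.toNNReal ω) (Icc 0 (M.τ n ω))
  wealth_nonneg : ∀ n, 1 ≤ n → ∀ᵐ ω ∂P, 0 ≤ M.wealth x α c n ω

/-- The value function `v` of the portfolio/consumption problem, with values in `[0, ∞]`. -/
noncomputable def value (M : IlliquidMarket Ω P) (U : ℝ → ℝ) (rho x : ℝ) : ℝ≥0∞ :=
  ⨆ (α : ℕ → Ω → ℝ) (c : ℝ≥0 → Ω → ℝ) (_ : M.IsAdmissiblePolicy x α c),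
    ∫⁻ ω, (∫⁻ t in Ioi (0 : ℝ),
      ENNReal.ofReal (Real.exp (-rho * t) * U (c t.toNNReal ω))) ∂P

/-- The set `A` of possible investments: `ℝ` if `zu < ∞`, and `[0, ∞)` if `zu = ∞`. -/
def investments (M : IlliquidMarket Ω P) : Set ℝ := {a | M.zu = ⊤ → 0 ≤ a}

open scoped Classical in
/-- `l(a) = max (a zl, -a zu)`, read as `a zl` if `zu = ∞`. -/
noncomputable def l (M : IlliquidMarket Ω P) (a : ℝ) : ℝ :=
  if M.zu = ⊤ then a * M.zl else max (a * M.zl) (-a * M.zu.toReal)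

/-- `g(t, x, a) = lam * ∫ v(x + a z) p(t, dz)`. -/
noncomputable def g (M : IlliquidMarket Ω P) (U : ℝ → ℝ) (rho t x a : ℝ) : ℝ≥0∞ :=
  ENNReal.ofReal M.lam * ∫⁻ z, M.value U rho (x + a * z) ∂(M.p t)

/-- The class `𝒞_a(t, x)` of consumption processes `(c_s)_{s ≥ t}` of the auxiliary problem. -/
structure IsAdmissibleConsumption (M : IlliquidMarket Ω P) (a t x : ℝ) (c : ℝ → ℝ) : Prop where
  measurable : Measurable fun s : Ici t => c s
  nonneg : ∀ s, t ≤ s → 0 ≤ c s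
  integrable : ∀ s, t ≤ s → IntegrableOn c (Icc t s)
  integral_le : ∀ s, t ≤ s → ∫ u in t..s, c u ≤ x - M.l a

/-- The gain `∫_t^∞ e^{-(rho+lam)(s-t)} [U(c_s) + g(s, Y_s, a)] ds` of a couple `(c, Y)`. -/
noncomputable def gain (M : IlliquidMarket Ω P) (U : ℝ → ℝ) (rho a t : ℝ) (c Y : ℝ → ℝ) :
    ℝ≥0∞ :=
  ∫⁻ s in Ioi t, ENNReal.ofReal (Real.exp (-(rho + M.lam) * (s - t))) *
    (ENNReal.ofReal (U (c s)) + M.g U rho s (Y s) a)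

/-- The value function `v̂(t, x, a)` of the auxiliary problem, with values in `[0, ∞]`. -/
noncomputable def auxValue (M : IlliquidMarket Ω P) (U : ℝ → ℝ) (rho t x a : ℝ) : ℝ≥0∞ :=
  ⨆ (c : ℝ → ℝ) (_ : M.IsAdmissibleConsumption a t x c),
    M.gain U rho a t c (fun s => x - ∫ u in t..s, c u)

/-- `(c, Y)` is an optimal couple at `(t, x)` for the auxiliary problem. -/
structure IsOptimalCouple (M : IlliquidMarket Ω P) (U : ℝ → ℝ) (rho a t x : ℝ) (c Y : ℝ → ℝ) :
    Prop where
  admissible : M.IsAdmissibleConsumption a t x c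
  state : ∀ s, t ≤ s → Y s = x - ∫ u in t..s, c u
  optimal : M.gain U rho a t c Y = M.auxValue U rho t x a

/-- The partial derivative `∂v̂/∂x (t, x, a)`. -/
noncomputable def auxSlope (M : IlliquidMarket Ω P) (U : ℝ → ℝ) (rho t x a : ℝ) : ℝ :=
  deriv (fun y => (M.auxValue U rho t y a).toReal) x

open scoped Classical in
/-- The feedback `ĉ(t, x, a) = I(∂v̂/∂x (t, x, a))` for `x > l(a)`, extended by zero to `x ≤ l(a)`
(at `x = l(a)` this is `I(+∞) = 0`, as `∂v̂/∂x` blows up there). -/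
noncomputable def feedback (M : IlliquidMarket Ω P) (U : ℝ → ℝ) (rho t x a : ℝ) : ℝ :=
  if M.l a < x then inverseMarginal U (M.auxSlope U rho t x a) else 0

/-- `Y` solves `Y'_s = -ĉ(s, Y_s, a)` for `s ≥ t`, `Y_t = x` (one-sided derivative at `t`). -/
def IsFeedbackSolution (M : IlliquidMarket Ω P) (U : ℝ → ℝ) (rho a t x : ℝ) (Y : ℝ → ℝ) : Prop :=
  Y t = x ∧ ∀ s, t ≤ s → HasDerivWithinAt Y (-M.feedback U rho s (Y s) a) (Ici t) s

/-- For every `a ≠ 0` in `A` and every continuous `w` with linear growth, the map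
`(t, x) ↦ lam * ∫ w(x + a z) p(t, dz)` is locally semiconcave on `(0, ∞) × (l(a), ∞)`. -/
def SemiconcaveReturns (M : IlliquidMarket Ω P) : Prop :=
  ∀ a ∈ M.investments, a ≠ 0 → ∀ w : ℝ → ℝ, Continuous w →
    (∃ C, ∀ y, |w y| ≤ C * (1 + |y|)) →
      LocallySemiconcave {q : WithLp 2 (ℝ × ℝ) | 0 < q.fst ∧ M.l a < q.snd}
        (fun q => M.lam * ∫ z, w (q.snd + a * z) ∂(M.p q.fst))

end IlliquidMarket

/-! For fixed `a` the auxiliary problem is deterministic: wealth above the floor l = l(a) is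
consumed, the discount rate is β = ρ + λ, and the running reward is G = g(·, ·, a). Everything about
the value V = v̂ rests on a few properties of G, collected in `IsConsumptionProblem`: concavity and
monotonicity in wealth, growth e^{κs} with κ < β, and G(s, y + h) ≤ G(s, y) + C h^γ. Variations of
optimal controls replace any differential equation for V.

Existence (`exists_optimal`). The payoff is concave, so near-optimal controls form decreasing
midpoint convex sets, from which an almost everywhere convergent sequence can be selected. By Fatou
the limit consumes no more than the capital. Truncating U at a level N costs at most U'(N)(x - l),
which vanishes as N → ∞, so the limit is optimal.

Differentiability. Since U'(0+) = +∞, an optimal c is bounded away from 0 on bounded time intervals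
(`exists_pos_le_optimal`). A small change k of capital, of either sign, can then be spread over the
consumption on (t, t + δ], which gives V(x + k) - V(x) ≥ kq - (Lδ + ω)|k|, where q is the average of
e^{-β(s-t)}U'(c_s) (`exists_value_expansion`). For a concave V this pinches the one-sided
derivatives and identifies V_x as the limit of q as δ ↓ 0. Tails of optimal controls are optimal, so
Lebesgue differentiation yields U'(c_s) = V_x(s, Y_s) almost everywhere: every optimal control
follows the feedback.

Closed loop. V is concave in x and continuous in t, so V_x is jointly continuous and an optimal path
solves the equation at every time; this provides the solution. Concavity also makes the feedback
nondecreasing in wealth, so the squared distance of two solutions cannot increase. Uniqueness of the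
solution then gives uniqueness of the optimal couple.

Market. Over one trading period, the discounted expectation of W^γ, with W the wealth gross of
consumption, shrinks at least by the factor (k/z̲)^γ λ/(λ + ρ - bγ), and the condition on ρ says
that this is below 1. Summing over periods gives v(x) ≤ K x^γ. Convexity of the policies makes v
concave, hence subadditive, and integrating against p(t, dz) transfers these properties to g. -/

namespace IsUtility

/-! ### Marginal utility, its inverse, and inequalities from concavity -/

variable {U : ℝ → ℝ} {γ : ℝ}

theorem hasDerivAt (h : IsUtility U γ) {x : ℝ} (hx : 0 < x) : HasDerivAt U (deriv U x) x :=
  ((h.contDiff.differentiableOn one_ne_zero).differentiableAt (Ioi_mem_nhds hx)).hasDerivAt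

theorem continuousOn_deriv (h : IsUtility U γ) : ContinuousOn (deriv U) (Ioi 0) :=
  h.contDiff.continuousOn_deriv_of_isOpen isOpen_Ioi le_rfl

theorem lt_tangent (h : IsUtility U γ) {x y : ℝ} (hx : 0 < x) (hy : 0 ≤ y) (hxy : y ≠ x) :
    U y < U x + deriv U x * (y - x) := by
  rcases lt_or_gt_of_ne hxy with hlt | hlt
  · have := h.strictConcave.lt_slope_of_hasDerivAt hy hx.le hlt (h.hasDerivAt hx)
    rw [slope_def_field, lt_div_iff₀ (by linarith)] at this
    linarith
  · have := h.strictConcave.slope_lt_of_hasDerivAt hx.le hy hlt (h.hasDerivAt hx)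
    rw [slope_def_field, div_lt_iff₀ (by linarith)] at this
    linarith

theorem le_tangent (h : IsUtility U γ) {x y : ℝ} (hx : 0 < x) (hy : 0 ≤ y) :
    U y ≤ U x + deriv U x * (y - x) := by
  rcases eq_or_ne y x with rfl | hxy
  · simp
  · exact (h.lt_tangent hx hy hxy).le

theorem strictAntiOn_deriv (h : IsUtility U γ) : StrictAntiOn (deriv U) (Ioi 0) :=
  (h.strictConcave.subset Ioi_subset_Ici_self (convex_Ioi 0)).strictAntiOn_deriv
    fun _ hx => (h.hasDerivAt hx).differentiableAt

theorem deriv_pos (h : IsUtility U γ) {x : ℝ} (hx : 0 < x) : 0 < deriv U x := by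
  have h1 : deriv U (x + 1) < deriv U x :=
    h.strictAntiOn_deriv hx (by simp only [mem_Ioi]; linarith) (by linarith)
  refine lt_of_le_of_lt (le_of_tendsto h.inada_top ?_) h1
  filter_upwards [eventually_ge_atTop (x + 1)] with y hy
  exact h.strictAntiOn_deriv.antitoneOn (by simp only [mem_Ioi]; linarith)
    (by simp only [mem_Ioi]; linarith) hy

theorem exists_deriv_gt (h : IsUtility U γ) (y : ℝ) : ∃ x, 0 < x ∧ y < deriv U x := by
  obtain ⟨x, hx, hx0⟩ := ((h.inada_zero.eventually (eventually_gt_atTop y)).and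
    self_mem_nhdsWithin).exists
  exact ⟨x, hx0, hx⟩

theorem exists_deriv_lt (h : IsUtility U γ) {y : ℝ} (hy : 0 < y) : ∃ x, 0 < x ∧ deriv U x < y := by
  obtain ⟨x, hx, hx0⟩ := ((h.inada_top.eventually (gt_mem_nhds hy)).and
    (eventually_gt_atTop 0)).exists
  exact ⟨x, hx0, hx⟩

theorem bijOn_deriv (h : IsUtility U γ) : BijOn (deriv U) (Ioi 0) (Ioi 0) := by
  refine ⟨fun x hx => h.deriv_pos hx, h.strictAntiOn_deriv.injOn, fun y hy => ?_⟩
  obtain ⟨a, ha, hay⟩ := h.exists_deriv_gt y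
  obtain ⟨b, hb, hby⟩ := h.exists_deriv_lt hy
  exact isPreconnected_Ioi.intermediate_value hb ha h.continuousOn_deriv ⟨hby.le, hay.le⟩

theorem inverseMarginal_pos (h : IsUtility U γ) {y : ℝ} (hy : 0 < y) :
    0 < inverseMarginal U y :=
  Function.invFunOn_mem (h.bijOn_deriv.surjOn hy)

theorem deriv_inverseMarginal (h : IsUtility U γ) {y : ℝ} (hy : 0 < y) :
    deriv U (inverseMarginal U y) = y :=
  Function.invFunOn_eq (h.bijOn_deriv.surjOn hy)

theorem inverseMarginal_deriv (h : IsUtility U γ) {x : ℝ} (hx : 0 < x) :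
    inverseMarginal U (deriv U x) = x :=
  h.strictAntiOn_deriv.injOn (h.inverseMarginal_pos (h.deriv_pos hx)) hx
    (h.deriv_inverseMarginal (h.deriv_pos hx))

theorem bijOn_inverseMarginal (h : IsUtility U γ) :
    BijOn (inverseMarginal U) (Ioi 0) (Ioi 0) := by
  refine ⟨fun y hy => h.inverseMarginal_pos hy, fun y hy z hz hyz => ?_, fun x hx => ?_⟩
  · rw [← h.deriv_inverseMarginal hy, hyz, h.deriv_inverseMarginal hz]
  · exact ⟨deriv U x, h.deriv_pos hx, h.inverseMarginal_deriv hx⟩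

theorem inverseMarginal_lt_iff (h : IsUtility U γ) {x y : ℝ} (hx : 0 < x) (hy : 0 < y) :
    inverseMarginal U y < x ↔ deriv U x < y := by
  conv_rhs => rw [← h.deriv_inverseMarginal hy]
  exact (h.strictAntiOn_deriv.lt_iff_gt hx (h.inverseMarginal_pos hy)).symm

theorem lt_inverseMarginal_iff (h : IsUtility U γ) {x y : ℝ} (hx : 0 < x) (hy : 0 < y) :
    x < inverseMarginal U y ↔ y < deriv U x := by
  conv_rhs => rw [← h.deriv_inverseMarginal hy]
  exact (h.strictAntiOn_deriv.lt_iff_gt (h.inverseMarginal_pos hy) hx).symm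

theorem strictAntiOn_inverseMarginal (h : IsUtility U γ) :
    StrictAntiOn (inverseMarginal U) (Ioi 0) := by
  intro y hy z hz hyz
  rw [h.inverseMarginal_lt_iff (h.inverseMarginal_pos hy) hz, h.deriv_inverseMarginal hy]
  exact hyz

theorem continuousOn_inverseMarginal (h : IsUtility U γ) :
    ContinuousOn (inverseMarginal U) (Ioi 0) := by
  intro y hy
  refine ContinuousAt.continuousWithinAt (tendsto_order.2 ⟨fun a ha => ?_, fun b hb => ?_⟩)
  · rcases le_or_gt a 0 with ha0 | ha0
    · filter_upwards [Ioi_mem_nhds hy] with z hz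
      exact ha0.trans_lt (h.inverseMarginal_pos hz)
    · filter_upwards [Ioi_mem_nhds hy,
        Iio_mem_nhds ((h.lt_inverseMarginal_iff ha0 hy).1 ha)] with z hz hz'
      exact (h.lt_inverseMarginal_iff ha0 hz).2 hz'
  · have hb0 : 0 < b := (h.inverseMarginal_pos hy).trans hb
    filter_upwards [Ioi_mem_nhds hy,
      Ioi_mem_nhds ((h.inverseMarginal_lt_iff hb0 hy).1 hb)] with z hz hz'
    exact (h.inverseMarginal_lt_iff hb0 hz).2 hz'

theorem monotoneOn (h : IsUtility U γ) : MonotoneOn U (Ici 0) := h.strictMono.monotoneOn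

theorem nonneg (h : IsUtility U γ) {x : ℝ} (hx : 0 ≤ x) : 0 ≤ U x :=
  h.map_zero ▸ h.monotoneOn self_mem_Ici hx hx

theorem concave_le (h : IsUtility U γ) {x y a b : ℝ} (hx : 0 ≤ x) (hy : 0 ≤ y) (ha : 0 ≤ a)
    (hb : 0 ≤ b) (hab : a + b = 1) : a * U x + b * U y ≤ U (a * x + b * y) :=
  h.strictConcave.concaveOn.2 hx hy ha hb hab

theorem mul_le_map_mul (h : IsUtility U γ) {x a : ℝ} (hx : 0 ≤ x) (ha : 0 ≤ a) (ha1 : a ≤ 1) :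
    a * U x ≤ U (a * x) := by
  have := h.concave_le hx le_rfl ha (sub_nonneg.2 ha1) (by ring)
  simpa [h.map_zero] using this

/-- Both y and x + d lie between x and y + d, as convex combinations with exchanged weights; adding
the two concavity inequalities gives the claim. -/
theorem increment_antitone (h : IsUtility U γ) {x y d : ℝ} (hx : 0 ≤ x) (hxy : x ≤ y)
    (hd : 0 ≤ d) : U (y + d) - U y ≤ U (x + d) - U x := by
  rcases hd.eq_or_lt with rfl | hd
  · simp
  have hL : 0 < y + d - x := by linarith
  have h1 := h.concave_le (a := (y - x) / (y + d - x)) (b := d / (y + d - x)) hx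
    (show 0 ≤ y + d by linarith) (div_nonneg (by linarith) hL.le) (by positivity)
    (by field_simp; ring)
  have h2 := h.concave_le (a := d / (y + d - x)) (b := (y - x) / (y + d - x)) hx
    (show 0 ≤ y + d by linarith) (by positivity) (div_nonneg (by linarith) hL.le)
    (by field_simp; ring)
  have e1 : (y - x) / (y + d - x) * x + d / (y + d - x) * (y + d) = x + d := by
    field_simp; ring
  have e2 : d / (y + d - x) * x + (y - x) / (y + d - x) * (y + d) = y := by
    field_simp; ring
  rw [e1] at h1
  rw [e2] at h2
  have e3 : (y - x) / (y + d - x) = 1 - d / (y + d - x) := by field_simp; ring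
  rw [e3] at h1 h2
  linarith

/-- Affine majorants of K x^γ with a free threshold M: below M the constant term suffices, above M
one has x^(γ-1) ≤ M^(γ-1). They bound integrals of U(c) by the integral of c, and M can then be
tuned to the scale of the problem. -/
theorem exists_power_bound (h : IsUtility U γ) :
    ∃ K > 0, ∀ x M, 0 ≤ x → 0 < M → U x ≤ K * (M ^ γ + M ^ (γ - 1) * x) := by
  obtain ⟨K, hK, hU⟩ := h.growth
  refine ⟨K, hK, fun x M hx hM => (hU x hx).trans (mul_le_mul_of_nonneg_left ?_ hK.le)⟩
  rcases le_total x M with hxM | hxM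
  · have h1 : x ^ γ ≤ M ^ γ := Real.rpow_le_rpow hx hxM h.γ_pos.le
    have h2 : 0 ≤ M ^ (γ - 1) * x := by positivity
    linarith
  · have hx0 : 0 < x := hM.trans_le hxM
    have h1 : x ^ γ = x ^ (γ - 1) * x := by
      rw [Real.rpow_sub_one hx0.ne']; field_simp
    have h2 : x ^ (γ - 1) ≤ M ^ (γ - 1) :=
      Real.rpow_le_rpow_of_nonpos hM hxM (by linarith [h.γ_lt_one])
    have h3 : 0 ≤ M ^ γ := by positivity
    rw [h1]
    nlinarith

/-- Beyond N, utility grows at most linearly with slope U'(N), which tends to 0. This stands in for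
uniform integrability when passing to the limit in payoffs. -/
theorem le_truncate (h : IsUtility U γ) {x N : ℝ} (hx : 0 ≤ x) (hN : 0 < N) :
    U x ≤ U (min x N) + deriv U N * x := by
  have hd := h.deriv_pos hN
  rcases le_total x N with hxN | hxN
  · rw [min_eq_left hxN]
    nlinarith
  · rw [min_eq_right hxN]
    have := h.le_tangent hN hx
    nlinarith

theorem measurable_comp (h : IsUtility U γ) {α : Type*} [MeasurableSpace α] {c : α → ℝ}
    (hc : Measurable c) (h0 : ∀ a, 0 ≤ c a) : Measurable fun a => U (c a) := by
  have hm : Monotone fun x => U (max x 0) := fun x y hxy =>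
    h.monotoneOn (mem_Ici.2 (le_max_right _ _)) (mem_Ici.2 (le_max_right _ _))
      (max_le_max_right 0 hxy)
  simpa only [Function.comp_def, max_eq_left (h0 _)] using hm.measurable.comp hc

/-- First order expansion of `U` from below, uniform on `[m, ∞)`. -/
theorem exists_uniform_expansion (h : IsUtility U γ) {m ω : ℝ} (hm : 0 < m) (hω : 0 < ω) :
    ∃ k₀ > 0, k₀ < m ∧ ∀ c k, m ≤ c → |k| ≤ k₀ → k * deriv U c - ω * |k| ≤ U (c + k) - U c := by
  -- Beyond N all slopes lie in (0, ω), so two of them differ by less than ω; for c ≤ N + m uniform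
  -- continuity of U' on a compact interval takes over.
  obtain ⟨N, hN, hNω⟩ := h.exists_deriv_lt hω
  have huc : UniformContinuousOn (deriv U) (Icc (m / 2) (N + m + 1)) :=
    isCompact_Icc.uniformContinuousOn_of_continuous
      (h.continuousOn_deriv.mono fun x hx => (half_pos hm).trans_le hx.1)
  obtain ⟨δ, hδ, hδ'⟩ := Metric.uniformContinuousOn_iff.1 huc ω hω
  refine ⟨min (δ / 2) (min (m / 2) (1 / 2)), by positivity, ?_, fun c k hc hk => ?_⟩
  · exact (min_le_right _ _).trans_lt ((min_le_left _ _).trans_lt (half_lt_self hm))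
  have hk1 : |k| ≤ δ / 2 := hk.trans (min_le_left _ _)
  have hk2 : |k| ≤ m / 2 := hk.trans ((min_le_right _ _).trans (min_le_left _ _))
  have hk3 : |k| ≤ 1 / 2 := hk.trans ((min_le_right _ _).trans (min_le_right _ _))
  have hk4 := neg_abs_le k
  have hk5 := le_abs_self k
  have hck : 0 < c + k := by linarith
  have h1 : U c ≤ U (c + k) + deriv U (c + k) * (c - (c + k)) :=
    h.le_tangent hck (by linarith)
  have h2 : |deriv U (c + k) - deriv U c| ≤ ω := by
    rcases le_total c (N + m) with hcN | hcN
    · have := hδ' (c + k) ⟨by linarith, by linarith⟩ c ⟨by linarith, by linarith⟩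
        (by rw [Real.dist_eq]; simp only [add_sub_cancel_left]; linarith)
      rw [Real.dist_eq] at this
      exact this.le
    · have p1 := h.deriv_pos hck
      have p2 := h.deriv_pos (hm.trans_le hc)
      have q1 : deriv U (c + k) ≤ deriv U N :=
        h.strictAntiOn_deriv.antitoneOn hN hck (by linarith)
      have q2 : deriv U c ≤ deriv U N :=
        h.strictAntiOn_deriv.antitoneOn hN (hm.trans_le hc) (by linarith)
      rw [abs_le]
      constructor <;> linarith
  have h3 : |k * (deriv U (c + k) - deriv U c)| ≤ ω * |k| := by
    rw [abs_mul, mul_comm]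
    exact mul_le_mul_of_nonneg_right h2 (abs_nonneg k)
  have h4 := neg_abs_le (k * (deriv U (c + k) - deriv U c))
  nlinarith

end IsUtility

/-! ### The deterministic consumption problem: controls, integrability, concavity -/

/-- Consumption controls on `[t, ∞)` keeping the wealth started at `x` above the floor `l`. -/
structure IsControl (l t x : ℝ) (c : ℝ → ℝ) : Prop where
  measurable : Measurable c
  nonneg : ∀ s, 0 ≤ c s
  integrable : Integrable c
  integral_le : ∫ s in Ioi t, c s ≤ x - l

/-- The wealth process of a consumption control. -/
noncomputable def wealthPath (t x : ℝ) (c : ℝ → ℝ) (s : ℝ) : ℝ := x - ∫ u in t..s, c u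

/-- The integrand of the discounted payoff. -/
noncomputable def payoffRate (U : ℝ → ℝ) (G : ℝ → ℝ → ℝ) (β t x : ℝ) (c : ℝ → ℝ) (s : ℝ) : ℝ :=
  Real.exp (-β * (s - t)) * (U (c s) + G s (wealthPath t x c s))

/-- The discounted payoff of a consumption control. -/
noncomputable def payoff (U : ℝ → ℝ) (G : ℝ → ℝ → ℝ) (β t x : ℝ) (c : ℝ → ℝ) : ℝ :=
  ∫ s in Ioi t, payoffRate U G β t x c s

/-- The value function of the deterministic consumption problem with running gain `G`. -/
noncomputable def consumptionValue (U : ℝ → ℝ) (G : ℝ → ℝ → ℝ) (β l t x : ℝ) : ℝ :=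
  sSup (payoff U G β t x '' {c | IsControl l t x c})

/-- Assumptions on the data of a deterministic consumption problem. -/
structure IsConsumptionProblem (U : ℝ → ℝ) (G : ℝ → ℝ → ℝ) (β l γ : ℝ) : Prop where
  utility : IsUtility U γ
  discount_pos : 0 < β
  measurable : Measurable (Function.uncurry G)
  nonneg : ∀ s y, 0 ≤ G s y
  mono : ∀ s, 0 < s → MonotoneOn (G s) (Ici l)
  concave : ∀ s, 0 < s → ConcaveOn ℝ (Ici l) (G s)
  growth : ∃ κ C, κ < β ∧ 0 ≤ κ ∧ 0 ≤ C ∧ ∀ s, 0 < s → ∀ y, l ≤ y →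
    G s y ≤ C * (1 + |y|) * Real.exp (κ * s)
  modulus : ∃ C, 0 ≤ C ∧ ∀ s, 0 < s → ∀ y h, l ≤ y → 0 ≤ h → G s (y + h) ≤ G s y + C * h ^ γ

namespace IsControl

variable {l t x : ℝ} {c : ℝ → ℝ}

theorem intervalIntegrable (h : IsControl l t x c) (a b : ℝ) : IntervalIntegrable c volume a b :=
  h.integrable.intervalIntegrable

theorem floor_le (h : IsControl l t x c) : l ≤ x := by
  have : 0 ≤ ∫ s in Ioi t, c s := setIntegral_nonneg measurableSet_Ioi fun s _ => h.nonneg s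
  linarith [h.integral_le]

theorem continuous_wealthPath (h : IsControl l t x c) : Continuous (wealthPath t x c) :=
  continuous_const.sub
    (intervalIntegral.continuous_primitive (fun a b => h.intervalIntegrable a b) t)

theorem wealthPath_sub (h : IsControl l t x c) (r s : ℝ) :
    wealthPath t x c r - wealthPath t x c s = ∫ u in r..s, c u := by
  rw [wealthPath, wealthPath, ← intervalIntegral.integral_interval_sub_left
    (h.intervalIntegrable t s) (h.intervalIntegrable t r)]
  ring

theorem antitone_wealthPath (h : IsControl l t x c) : Antitone (wealthPath t x c) := by
  intro r s hrs
  have h1 := h.wealthPath_sub r s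
  have h2 : 0 ≤ ∫ u in r..s, c u := intervalIntegral.integral_nonneg hrs fun u _ => h.nonneg u
  linarith

theorem wealthPath_self : wealthPath t x c t = x := by simp [wealthPath]

theorem wealthPath_le (h : IsControl l t x c) {s : ℝ} (hs : t ≤ s) : wealthPath t x c s ≤ x := by
  simpa [wealthPath_self] using h.antitone_wealthPath hs

theorem integral_tail (h : IsControl l t x c) {s : ℝ} (hs : t ≤ s) :
    (∫ u in t..s, c u) + ∫ u in Ioi s, c u = ∫ u in Ioi t, c u := by
  rw [intervalIntegral.integral_of_le hs, ← setIntegral_union (Ioc_disjoint_Ioi le_rfl)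
    measurableSet_Ioi h.integrable.integrableOn h.integrable.integrableOn, Ioc_union_Ioi_eq_Ioi hs]

theorem tail (h : IsControl l t x c) {s : ℝ} (hs : t ≤ s) :
    IsControl l s (wealthPath t x c s) c where
  measurable := h.measurable
  nonneg := h.nonneg
  integrable := h.integrable
  integral_le := by
    have := h.integral_tail hs
    have := h.integral_le
    rw [wealthPath]
    linarith

theorem le_wealthPath (h : IsControl l t x c) {s : ℝ} (hs : t ≤ s) : l ≤ wealthPath t x c s :=
  (h.tail hs).floor_le

theorem wealthPath_tail (h : IsControl l t x c) (s r : ℝ) :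
    wealthPath s (wealthPath t x c s) c r = wealthPath t x c r := by
  have := h.wealthPath_sub s r
  rw [wealthPath]
  linarith

theorem zero (hx : l ≤ x) : IsControl l t x fun _ => 0 where
  measurable := measurable_const
  nonneg _ := le_rfl
  integrable := integrable_zero _ _ _
  integral_le := by simpa using hx

theorem mono (h : IsControl l t x c) {x' : ℝ} (hx : x ≤ x') : IsControl l t x' c :=
  ⟨h.measurable, h.nonneg, h.integrable, h.integral_le.trans (by linarith)⟩

theorem combo (h : IsControl l t x c) {x' : ℝ} {c' : ℝ → ℝ} (h' : IsControl l t x' c') {a b : ℝ}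
    (ha : 0 ≤ a) (hb : 0 ≤ b) (hab : a + b = 1) :
    IsControl l t (a * x + b * x') fun s => a * c s + b * c' s where
  measurable := (h.measurable.const_mul a).add (h'.measurable.const_mul b)
  nonneg s := add_nonneg (mul_nonneg ha (h.nonneg s)) (mul_nonneg hb (h'.nonneg s))
  integrable := (h.integrable.const_mul a).add (h'.integrable.const_mul b)
  integral_le := by
    rw [integral_add (h.integrable.const_mul a).integrableOn (h'.integrable.const_mul b).integrableOn,
      integral_const_mul, integral_const_mul]
    have h1 := mul_le_mul_of_nonneg_left h.integral_le ha
    have h2 := mul_le_mul_of_nonneg_left h'.integral_le hb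
    have : l = a * l + b * l := by rw [← add_mul, hab, one_mul]
    linarith

theorem wealthPath_combo (h : IsControl l t x c) {x' : ℝ} {c' : ℝ → ℝ} (h' : IsControl l t x' c')
    (a b s : ℝ) : wealthPath t (a * x + b * x') (fun s => a * c s + b * c' s) s
      = a * wealthPath t x c s + b * wealthPath t x' c' s := by
  simp only [wealthPath]
  rw [intervalIntegral.integral_add ((h.intervalIntegrable t s).const_mul a)
    ((h'.intervalIntegrable t s).const_mul b), intervalIntegral.integral_const_mul,
    intervalIntegral.integral_const_mul]
  ring

end IsControl

theorem integrableOn_exp_discount {β : ℝ} (hβ : 0 < β) (t : ℝ) :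
    IntegrableOn (fun s => Real.exp (-β * (s - t))) (Ioi t) := by
  refine (integrableOn_congr_fun (fun s _ => ?_) measurableSet_Ioi).2
    ((integrableOn_exp_mul_Ioi (neg_lt_zero.2 hβ) t).const_mul (Real.exp (β * t)))
  rw [← Real.exp_add]
  ring_nf

theorem integral_exp_discount {β : ℝ} (hβ : 0 < β) (t : ℝ) :
    ∫ s in Ioi t, Real.exp (-β * (s - t)) = 1 / β := by
  have h : ∀ s, Real.exp (-β * (s - t)) = Real.exp (β * t) * Real.exp (-β * s) := fun s => by
    rw [← Real.exp_add]; ring_nf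
  simp only [h]
  rw [integral_const_mul, integral_exp_mul_Ioi (neg_lt_zero.2 hβ), neg_div_neg_eq, mul_div_assoc',
    ← Real.exp_add]
  ring_nf
  simp

namespace IsConsumptionProblem

variable {U : ℝ → ℝ} {G : ℝ → ℝ → ℝ} {β l γ t x : ℝ} {c : ℝ → ℝ}

theorem payoffRate_nonneg (h : IsConsumptionProblem U G β l γ) (hc : ∀ s, 0 ≤ c s) (s : ℝ) :
    0 ≤ payoffRate U G β t x c s :=
  mul_nonneg (Real.exp_nonneg _) (add_nonneg (h.utility.nonneg (hc s)) (h.nonneg _ _))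

theorem measurable_payoffRate (h : IsConsumptionProblem U G β l γ) (hc : IsControl l t x c) :
    Measurable (payoffRate U G β t x c) := by
  refine Measurable.mul (by fun_prop) ((h.utility.measurable_comp hc.measurable hc.nonneg).add ?_)
  exact h.measurable.comp (measurable_id.prodMk hc.continuous_wealthPath.measurable)

/-- Wealth only decreases, so monotonicity replaces it by its starting value, and the factor e^{κs}
is beaten by the discount since κ < β. U is bounded affinely, and the consumption itself is
integrable. One majorant thus gives both integrability and boundedness of the payoffs. -/
theorem exists_payoffRate_bound (h : IsConsumptionProblem U G β l γ) :
    ∃ K > 0, ∃ C ≥ 0, ∃ κ, 0 ≤ κ ∧ κ < β ∧ ∀ t x c, 0 ≤ t → IsControl l t x c → ∀ s, t < s →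
      payoffRate U G β t x c s ≤ K * Real.exp (-β * (s - t)) + K * c s +
        C * (1 + |x|) * Real.exp (κ * t) * Real.exp (-(β - κ) * (s - t)) := by
  obtain ⟨K, hK, hU⟩ := h.utility.exists_power_bound
  obtain ⟨κ, C, hκβ, hκ, hC, hG⟩ := h.growth
  refine ⟨K, hK, C, hC, κ, hκ, hκβ, fun t x c ht hc s hs => ?_⟩
  have hs0 : 0 < s := ht.trans_lt hs
  have h1 : U (c s) ≤ K * (1 + c s) := by simpa using hU (c s) 1 (hc.nonneg s) one_pos
  have h2 : G s (wealthPath t x c s) ≤ C * (1 + |x|) * Real.exp (κ * s) :=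
    (h.mono s hs0 (hc.le_wealthPath hs.le) hc.floor_le (hc.wealthPath_le hs.le)).trans
      (hG s hs0 x hc.floor_le)
  have h3 : Real.exp (-β * (s - t)) ≤ 1 := by
    rw [Real.exp_le_one_iff]
    have := h.discount_pos
    nlinarith
  have h4 : Real.exp (-β * (s - t)) * Real.exp (κ * s)
      = Real.exp (κ * t) * Real.exp (-(β - κ) * (s - t)) := by
    rw [← Real.exp_add, ← Real.exp_add]; ring_nf
  have h5 : Real.exp (-β * (s - t)) * U (c s)
      ≤ K * Real.exp (-β * (s - t)) + K * c s := by
    have e := Real.exp_nonneg (-β * (s - t))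
    have := mul_le_mul_of_nonneg_left h1 e
    have : Real.exp (-β * (s - t)) * (K * c s) ≤ K * c s :=
      mul_le_of_le_one_left (mul_nonneg hK.le (hc.nonneg s)) h3
    linarith
  have h6 := mul_le_mul_of_nonneg_left h2 (Real.exp_nonneg (-β * (s - t)))
  rw [payoffRate, mul_add]
  have h7 : Real.exp (-β * (s - t)) * (C * (1 + |x|) * Real.exp (κ * s))
      = C * (1 + |x|) * Real.exp (κ * t) * Real.exp (-(β - κ) * (s - t)) := by
    rw [mul_left_comm, h4]; ring
  linarith

theorem integrableOn_payoffRate (h : IsConsumptionProblem U G β l γ) (ht : 0 ≤ t)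
    (hc : IsControl l t x c) : IntegrableOn (payoffRate U G β t x c) (Ioi t) := by
  obtain ⟨K, -, C, -, κ, -, hκβ, hb⟩ := h.exists_payoffRate_bound
  refine Integrable.mono' ((((integrableOn_exp_discount h.discount_pos t).const_mul K).add
    (hc.integrable.integrableOn.const_mul K)).add
    ((integrableOn_exp_discount (sub_pos.2 hκβ) t).const_mul (C * (1 + |x|) * Real.exp (κ * t))))
    (h.measurable_payoffRate hc).aestronglyMeasurable ?_
  refine (ae_restrict_iff' measurableSet_Ioi).2 (Eventually.of_forall fun s hs => ?_)
  rw [Real.norm_of_nonneg (h.payoffRate_nonneg hc.nonneg s)]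
  exact hb t x c ht hc s hs

theorem payoff_nonneg (h : IsConsumptionProblem U G β l γ) (hc : ∀ s, 0 ≤ c s) :
    0 ≤ payoff U G β t x c :=
  setIntegral_nonneg measurableSet_Ioi fun s _ => h.payoffRate_nonneg hc s

theorem exists_payoff_bound (h : IsConsumptionProblem U G β l γ) (ht : 0 ≤ t) (x : ℝ) :
    ∃ B, ∀ c, IsControl l t x c → payoff U G β t x c ≤ B := by
  obtain ⟨K, hK, C, -, κ, -, hκβ, hb⟩ := h.exists_payoffRate_bound
  refine ⟨K * (1 / β) + K * (x - l) + C * (1 + |x|) * Real.exp (κ * t) * (1 / (β - κ)),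
    fun c hc => ?_⟩
  have i1 := (integrableOn_exp_discount h.discount_pos t).const_mul K
  have i2 := (hc.integrable.integrableOn (s := Ioi t)).const_mul K
  have i3 := (integrableOn_exp_discount (sub_pos.2 hκβ) t).const_mul
    (C * (1 + |x|) * Real.exp (κ * t))
  refine (setIntegral_mono_on (h.integrableOn_payoffRate ht hc) ((i1.add i2).add i3)
    measurableSet_Ioi fun s hs => hb t x c ht hc s hs).trans ?_
  rw [integral_add' (i1.add i2) i3, integral_add' i1 i2, integral_const_mul, integral_const_mul,
    integral_const_mul, integral_exp_discount h.discount_pos,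
    integral_exp_discount (sub_pos.2 hκβ)]
  have := mul_le_mul_of_nonneg_left hc.integral_le hK.le
  linarith

theorem bddAbove_payoff (h : IsConsumptionProblem U G β l γ) (ht : 0 ≤ t) (x : ℝ) :
    BddAbove (payoff U G β t x '' {c | IsControl l t x c}) := by
  obtain ⟨B, hB⟩ := h.exists_payoff_bound ht x
  refine ⟨B, ?_⟩
  rintro _ ⟨c, hc, rfl⟩
  exact hB c hc

theorem payoff_le_value (h : IsConsumptionProblem U G β l γ) (ht : 0 ≤ t)
    (hc : IsControl l t x c) : payoff U G β t x c ≤ consumptionValue U G β l t x :=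
  le_csSup (h.bddAbove_payoff ht x) (mem_image_of_mem _ hc)

theorem value_le (hx : l ≤ x) {B : ℝ} (hB : ∀ c, IsControl l t x c → payoff U G β t x c ≤ B) :
    consumptionValue U G β l t x ≤ B := by
  refine csSup_le ⟨_, mem_image_of_mem _ (IsControl.zero hx)⟩ ?_
  rintro _ ⟨c, hc, rfl⟩
  exact hB c hc

theorem value_nonneg (h : IsConsumptionProblem U G β l γ) (ht : 0 ≤ t) (hx : l ≤ x) :
    0 ≤ consumptionValue U G β l t x :=
  (h.payoff_nonneg fun _ => le_rfl).trans (h.payoff_le_value ht (IsControl.zero hx))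

/-- Comparison of payoffs from a pointwise comparison of the integrands. -/
theorem payoff_add_le (h : IsConsumptionProblem U G β l γ) (ht : 0 ≤ t)
    (hc : IsControl l t x c) {x' : ℝ} {c' : ℝ → ℝ} (hc' : IsControl l t x' c') (a : ℝ)
    {r : ℝ → ℝ} (hr : IntegrableOn r (Ioi t))
    (hle : ∀ᵐ s ∂volume.restrict (Ioi t),
      a * payoffRate U G β t x c s + r s ≤ payoffRate U G β t x' c' s) :
    a * payoff U G β t x c + ∫ s in Ioi t, r s ≤ payoff U G β t x' c' := by
  have i1 := (h.integrableOn_payoffRate ht hc).const_mul a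
  rw [payoff, payoff, ← integral_const_mul, ← integral_add i1 hr]
  exact integral_mono_ae (i1.add hr) (h.integrableOn_payoffRate ht hc') hle

theorem payoffRate_mono (h : IsConsumptionProblem U G β l γ) {s : ℝ} (hs : 0 < s)
    {x' : ℝ} {c' : ℝ → ℝ} (hc0 : 0 ≤ c s) (hcc : c s ≤ c' s) (hl : l ≤ wealthPath t x c s)
    (hY : wealthPath t x c s ≤ wealthPath t x' c' s) :
    payoffRate U G β t x c s ≤ payoffRate U G β t x' c' s :=
  mul_le_mul_of_nonneg_left (add_le_add (h.utility.monotoneOn hc0 (hc0.trans hcc) hcc)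
    (h.mono s hs hl (hl.trans hY) hY)) (Real.exp_nonneg _)

theorem value_mono (h : IsConsumptionProblem U G β l γ) (ht : 0 ≤ t) {x' : ℝ} (hx : l ≤ x)
    (hxx : x ≤ x') : consumptionValue U G β l t x ≤ consumptionValue U G β l t x' := by
  refine value_le hx fun c hc => ?_
  refine le_trans ?_ (h.payoff_le_value ht (hc.mono hxx))
  refine setIntegral_mono_on (h.integrableOn_payoffRate ht hc)
    (h.integrableOn_payoffRate ht (hc.mono hxx)) measurableSet_Ioi fun s hs => ?_
  exact h.payoffRate_mono (ht.trans_lt hs) (hc.nonneg s) le_rfl (hc.le_wealthPath (le_of_lt hs))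
    (sub_le_sub_right hxx _)

theorem payoffRate_combo_le (h : IsConsumptionProblem U G β l γ) (ht : 0 ≤ t)
    (hc : IsControl l t x c) {x' : ℝ} {c' : ℝ → ℝ} (hc' : IsControl l t x' c') {a b : ℝ}
    (ha : 0 ≤ a) (hb : 0 ≤ b) (hab : a + b = 1) {s : ℝ} (hs : t < s) :
    a * payoffRate U G β t x c s + b * payoffRate U G β t x' c' s
      ≤ payoffRate U G β t (a * x + b * x') (fun s => a * c s + b * c' s) s := by
  simp only [payoffRate]
  rw [hc.wealthPath_combo hc']
  have h1 := h.utility.concave_le (hc.nonneg s) (hc'.nonneg s) ha hb hab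
  have h2 := (h.concave s (ht.trans_lt hs)).2 (hc.le_wealthPath hs.le) (hc'.le_wealthPath hs.le)
    ha hb hab
  simp only [smul_eq_mul] at h2
  have := mul_le_mul_of_nonneg_left (add_le_add h1 h2) (Real.exp_nonneg (-β * (s - t)))
  refine le_trans (le_of_eq ?_) this
  ring

theorem payoff_combo_le (h : IsConsumptionProblem U G β l γ) (ht : 0 ≤ t)
    (hc : IsControl l t x c) {x' : ℝ} {c' : ℝ → ℝ} (hc' : IsControl l t x' c') {a b : ℝ}
    (ha : 0 ≤ a) (hb : 0 ≤ b) (hab : a + b = 1) :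
    a * payoff U G β t x c + b * payoff U G β t x' c'
      ≤ payoff U G β t (a * x + b * x') fun s => a * c s + b * c' s := by
  have := h.payoff_add_le ht hc (hc.combo hc' ha hb hab) a
    ((h.integrableOn_payoffRate ht hc').const_mul b)
    ((ae_restrict_iff' measurableSet_Ioi).2 (Eventually.of_forall fun s hs =>
      h.payoffRate_combo_le ht hc hc' ha hb hab hs))
  rwa [integral_const_mul] at this

theorem exists_payoff_gt (hx : l ≤ x) {ε : ℝ} (hε : 0 < ε) :
    ∃ c, IsControl l t x c ∧ consumptionValue U G β l t x - ε < payoff U G β t x c := by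
  obtain ⟨_, ⟨c, hc, rfl⟩, hlt⟩ := exists_lt_of_lt_csSup
    (⟨_, mem_image_of_mem _ (IsControl.zero hx)⟩ :
      (payoff U G β t x '' {c | IsControl l t x c}).Nonempty)
    (sub_lt_self (consumptionValue U G β l t x) hε)
  exact ⟨c, hc, hlt⟩

theorem concaveOn_value (h : IsConsumptionProblem U G β l γ) (ht : 0 ≤ t) :
    ConcaveOn ℝ (Ici l) (consumptionValue U G β l t) := by
  refine ⟨convex_Ici l, fun x hx y hy a b ha hb hab => ?_⟩
  simp only [smul_eq_mul]
  refine le_of_forall_pos_le_add fun ε hε => ?_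
  obtain ⟨c, hc, hcv⟩ := exists_payoff_gt (U := U) (G := G) (β := β) (t := t) hx hε
  obtain ⟨d, hd, hdv⟩ := exists_payoff_gt (U := U) (G := G) (β := β) (t := t) hy hε
  have h1 := (h.payoff_combo_le ht hc hd ha hb hab).trans
    (h.payoff_le_value ht (hc.combo hd ha hb hab))
  have h2 := mul_le_mul_of_nonneg_left hcv.le ha
  have h3 := mul_le_mul_of_nonneg_left hdv.le hb
  have h4 : ε = a * ε + b * ε := by rw [← add_mul, hab, one_mul]
  linarith

/-- Splitting the payoff at an intermediate date. -/
theorem payoff_split (h : IsConsumptionProblem U G β l γ) (ht : 0 ≤ t) (hc : IsControl l t x c)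
    {s : ℝ} (hs : t ≤ s) : payoff U G β t x c = (∫ r in Ioc t s, payoffRate U G β t x c r)
      + Real.exp (-β * (s - t)) * payoff U G β s (wealthPath t x c s) c := by
  have hi := h.integrableOn_payoffRate ht hc
  rw [payoff, ← Ioc_union_Ioi_eq_Ioi hs, setIntegral_union (Ioc_disjoint_Ioi le_rfl)
    measurableSet_Ioi (hi.mono_set Ioc_subset_Ioi_self) (hi.mono_set (Ioi_subset_Ioi hs)),
    payoff, ← integral_const_mul]
  congr 1
  refine setIntegral_congr_fun measurableSet_Ioi fun r _ => ?_
  simp only [payoffRate]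
  rw [hc.wealthPath_tail, ← mul_assoc, ← Real.exp_add]
  ring_nf

end IsConsumptionProblem

/-! ### Increments of the value in wealth and continuity in time -/

namespace IsConsumptionProblem

variable {U : ℝ → ℝ} {G : ℝ → ℝ → ℝ} {β l γ t x : ℝ} {c : ℝ → ℝ}

theorem exists_gain_bound (h : IsConsumptionProblem U G β l γ) (T x : ℝ) :
    ∃ Γ ≥ 0, ∀ s, 0 < s → s ≤ T → ∀ y, l ≤ y → y ≤ x → G s y ≤ Γ := by
  obtain ⟨κ, C, -, hκ, hC, hG⟩ := h.growth
  refine ⟨C * (1 + |x|) * Real.exp (κ * T), by positivity, fun s hs hsT y hy hyx => ?_⟩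
  refine ((h.mono s hs hy (hy.trans hyx) hyx).trans (hG s hs x (hy.trans hyx))).trans ?_
  gcongr

/-- Extra consumption on `[t, t + 1]` bounds the increments of the value from below. -/
theorem value_increment_ge (h : IsConsumptionProblem U G β l γ) (ht : 0 ≤ t) (hx : l < x) {d : ℝ}
    (hd : 0 ≤ d) :
    Real.exp (-β) / 2 * (U (2 * (x - l) + d) - U (2 * (x - l))) ≤
      consumptionValue U G β l t (x + d) - consumptionValue U G β l t x := by
  set Δ := U (2 * (x - l) + d) - U (2 * (x - l)) with hΔ
  have hΔ0 : 0 ≤ Δ := sub_nonneg.2 (h.utility.monotoneOn (mem_Ici.2 (by linarith))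
    (mem_Ici.2 (by linarith)) (by linarith))
  suffices H : ∀ c, IsControl l t x c → payoff U G β t x c ≤
      consumptionValue U G β l t (x + d) - Real.exp (-β) / 2 * Δ by
    have := value_le hx.le H
    linarith
  intro c hc
  set c' : ℝ → ℝ := fun s => c s + (Ioc t (t + 1)).indicator (fun _ => d) s with hc'def
  have hind : Integrable ((Ioc t (t + 1)).indicator fun _ => d) :=
    (integrable_indicator_iff measurableSet_Ioc).2 (integrableOn_const (by simp))
  have hc' : IsControl l t (x + d) c' := by
    refine ⟨hc.measurable.add (measurable_const.indicator measurableSet_Ioc), fun s =>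
      add_nonneg (hc.nonneg s) (indicator_nonneg (fun _ _ => hd) s), hc.integrable.add hind, ?_⟩
    rw [integral_add hc.integrable.integrableOn hind.integrableOn, setIntegral_indicator
      measurableSet_Ioc, inter_eq_right.2 Ioc_subset_Ioi_self, setIntegral_const]
    have := hc.integral_le
    simp
    linarith
  have hY : ∀ s, t ≤ s → wealthPath t x c s ≤ wealthPath t (x + d) c' s := by
    intro s hs
    have e : ∫ u in t..s, (Ioc t (t + 1)).indicator (fun _ => d) u
        = volume.real (Ioc t s ∩ Ioc t (t + 1)) * d := by
      rw [intervalIntegral.integral_of_le hs, setIntegral_indicator measurableSet_Ioc,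
        setIntegral_const, smul_eq_mul]
    simp only [wealthPath, hc'def]
    rw [intervalIntegral.integral_add (hc.intervalIntegrable t s) hind.intervalIntegrable, e]
    have : volume.real (Ioc t s ∩ Ioc t (t + 1)) ≤ 1 := by
      refine (measureReal_mono inter_subset_right (by simp)).trans ?_
      simp
    nlinarith
  -- Total consumption is at most x - l, so by Markov's inequality c ≤ 2(x - l) on at least half of
  -- the unit interval. There, by concavity, the extra rate d gains at least Δ.
  set S : Set ℝ := Ioc t (t + 1) ∩ {s | c s ≤ 2 * (x - l)} with hS
  have hSm : MeasurableSet S := measurableSet_Ioc.inter (hc.measurable measurableSet_Iic)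
  have hSfin : volume S ≠ ⊤ := ne_top_of_le_ne_top (by simp) (measure_mono inter_subset_left)
  have hvol : 1 / 2 ≤ volume.real S := by
    have h1 : volume.real (Ioc t (t + 1) \ {s | c s ≤ 2 * (x - l)}) ≤ 1 / 2 := by
      set E := Ioc t (t + 1) \ {s | c s ≤ 2 * (x - l)}
      have hEm : MeasurableSet E := measurableSet_Ioc.diff (hc.measurable measurableSet_Iic)
      have hEfin : volume E ≠ ⊤ := ne_top_of_le_ne_top (by simp) (measure_mono sdiff_subset)
      have h2 : volume.real E * (2 * (x - l)) ≤ x - l := by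
        calc volume.real E * (2 * (x - l)) = ∫ s in E, 2 * (x - l) := by
              rw [setIntegral_const, smul_eq_mul]
          _ ≤ ∫ s in E, c s := setIntegral_mono_on (integrableOn_const hEfin)
              hc.integrable.integrableOn hEm fun s hs => (not_le.1 hs.2).le
          _ ≤ ∫ s in Ioi t, c s := setIntegral_mono_set hc.integrable.integrableOn
              (Eventually.of_forall hc.nonneg)
              (LE.le.eventuallyLE fun s hs => hs.1.1)
          _ ≤ x - l := hc.integral_le
      have : 0 < x - l := sub_pos.2 hx
      by_contra! hcon
      nlinarith
    have h2 := measureReal_inter_add_sdiff (μ := volume) (s := Ioc t (t + 1))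
      (hc.measurable (measurableSet_Iic (a := 2 * (x - l)))) (by simp)
    have h3 : volume.real (Ioc t (t + 1)) = 1 := by simp
    rw [h3] at h2
    change volume.real S + volume.real (Ioc t (t + 1) \ {s | c s ≤ 2 * (x - l)}) = 1 at h2
    linarith
  have hr : IntegrableOn (S.indicator fun _ => Real.exp (-β) * Δ) (Ioi t) :=
    ((integrable_indicator_iff hSm).2 (integrableOn_const hSfin)).integrableOn
  have key := h.payoff_add_le ht hc hc' 1 hr
    ((ae_restrict_iff' measurableSet_Ioi).2 (Eventually.of_forall fun s hs => ?_))
  · rw [setIntegral_indicator hSm, inter_eq_right.2 (fun s hs => hs.1.1), setIntegral_const,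
      smul_eq_mul] at key
    have h1 := h.payoff_le_value ht hc'
    have h2 : 0 ≤ (volume.real S - 1 / 2) * (Real.exp (-β) * Δ) :=
      mul_nonneg (sub_nonneg.2 hvol) (mul_nonneg (Real.exp_nonneg _) hΔ0)
    linarith
  · have hts : t ≤ s := le_of_lt hs
    by_cases hsS : s ∈ S
    · rw [indicator_of_mem hsS, one_mul]
      have hcs : c' s = c s + d := by simp only [hc'def, indicator_of_mem hsS.1]
      have h1 : Δ ≤ U (c s + d) - U (c s) := h.utility.increment_antitone (hc.nonneg s) hsS.2 hd
      have h2 : Real.exp (-β) ≤ Real.exp (-β * (s - t)) := by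
        rw [Real.exp_le_exp]
        have := hsS.1.2
        have := h.discount_pos
        nlinarith
      have h3 := h.mono s (ht.trans_lt hs) (hc.le_wealthPath hts)
        ((hc.le_wealthPath hts).trans (hY s hts)) (hY s hts)
      simp only [payoffRate, hcs]
      have h4 := mul_le_mul_of_nonneg_right h2 hΔ0
      have h5 := mul_le_mul_of_nonneg_left (add_le_add h1 h3) (Real.exp_nonneg (-β * (s - t)))
      linarith
    · rw [indicator_of_notMem hsS, one_mul, add_zero]
      exact h.payoffRate_mono (ht.trans_lt hs) (hc.nonneg s)
        (le_add_of_nonneg_right (indicator_nonneg (fun _ _ => hd) s)) (hc.le_wealthPath hts)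
        (hY s hts)

/-- Consuming nothing until s keeps the wealth x intact, and the payoff collected while waiting is
nonnegative. -/
theorem value_later_le (h : IsConsumptionProblem U G β l γ) (ht : 0 ≤ t) (hx : l ≤ x) {s : ℝ}
    (hs : t ≤ s) :
    Real.exp (-β * (s - t)) * consumptionValue U G β l s x ≤ consumptionValue U G β l t x := by
  rw [← le_div_iff₀' (Real.exp_pos _)]
  refine value_le hx fun c hc => ?_
  rw [le_div_iff₀' (Real.exp_pos _)]
  set c' := (Ioi s).indicator c
  have hIoc : ∀ r, r ∈ Ioc t s → c' r = 0 := fun r hr => indicator_of_notMem (not_lt.2 hr.2) _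
  have hIoi : ∀ r, r ∈ Ioi s → c' r = c r := fun r hr => indicator_of_mem hr _
  have hint : Integrable c' := hc.integrable.indicator measurableSet_Ioi
  have hc' : IsControl l t x c' := by
    refine ⟨hc.measurable.indicator measurableSet_Ioi, fun r => indicator_nonneg
      (fun r _ => hc.nonneg r) r, hint, ?_⟩
    rw [setIntegral_indicator measurableSet_Ioi, Ioi_inter_Ioi, sup_eq_right.2 hs]
    exact hc.integral_le
  have hYs : wealthPath t x c' s = x := by
    rw [wealthPath, intervalIntegral.integral_of_le hs, setIntegral_congr_fun measurableSet_Ioc hIoc]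
    simp
  refine le_trans ?_ (h.payoff_le_value ht hc')
  rw [h.payoff_split ht hc' hs, hYs]
  have h1 : payoff U G β s x c = payoff U G β s x c' := by
    refine setIntegral_congr_fun measurableSet_Ioi fun r hr => ?_
    simp only [payoffRate, wealthPath]
    rw [hIoi r hr, intervalIntegral.integral_of_le (le_of_lt hr),
      intervalIntegral.integral_of_le (le_of_lt hr),
      setIntegral_congr_fun measurableSet_Ioc fun u hu => hIoi u hu.1]
  rw [h1]
  exact le_add_of_nonneg_left (setIntegral_nonneg measurableSet_Ioc fun r _ =>
    h.payoffRate_nonneg hc'.nonneg r)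

/-- On (t, s] the running gain contributes at most Γ(s - t), and the utility of a total consumption
of at most x - l is of order (s - t) + (s - t)^(1-γ). After s, wealth is at most x, so the rest is
at most the value at (s, x). -/
theorem value_le_later (h : IsConsumptionProblem U G β l γ) (T x : ℝ) (hx : l ≤ x) :
    ∃ B ≥ 0, ∀ t s, 0 ≤ t → t < s → s ≤ T → consumptionValue U G β l t x ≤
      consumptionValue U G β l s x + B * ((s - t) + (s - t) ^ (1 - γ)) := by
  obtain ⟨Γ, hΓ, hG⟩ := h.exists_gain_bound T x
  obtain ⟨K, hK, hU⟩ := h.utility.exists_power_bound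
  refine ⟨Γ + K * (1 + (x - l)), by nlinarith, fun t s ht hts hsT => value_le hx fun c hc => ?_⟩
  rw [h.payoff_split ht hc hts.le]
  have hd : 0 < s - t := sub_pos.2 hts
  -- Spreading a fixed amount over (t, s] gives rates of order 1/(s - t); with this threshold both
  -- terms of the power bound have order (s - t)^(1-γ).
  set M := (s - t)⁻¹ with hM
  have hM0 : 0 < M := inv_pos.2 hd
  have hMγ : M ^ γ * (s - t) = (s - t) ^ (1 - γ) := by
    rw [hM, Real.inv_rpow hd.le, Real.rpow_sub hd, Real.rpow_one]; field_simp
  have hMγ' : M ^ (γ - 1) = (s - t) ^ (1 - γ) := by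
    rw [hM, Real.inv_rpow hd.le, ← Real.rpow_neg hd.le]; ring_nf
  have h1 : ∫ r in Ioc t s, payoffRate U G β t x c r ≤
      ∫ r in Ioc t s, (K * M ^ γ + Γ) + K * M ^ (γ - 1) * c r := by
    refine setIntegral_mono_on ((h.integrableOn_payoffRate ht hc).mono_set Ioc_subset_Ioi_self)
      ((integrableOn_const (by simp)).add (hc.integrable.integrableOn.const_mul _))
      measurableSet_Ioc fun r hr => ?_
    have e1 : Real.exp (-β * (r - t)) ≤ 1 := by
      rw [Real.exp_le_one_iff]
      have := h.discount_pos
      have := hr.1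
      nlinarith
    have e2 := hU (c r) M (hc.nonneg r) hM0
    have e3 := hG r (ht.trans_lt hr.1) (hr.2.trans hsT) _ (hc.le_wealthPath hr.1.le)
      (hc.wealthPath_le hr.1.le)
    refine (mul_le_of_le_one_left (add_nonneg (h.utility.nonneg (hc.nonneg r))
      (h.nonneg _ _)) e1).trans ?_
    linarith
  have h2 : ∫ r in Ioc t s, (K * M ^ γ + Γ) + K * M ^ (γ - 1) * c r ≤
      (Γ + K * (1 + (x - l))) * ((s - t) + (s - t) ^ (1 - γ)) := by
    have ic : IntegrableOn (fun _ => K * M ^ γ + Γ) (Ioc t s) := integrableOn_const (by simp)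
    rw [integral_add ic (hc.integrable.integrableOn.const_mul _),
      setIntegral_const, integral_const_mul, smul_eq_mul, Real.volume_real_Ioc_of_le hts.le]
    have e1 : ∫ r in Ioc t s, c r ≤ x - l :=
      (setIntegral_mono_set hc.integrable.integrableOn (Eventually.of_forall hc.nonneg)
        (LE.le.eventuallyLE Ioc_subset_Ioi_self)).trans hc.integral_le
    have e2 : 0 ≤ (s - t) ^ (1 - γ) := by positivity
    have e3 : (s - t) * (K * M ^ γ + Γ) = K * (s - t) ^ (1 - γ) + Γ * (s - t) := by
      rw [← hMγ]; ring
    rw [e3, hMγ']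
    have e4 := mul_le_mul_of_nonneg_left e1 (mul_nonneg hK.le e2)
    have e5 : 0 ≤ K * (s - t) * (1 + (x - l)) := by
      have : 0 ≤ x - l := sub_nonneg.2 hx
      positivity
    have e6 : 0 ≤ Γ * (s - t) ^ (1 - γ) := by positivity
    nlinarith
  have h3 : Real.exp (-β * (s - t)) * payoff U G β s (wealthPath t x c s) c ≤
      consumptionValue U G β l s x := by
    have e0 : 0 ≤ s := ht.trans hts.le
    have e1 : Real.exp (-β * (s - t)) ≤ 1 := by
      rw [Real.exp_le_one_iff]
      have := h.discount_pos
      nlinarith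
    refine (mul_le_of_le_one_left (h.payoff_nonneg hc.nonneg) e1).trans ?_
    exact (h.payoff_le_value e0 (hc.tail hts.le)).trans
      (h.value_mono e0 (hc.le_wealthPath hts.le) (hc.wealthPath_le hts.le))
  linarith

/-- The value function is continuous in time. -/
theorem continuousOn_value_time (h : IsConsumptionProblem U G β l γ) (hx : l ≤ x) :
    ContinuousOn (fun t => consumptionValue U G β l t x) (Ici 0) := by
  intro t ht
  obtain ⟨B, hB, hle⟩ := h.value_le_later (t + 1) x hx
  set v := fun t => consumptionValue U G β l t x with hv
  have hγ : 0 < 1 - γ := sub_pos.2 h.utility.γ_lt_one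
  have hm : Tendsto (fun s => B * (|s - t| + |s - t| ^ (1 - γ))) (𝓝[Ici 0] t) (𝓝 0) := by
    have : Continuous fun s : ℝ => B * (|s - t| + |s - t| ^ (1 - γ)) := by
      refine continuous_const.mul ((by fun_prop : Continuous fun s => |s - t|).add ?_)
      exact (by fun_prop : Continuous fun s => |s - t|).rpow_const fun _ => Or.inr hγ.le
    have h0 := this.tendsto t
    simp only [sub_self, abs_zero, Real.zero_rpow hγ.ne', add_zero, mul_zero] at h0
    exact h0.mono_left nhdsWithin_le_nhds
  have he : Tendsto (fun s => Real.exp (β * |s - t|)) (𝓝[Ici 0] t) (𝓝 1) := by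
    have : Continuous fun s : ℝ => Real.exp (β * |s - t|) := by fun_prop
    have h0 := this.tendsto t
    simp only [sub_self, abs_zero, mul_zero, Real.exp_zero] at h0
    exact h0.mono_left nhdsWithin_le_nhds
  have hnn : ∀ s, 0 ≤ s → 0 ≤ v s := fun s hs => h.value_nonneg hs hx
  have hexp : ∀ r s, 0 ≤ r → r ≤ s → v s ≤ Real.exp (β * (s - r)) * v r := by
    intro r s hr hrs
    have h1 := mul_le_mul_of_nonneg_left (h.value_later_le hr hx hrs)
      (Real.exp_nonneg (β * (s - r)))
    rw [← mul_assoc, ← Real.exp_add, show β * (s - r) + -β * (s - r) = 0 by ring, Real.exp_zero,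
      one_mul] at h1
    exact h1
  have hone : ∀ s : ℝ, 1 ≤ Real.exp (β * |s - t|) := fun s =>
    Real.one_le_exp (mul_nonneg h.discount_pos.le (abs_nonneg _))
  have hnear : ∀ᶠ s in 𝓝[Ici 0] t, s ≤ t + 1 :=
    (nhdsWithin_le_nhds (Iic_mem_nhds (by linarith : t < t + 1)))
  -- `value_later_le` loses a factor e^{β|s - t|} and `value_le_later` an additive modulus. Each is
  -- used with s before t and with t before s, which squeezes v s between two functions tending to v
  -- t.
  have lower : Tendsto (fun s => (v t - B * (|s - t| + |s - t| ^ (1 - γ))) /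
      Real.exp (β * |s - t|)) (𝓝[Ici 0] t) (𝓝 (v t)) := by
    have h0 := ((tendsto_const_nhds (x := v t)).sub hm).div he one_ne_zero
    rw [sub_zero, div_one] at h0
    exact h0
  have upper : Tendsto (fun s => Real.exp (β * |s - t|) * v t +
      B * (|s - t| + |s - t| ^ (1 - γ))) (𝓝[Ici 0] t) (𝓝 (v t)) := by
    simpa using (he.mul_const (v t)).add hm
  refine tendsto_of_tendsto_of_tendsto_of_le_of_le' lower upper ?_ ?_
  · filter_upwards [self_mem_nhdsWithin, hnear] with s hs hs1
    rw [div_le_iff₀ (Real.exp_pos _)]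
    have hvs := hnn s hs
    have hm0 : 0 ≤ B * (|s - t| + |s - t| ^ (1 - γ)) := by positivity
    rcases lt_trichotomy s t with hst | rfl | hst
    · have := hexp s t hs hst.le
      rw [abs_of_neg (sub_neg.2 hst), neg_sub] at hm0 ⊢
      nlinarith
    · simp [Real.zero_rpow hγ.ne']
    · have h1 := hle t s ht hst hs1
      have h2 := mul_le_mul_of_nonneg_left (hone s) hvs
      rw [abs_of_pos (sub_pos.2 hst)] at h2 hm0 ⊢
      change v t ≤ v s + _ at h1
      linarith
  · filter_upwards [self_mem_nhdsWithin, hnear] with s hs hs1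
    have hvt := hnn t ht
    have hm0 : 0 ≤ B * (|s - t| + |s - t| ^ (1 - γ)) := by positivity
    rcases lt_trichotomy s t with hst | rfl | hst
    · have h1 := hle s t hs hst (by linarith)
      have h2 := mul_le_mul_of_nonneg_right (hone s) hvt
      rw [abs_of_neg (sub_neg.2 hst), neg_sub] at h2 hm0 ⊢
      change v s ≤ v t + _ at h1
      linarith
    · simp [Real.zero_rpow hγ.ne']
    · have := hexp t s ht hst.le
      rw [abs_of_pos (sub_pos.2 hst)] at hm0 ⊢
      linarith

end IsConsumptionProblem

/-! ### Existence of an optimal control -/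

/-- Quantitative strict concavity of the square root: the midpoint gap controls a distance of fourth
roots. With p, q the fourth roots it reduces to ((p² + q²)/2 + (p - q)²/8)² ≤ (p⁴ + q⁴)/2, where the
difference of the two sides has the factor (p - q)². -/
theorem sq_sub_fourthRoot_le {a b : ℝ} (ha : 0 ≤ a) (hb : 0 ≤ b) :
    (√√a - √√b) ^ 2 ≤ 8 * (√((a + b) / 2) - (√a + √b) / 2) := by
  obtain ⟨p, hp, hpa⟩ : ∃ p, 0 ≤ p ∧ √√a = p := ⟨_, Real.sqrt_nonneg _, rfl⟩
  obtain ⟨q, hq, hqb⟩ : ∃ q, 0 ≤ q ∧ √√b = q := ⟨_, Real.sqrt_nonneg _, rfl⟩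
  have h1 : √a = p ^ 2 := by rw [← hpa, Real.sq_sqrt (Real.sqrt_nonneg _)]
  have h2 : √b = q ^ 2 := by rw [← hqb, Real.sq_sqrt (Real.sqrt_nonneg _)]
  have h3 : a = (p ^ 2) ^ 2 := by rw [← h1, Real.sq_sqrt ha]
  have h4 : b = (q ^ 2) ^ 2 := by rw [← h2, Real.sq_sqrt hb]
  rw [hpa, hqb, h1, h2]
  have h5 : (p ^ 2 + q ^ 2) / 2 + (p - q) ^ 2 / 8 ≤ √((a + b) / 2) := by
    refine Real.le_sqrt_of_sq_le ?_
    rw [h3, h4]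
    have : 0 ≤ (p - q) ^ 2 * ((p + q) ^ 2 / 4 - (p ^ 2 + q ^ 2) / 8 - (p - q) ^ 2 / 64) :=
      mul_nonneg (sq_nonneg _) (by nlinarith [mul_nonneg hp hq])
    nlinarith
  linarith

/-- In a decreasing sequence of midpoint convex sets of nonnegative functions, bounded in a
weighted `L^{1/2}` sense, one can choose elements converging almost everywhere. -/
theorem exists_ae_convergent_of_midpoint_convex {α : Type*} [MeasurableSpace α] {μ : Measure α}
    {w : α → ℝ} (hw : Measurable w) (hw0 : ∀ a, 0 < w a) {K : ℕ → Set (α → ℝ)}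
    (hK : Antitone K) (hne : ∀ n, (K n).Nonempty) (hmeas : ∀ c ∈ K 0, Measurable c)
    (hnn : ∀ c ∈ K 0, ∀ a, 0 ≤ c a)
    (hmid : ∀ n, ∀ c ∈ K n, ∀ d ∈ K n, (fun a => (c a + d a) / 2) ∈ K n)
    (hint : ∀ c ∈ K 0, Integrable (fun a => w a * √(c a)) μ) {B : ℝ}
    (hB : ∀ c ∈ K 0, ∫ a, w a * √(c a) ∂μ ≤ B) :
    ∃ c : ℕ → α → ℝ, (∀ n, c n ∈ K n) ∧
      ∀ᵐ a ∂μ, ∃ L, Tendsto (fun n => c n a) atTop (𝓝 L) := by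
  have hK0 : ∀ {n c}, c ∈ K n → c ∈ K 0 := fun hc => hK (Nat.zero_le _) hc
  set Φ : (α → ℝ) → ℝ := fun c => ∫ a, w a * √(c a) ∂μ with hΦ
  set S : ℕ → ℝ := fun n => sSup (Φ '' K n) with hS
  have hbdd : ∀ n, BddAbove (Φ '' K n) := fun n => ⟨B, by
    rintro _ ⟨c, hc, rfl⟩
    exact hB c (hK0 hc)⟩
  have hleS : ∀ n, ∀ c ∈ K n, Φ c ≤ S n := fun n c hc => le_csSup (hbdd n) (mem_image_of_mem _ hc)
  have hSanti : Antitone S := fun m n hmn =>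
    csSup_le_csSup (hbdd m) ((hne n).image _) (image_mono (hK hmn))
  have hSnn : ∀ n, 0 ≤ S n := fun n => by
    obtain ⟨c, hc⟩ := hne n
    exact (integral_nonneg fun a => mul_nonneg (hw0 a).le (Real.sqrt_nonneg _)).trans
      (hleS n c hc)
  obtain ⟨s, hs⟩ : ∃ s, Tendsto S atTop (𝓝 s) :=
    ⟨_, tendsto_atTop_ciInf hSanti ⟨0, by rintro _ ⟨n, rfl⟩; exact hSnn n⟩⟩
  have hsS : ∀ n, s ≤ S n := fun n => hSanti.le_of_tendsto hs n
  -- Square roots of these gaps are multiples of 4⁻ⁿ, which are summable.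
  set r : ℕ → ℝ := fun n => (1 / 16) ^ n with hr
  have hr0 : ∀ n, 0 < r n := fun n => by positivity
  have hranti : Antitone r := pow_right_anti₀ (by norm_num) (by norm_num)
  obtain ⟨φ, hφ, hφS⟩ := extraction_forall_of_eventually (P := fun n k => S k < s + r n)
    fun n => hs.eventually (gt_mem_nhds (lt_add_of_pos_right s (hr0 n)))
  have hex : ∀ n, ∃ c ∈ K (φ n), S (φ n) - r n < Φ c := by
    intro n
    obtain ⟨_, ⟨c, hc, rfl⟩, hlt⟩ := exists_lt_of_lt_csSup ((hne (φ n)).image Φ)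
      (sub_lt_self (S (φ n)) (hr0 n))
    exact ⟨c, hc, hlt⟩
  choose c hcK hcΦ using hex
  refine ⟨c, fun n => hK hφ.le_apply (hcK n), ?_⟩
  set f : ℕ → α → ℝ := fun n a => √(w a) * √√(c n a) with hf
  have hfm : ∀ n, Measurable (f n) := fun n =>
    hw.sqrt.mul (hmeas _ (hK0 (hcK n))).sqrt.sqrt
  -- Near-maximizers of Φ form a Cauchy sequence: the midpoint of `c n` and `c m` stays in `K (φ
  -- N)`, so Φ there is below s + r N, while both ends are above s - r N. The gap is at most 2 r N,
  -- and `sq_sub_fourthRoot_le` turns it into an L² bound. The constant 5 instead of 4 makes the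
  -- inequality strict.
  have hcau : ∀ N n m, N ≤ n → N ≤ m →
      eLpNorm' (f n - f m) 2 μ < ENNReal.ofReal (5 * (1 / 4) ^ N) := by
    intro N n m hn hm
    have hKn := hK (hφ.monotone hn) (hcK n)
    have hKm := hK (hφ.monotone hm) (hcK m)
    have hmidK := hmid _ _ hKn _ hKm
    have h1 := hleS _ _ hmidK
    have i1 := hint _ (hK0 hmidK)
    have i2 := hint _ (hK0 hKn)
    have i3 := hint _ (hK0 hKm)
    have hg := (i1.sub ((i2.add i3).div_const 2)).const_mul 8
    have h2 : ∫ a, 8 * ((fun a => w a * √((c n a + c m a) / 2)) -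
        fun a => ((fun a => w a * √(c n a)) + fun a => w a * √(c m a)) a / 2) a ∂μ
        ≤ 16 * r N := by
      rw [integral_const_mul, integral_sub' i1 ((i2.add i3).div_const 2), integral_div,
        integral_add' i2 i3]
      have e1 := hcΦ n
      have e2 := hcΦ m
      have e3 := hφS N
      have e4 := hranti hn
      have e5 := hranti hm
      have e6 := hsS (φ n)
      have e7 := hsS (φ m)
      simp only [hΦ] at e1 e2 h1
      linarith
    have h3 : ∫⁻ a, ‖(f n - f m) a‖ₑ ^ (2 : ℝ) ∂μ ≤ ENNReal.ofReal (16 * r N) := by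
      refine le_trans ?_ (ENNReal.ofReal_le_ofReal h2)
      have hpt : ∀ a, ((f n - f m) a) ^ 2 ≤ 8 * ((fun a => w a * √((c n a + c m a) / 2)) -
          fun a => ((fun a => w a * √(c n a)) + fun a => w a * √(c m a)) a / 2) a := by
        intro a
        have e1 := mul_le_mul_of_nonneg_left (sq_sub_fourthRoot_le
          (hnn _ (hK0 hKn) a) (hnn _ (hK0 hKm) a)) (hw0 a).le
        have e2 : ((f n - f m) a) ^ 2 = w a * (√√(c n a) - √√(c m a)) ^ 2 := by
          simp only [hf, Pi.sub_apply]
          rw [← mul_sub, mul_pow, Real.sq_sqrt (hw0 a).le]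
        rw [e2]
        simp only [Pi.sub_apply, Pi.add_apply]
        linarith
      rw [ofReal_integral_eq_lintegral_ofReal hg
        (Eventually.of_forall fun a => (sq_nonneg _).trans (hpt a))]
      refine lintegral_mono fun a => ?_
      rw [Real.enorm_eq_ofReal_abs, ENNReal.ofReal_rpow_of_nonneg (abs_nonneg _) zero_le_two]
      refine ENNReal.ofReal_le_ofReal ?_
      rw [Real.rpow_two, sq_abs]
      exact hpt a
    rw [eLpNorm']
    calc (∫⁻ a, ‖(f n - f m) a‖ₑ ^ (2 : ℝ) ∂μ) ^ (1 / (2 : ℝ))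
        ≤ (ENNReal.ofReal (16 * r N)) ^ (1 / (2 : ℝ)) := ENNReal.rpow_le_rpow h3 (by norm_num)
      _ = ENNReal.ofReal (4 * (1 / 4) ^ N) := by
        rw [ENNReal.ofReal_rpow_of_nonneg (by positivity) (by norm_num), ← Real.sqrt_eq_rpow]
        congr 1
        rw [Real.sqrt_eq_iff_mul_self_eq (by positivity) (by positivity)]
        simp only [hr]
        rw [show (1 / 16 : ℝ) = (1 / 4) * (1 / 4) by norm_num, mul_pow]
        ring
      _ < ENNReal.ofReal (5 * (1 / 4) ^ N) := by
        have : (0 : ℝ) < (1 / 4) ^ N := by positivity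
        exact (ENNReal.ofReal_lt_ofReal_iff (by positivity)).2 (by linarith)
  have hsum : ∑' N, ENNReal.ofReal (5 * (1 / 4) ^ N) ≠ ∞ :=
    ((summable_geometric_of_lt_one (by norm_num) (by norm_num)).mul_left 5).tsum_ofReal_ne_top
  filter_upwards [Lp.ae_tendsto_of_cauchy_eLpNorm' (fun n => (hfm n).aestronglyMeasurable)
    one_le_two hsum hcau] with a ha
  obtain ⟨L, hL⟩ := ha
  -- Convergence holds for the weighted fourth roots; it is undone by dividing by the weight and
  -- taking fourth powers.
  refine ⟨(L / √(w a)) ^ 4, ((hL.div_const _).pow 4).congr fun n => ?_⟩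
  have hwa : √(w a) ≠ 0 := (Real.sqrt_pos.2 (hw0 a)).ne'
  simp only [hf]
  rw [mul_div_cancel_left₀ _ hwa, show 4 = 2 * 2 from rfl, pow_mul,
    Real.sq_sqrt (Real.sqrt_nonneg _), Real.sq_sqrt (hnn _ (hK0 (hcK n)) a)]

theorem IsUtility.continuousOn {U : ℝ → ℝ} {γ : ℝ} (h : IsUtility U γ) :
    ContinuousOn U (Ici 0) := by
  intro x hx
  rcases (mem_Ici.1 hx).eq_or_lt with rfl | hx
  -- At the end point 0 continuity comes from the squeeze 0 ≤ U(y) ≤ K y^γ.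
  · obtain ⟨K, -, hU⟩ := h.growth
    have h1 : Tendsto (fun x : ℝ => K * x ^ γ) (𝓝[Ici 0] 0) (𝓝 0) := by
      have : Continuous fun x : ℝ => K * x ^ γ :=
        continuous_const.mul (Real.continuous_rpow_const h.γ_pos.le)
      have h0 := this.tendsto 0
      rw [Real.zero_rpow h.γ_pos.ne', mul_zero] at h0
      exact h0.mono_left nhdsWithin_le_nhds
    rw [ContinuousWithinAt, h.map_zero]
    refine tendsto_of_tendsto_of_tendsto_of_le_of_le' tendsto_const_nhds h1 ?_ ?_
    · filter_upwards [self_mem_nhdsWithin] with y hy using h.nonneg hy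
    · filter_upwards [self_mem_nhdsWithin] with y hy using hU y hy
  · exact (h.hasDerivAt hx).continuousAt.continuousWithinAt

theorem setLIntegral_limit_le_liminf {c : ℕ → ℝ → ℝ} {d : ℝ → ℝ} {S : Set ℝ}
    (hc : ∀ n, Measurable (c n))
    (hlim : ∀ᵐ s ∂volume.restrict S, Tendsto (fun n => c n s) atTop (𝓝 (d s))) :
    ∫⁻ s in S, ENNReal.ofReal (d s) ≤ liminf (fun n => ∫⁻ s in S, ENNReal.ofReal (c n s)) atTop := by
  refine le_trans (le_of_eq (lintegral_congr_ae ?_))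
    (lintegral_liminf_le fun n => (hc n).ennreal_ofReal)
  filter_upwards [hlim] with s hs
  exact ((ENNReal.continuous_ofReal.tendsto _).comp hs).liminf_eq.symm

namespace IsConsumptionProblem

variable {U : ℝ → ℝ} {G : ℝ → ℝ → ℝ} {β l γ t x : ℝ} {c : ℝ → ℝ}

/-- A limit of controls is a control, and its wealth dominates the limits of the wealths. -/
theorem isControl_of_tendsto {c : ℕ → ℝ → ℝ} (hc : ∀ n, IsControl l t x (c n)) {d : ℝ → ℝ}
    (hd : Measurable d) (hd0 : ∀ s, 0 ≤ d s) (hdt : ∀ s ≤ t, d s = 0)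
    (hlim : ∀ᵐ s ∂volume.restrict (Ioi t), Tendsto (fun n => c n s) atTop (𝓝 (d s))) :
    IsControl l t x d ∧ ∀ s, t ≤ s → ∀ ε, 0 < ε →
      ∀ᶠ n in atTop, wealthPath t x (c n) s ≤ wealthPath t x d s + ε := by
  have hconv : ∀ (S : Set ℝ) (f : ℝ → ℝ), Integrable f → (∀ s, 0 ≤ f s) →
      ∫⁻ s in S, ENNReal.ofReal (f s) = ENNReal.ofReal (∫ s in S, f s) := fun S f hf hf0 =>
    (ofReal_integral_eq_lintegral_ofReal hf.integrableOn (Eventually.of_forall hf0)).symm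
  have hxl : 0 ≤ x - l := sub_nonneg.2 (hc 0).floor_le
  have h1 : ∫⁻ s in Ioi t, ENNReal.ofReal (d s) ≤ ENNReal.ofReal (x - l) := by
    refine (setLIntegral_limit_le_liminf (fun n => (hc n).measurable) hlim).trans ?_
    refine (liminf_le_liminf (v := fun _ => ENNReal.ofReal (x - l))
      (Eventually.of_forall fun n => ?_)).trans_eq (liminf_const _)
    rw [hconv _ _ (hc n).integrable (hc n).nonneg]
    exact ENNReal.ofReal_le_ofReal (hc n).integral_le
  have hint : IntegrableOn d (Ioi t) := by
    refine (lintegral_ofReal_ne_top_iff_integrable hd.aestronglyMeasurable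
      (Eventually.of_forall hd0)).1 (ne_top_of_le_ne_top ENNReal.ofReal_ne_top h1)
  have hint' : Integrable d := by
    refine (integrable_indicator_iff measurableSet_Ioi).2 hint |>.congr ?_
    refine Eventually.of_forall fun s => ?_
    by_cases hs : s ∈ Ioi t
    · rw [indicator_of_mem hs]
    · rw [indicator_of_notMem hs, hdt s (not_lt.1 hs)]
  refine ⟨⟨hd, hd0, hint', ?_⟩, fun s hs ε hε => ?_⟩
  · rw [hconv _ _ hint' hd0] at h1
    exact (ENNReal.ofReal_le_ofReal_iff hxl).1 h1
  -- Fatou on (t, s]: mass can only be lost in the limit, so the limit control has consumed no more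
  -- by time s, up to ε, than the approximating controls eventually do.
  · have h2 := setLIntegral_limit_le_liminf (fun n => (hc n).measurable)
      (ae_restrict_of_ae_restrict_of_subset (Ioc_subset_Ioi_self : Ioc t s ⊆ Ioi t) hlim)
    rw [hconv _ _ hint' hd0] at h2
    set I := ∫ r in Ioc t s, d r with hI
    rcases lt_or_ge (I - ε) 0 with hneg | hpos
    · filter_upwards with n
      have h3 := (hc n).wealthPath_le hs
      rw [wealthPath, wealthPath, intervalIntegral.integral_of_le hs (f := d), ← hI]
      rw [wealthPath] at h3
      linarith
    · have h3 : ENNReal.ofReal (I - ε) < ENNReal.ofReal I :=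
        (ENNReal.ofReal_lt_ofReal_iff (by linarith)).2 (by linarith)
      filter_upwards [eventually_lt_of_lt_liminf (h3.trans_le h2)] with n hn
      rw [hconv _ _ (hc n).integrable (hc n).nonneg, ENNReal.ofReal_lt_ofReal_iff_of_nonneg hpos]
        at hn
      rw [wealthPath, wealthPath, intervalIntegral.integral_of_le hs,
        intervalIntegral.integral_of_le hs, ← hI]
      linarith

/-- An optimal control exists. -/
theorem exists_optimal (h : IsConsumptionProblem U G β l γ) (ht : 0 ≤ t) (hx : l ≤ x) :
    ∃ c, IsControl l t x c ∧ payoff U G β t x c = consumptionValue U G β l t x := by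
  set v := consumptionValue U G β l t x with hv
  set K : ℕ → Set (ℝ → ℝ) :=
    fun n => {c | IsControl l t x c ∧ v - 1 / ((n : ℝ) + 1) < payoff U G β t x c} with hK
  have hw0 : ∀ s, 0 < Real.exp (-β * (s - t)) := fun s => Real.exp_pos _
  have hint : ∀ c, IsControl l t x c → Integrable (fun s => Real.exp (-β * (s - t)) * (1 + c s))
      (volume.restrict (Ioi t)) := by
    intro c hc
    refine Integrable.mono' ((integrableOn_exp_discount h.discount_pos t).add
      hc.integrable.integrableOn) ?_ ((ae_restrict_iff' measurableSet_Ioi).2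
      (Eventually.of_forall fun s hs => ?_))
    · exact (Measurable.mul (by fun_prop)
        (hc.measurable.const_add 1)).aestronglyMeasurable
    · have h1 : Real.exp (-β * (s - t)) ≤ 1 := by
        rw [Real.exp_le_one_iff]
        have := h.discount_pos
        have : t < s := hs
        nlinarith
      rw [Real.norm_of_nonneg (mul_nonneg (hw0 s).le (by linarith [hc.nonneg s])), mul_one_add,
        Pi.add_apply]
      have := mul_le_of_le_one_left (hc.nonneg s) h1
      linarith
  have hsqrt : ∀ y : ℝ, 0 ≤ y → √y ≤ 1 + y := fun y hy => by
    rw [Real.sqrt_le_left (by linarith)]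
    nlinarith
  have hint' : ∀ c, IsControl l t x c → Integrable (fun s => Real.exp (-β * (s - t)) * √(c s))
      (volume.restrict (Ioi t)) := by
    intro c hc
    refine (hint c hc).mono' (Measurable.mul (by fun_prop) hc.measurable.sqrt).aestronglyMeasurable
      (Eventually.of_forall fun s => ?_)
    rw [Real.norm_of_nonneg (mul_nonneg (hw0 s).le (Real.sqrt_nonneg _))]
    exact mul_le_mul_of_nonneg_left (hsqrt _ (hc.nonneg s)) (hw0 s).le
  obtain ⟨c, hcK, hclim⟩ := exists_ae_convergent_of_midpoint_convex
    (μ := volume.restrict (Ioi t)) (w := fun s => Real.exp (-β * (s - t))) (K := K)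
    (B := 1 / β + (x - l)) (by fun_prop) hw0
    (fun m n hmn c hc => ⟨hc.1, lt_of_le_of_lt (sub_le_sub_left
      (one_div_le_one_div_of_le (by positivity) (by exact_mod_cast Nat.succ_le_succ hmn)) v) hc.2⟩)
    (fun n => (exists_payoff_gt hx (by positivity)).imp fun c hc => hc)
    (fun c hc => hc.1.measurable) (fun c hc => hc.1.nonneg)
    (fun n c hc d hd => by
      have h1 := hc.1.combo hd.1 (a := 1 / 2) (b := 1 / 2) (by norm_num) (by norm_num)
        (by norm_num)
      have h2 := h.payoff_combo_le ht hc.1 hd.1 (a := 1 / 2) (b := 1 / 2) (by norm_num)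
        (by norm_num) (by norm_num)
      have e1 : (fun s => (c s + d s) / 2) = fun s => 1 / 2 * c s + 1 / 2 * d s := by
        funext s; ring
      have e2 : 1 / 2 * x + 1 / 2 * x = x := by ring
      rw [e2] at h1 h2
      rw [e1]
      have := hc.2
      have := hd.2
      exact ⟨h1, by linarith⟩)
    (fun c hc => hint' c hc.1)
    (fun c hc => by
      have e1 : ∫ s in Ioi t, Real.exp (-β * (s - t)) * √(c s) ≤
          ∫ s in Ioi t, Real.exp (-β * (s - t)) + c s := by
        refine setIntegral_mono_on (hint' c hc.1)
          ((integrableOn_exp_discount h.discount_pos t).add hc.1.integrable.integrableOn)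
          measurableSet_Ioi fun s hs => ?_
        have h1 : Real.exp (-β * (s - t)) ≤ 1 := by
          rw [Real.exp_le_one_iff]
          have := h.discount_pos
          have : t < s := hs
          nlinarith
        have h2 := mul_le_mul_of_nonneg_left (hsqrt _ (hc.1.nonneg s)) (hw0 s).le
        have h3 := mul_le_of_le_one_left (hc.1.nonneg s) h1
        linarith
      rw [integral_add (integrableOn_exp_discount h.discount_pos t)
        hc.1.integrable.integrableOn, integral_exp_discount h.discount_pos] at e1
      linarith [hc.1.integral_le])
  have hc : ∀ n, IsControl l t x (c n) := fun n => (hcK n).1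
  obtain ⟨f, hfm, hf⟩ := measurable_limit_of_tendsto_metrizable_ae
    (fun n => (hc n).measurable.aemeasurable) hclim
  -- The limit is known only almost everywhere after t. Clipping at 0 and vanishing up to t make it
  -- a nonnegative function that is integrable on the whole line.
  set d : ℝ → ℝ := (Ioi t).indicator fun s => max (f s) 0 with hd
  have hdlim : ∀ᵐ s ∂volume.restrict (Ioi t), Tendsto (fun n => c n s) atTop (𝓝 (d s)) := by
    filter_upwards [hf, ae_restrict_mem measurableSet_Ioi] with s hs hst
    rw [hd, indicator_of_mem hst,
      max_eq_left (ge_of_tendsto' hs fun n => (hc n).nonneg s)]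
    exact hs
  obtain ⟨hdc, hdY⟩ := isControl_of_tendsto hc ((hfm.max measurable_const).indicator
    measurableSet_Ioi) (fun s => indicator_nonneg (fun s _ => le_max_right _ _) s)
    (fun s hs => indicator_of_notMem (not_lt.2 hs) _) hdlim
  refine ⟨d, hdc, le_antisymm (h.payoff_le_value ht hdc) ?_⟩
  obtain ⟨C, hC, hmod⟩ := h.modulus
  have hγ := h.utility.γ_pos
  -- The rates U(c n) need not be dominated. Truncation at N costs at most U'(N)(x - l), after which
  -- dominated convergence applies; N → ∞ at the end.
  have main : ∀ N, 0 < N → v ≤ payoff U G β t x d + deriv U N * (x - l) := by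
    intro N hN
    set D : ℝ → ℝ := fun s => Real.exp (-β * (s - t)) * U N + payoffRate U G β t x (fun _ => 0) s
      with hD
    have hDint : IntegrableOn D (Ioi t) :=
      ((integrableOn_exp_discount h.discount_pos t).mul_const _).add
        (h.integrableOn_payoffRate ht (IsControl.zero hx))
    set Y := wealthPath t x d with hY
    -- The running gain along c exceeds the one along the limit wealth Y by at most C(excess
    -- wealth)^γ, and this excess tends to 0. The minimum with D, itself a bound for the truncated
    -- rate, provides the domination.
    set H : (ℝ → ℝ) → ℝ → ℝ := fun c s => min (Real.exp (-β * (s - t)) * (U (min (c s) N)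
      + (G s (Y s) + C * (max (wealthPath t x c s - Y s) 0) ^ γ))) (D s) with hH
    have hHm : ∀ c, IsControl l t x c → Measurable (H c) := by
      intro c hc
      refine Measurable.min (Measurable.mul (by fun_prop) (Measurable.add ?_ (Measurable.add ?_ ?_)))
        (Measurable.add (by fun_prop) (h.measurable_payoffRate (IsControl.zero hx)))
      · exact h.utility.measurable_comp (hc.measurable.min measurable_const)
          fun s => le_min (hc.nonneg s) hN.le
      · exact h.measurable.comp (measurable_id.prodMk hdc.continuous_wealthPath.measurable)
      · exact ((((hc.continuous_wealthPath.measurable.sub hdc.continuous_wealthPath.measurable).max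
          measurable_const).pow_const γ).const_mul C)
    have hD0 : ∀ s, 0 ≤ D s := fun s => add_nonneg
      (mul_nonneg (hw0 s).le (h.utility.nonneg hN.le)) (h.payoffRate_nonneg (fun _ => le_rfl) s)
    have hH0 : ∀ c, IsControl l t x c → ∀ s, 0 ≤ H c s := fun c hc s =>
      le_min (mul_nonneg (hw0 s).le (add_nonneg (h.utility.nonneg (le_min (hc.nonneg s) hN.le))
        (add_nonneg (h.nonneg _ _) (by positivity)))) (hD0 s)
    have hHint : ∀ c, IsControl l t x c → IntegrableOn (H c) (Ioi t) := fun c hc =>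
      Integrable.mono' hDint (hHm c hc).aestronglyMeasurable
        (Eventually.of_forall fun s => by
          rw [Real.norm_of_nonneg (hH0 c hc s)]
          exact min_le_right _ _)
    have hrate : ∀ c, IsControl l t x c → ∀ s ∈ Ioi t,
        payoffRate U G β t x c s ≤ H c s + deriv U N * c s := by
      intro c hc s hs
      have hts : t ≤ s := le_of_lt hs
      have hs0 : 0 < s := ht.trans_lt hs
      have e1 := h.utility.le_truncate (hc.nonneg s) hN
      have e2 : G s (wealthPath t x c s) ≤
          G s (Y s) + C * (max (wealthPath t x c s - Y s) 0) ^ γ := by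
        refine le_trans ?_ (hmod s hs0 (Y s) _ (hdc.le_wealthPath hts) (le_max_right _ _))
        refine h.mono s hs0 (hc.le_wealthPath hts) ?_ ?_
        · exact (hdc.le_wealthPath hts).trans (le_add_of_nonneg_right (le_max_right _ _))
        · linarith [le_max_left (wealthPath t x c s - Y s) 0]
      have e3 : Real.exp (-β * (s - t)) ≤ 1 := by
        rw [Real.exp_le_one_iff]
        have := h.discount_pos
        have : t < s := hs
        nlinarith
      have e4 : Real.exp (-β * (s - t)) * (deriv U N * c s) ≤ deriv U N * c s :=
        mul_le_of_le_one_left (mul_nonneg (h.utility.deriv_pos hN).le (hc.nonneg s)) e3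
      have e5 : G s (wealthPath t x c s) ≤ G s (wealthPath t x (fun _ => 0) s) := by
        refine h.mono s hs0 (hc.le_wealthPath hts) ((IsControl.zero hx).le_wealthPath hts) ?_
        simpa [wealthPath] using hc.wealthPath_le hts
      have e6 : U (min (c s) N) ≤ U N := h.utility.monotoneOn
        (mem_Ici.2 (le_min (hc.nonneg s) hN.le)) (mem_Ici.2 hN.le) (min_le_right _ _)
      rw [← sub_le_iff_le_add]
      refine le_min ?_ ?_
      · have := mul_le_mul_of_nonneg_left (add_le_add e1 e2) (hw0 s).le
        simp only [payoffRate]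
        linarith
      · have := mul_le_mul_of_nonneg_left (add_le_add (e1.trans (add_le_add_left e6 _)) e5)
          (hw0 s).le
        simp only [payoffRate, hD, h.utility.map_zero, zero_add]
        linarith
    have hpay : ∀ c, IsControl l t x c →
        payoff U G β t x c ≤ (∫ s in Ioi t, H c s) + deriv U N * (x - l) := by
      intro c hc
      have i2 := hc.integrable.integrableOn (s := Ioi t) |>.const_mul (deriv U N)
      refine (setIntegral_mono_on (h.integrableOn_payoffRate ht hc) ((hHint c hc).add i2)
        measurableSet_Ioi (hrate c hc)).trans ?_
      rw [integral_add' (hHint c hc) i2, integral_const_mul]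
      have := mul_le_mul_of_nonneg_left hc.integral_le (h.utility.deriv_pos hN).le
      linarith
    have hHlim : Tendsto (fun n => ∫ s in Ioi t, H (c n) s) atTop (𝓝 (∫ s in Ioi t, H d s)) := by
      refine tendsto_integral_of_dominated_convergence D
        (fun n => (hHm _ (hc n)).aestronglyMeasurable) hDint
        (fun n => Eventually.of_forall fun s => ?_) ?_
      · rw [Real.norm_of_nonneg (hH0 _ (hc n) s)]
        exact min_le_right _ _
      · filter_upwards [hdlim, ae_restrict_mem measurableSet_Ioi] with s hs hst
        have l1 : Tendsto (fun n => U (min (c n s) N)) atTop (𝓝 (U (min (d s) N))) := by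
          refine (h.utility.continuousOn (min (d s) N) (mem_Ici.2 (le_min (hdc.nonneg s)
            hN.le))).tendsto.comp (tendsto_nhdsWithin_iff.2 ⟨hs.min tendsto_const_nhds,
              Eventually.of_forall fun n => le_min ((hc n).nonneg s) hN.le⟩)
        have l2 : Tendsto (fun n => max (wealthPath t x (c n) s - Y s) 0) atTop (𝓝 0) := by
          refine tendsto_order.2 ⟨fun a ha => Eventually.of_forall fun n =>
            ha.trans_le (le_max_right _ _), fun a ha => ?_⟩
          filter_upwards [hdY s (le_of_lt hst) (a / 2) (half_pos ha)] with n hn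
          refine max_lt ?_ ha
          linarith
        have l3 := ((l2.rpow_const (Or.inr hγ.le) : Tendsto (fun n =>
          (max (wealthPath t x (c n) s - Y s) 0) ^ γ) atTop (𝓝 ((0 : ℝ) ^ γ)))).const_mul C
        have l4 := ((l1.add (l3.const_add (G s (Y s)))).const_mul
          (Real.exp (-β * (s - t)))).min (tendsto_const_nhds (x := D s))
        have e : H d s = min (Real.exp (-β * (s - t)) *
            (U (min (d s) N) + (G s (Y s) + C * (0 : ℝ) ^ γ))) (D s) := by
          simp only [hH, hY, sub_self, max_self]
        rw [e]
        exact l4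
    have hHd : ∫ s in Ioi t, H d s ≤ payoff U G β t x d := by
      refine setIntegral_mono_on (hHint d hdc) (h.integrableOn_payoffRate ht hdc)
        measurableSet_Ioi fun s _ => (min_le_left _ _).trans ?_
      simp only [hY, sub_self, max_self, Real.zero_rpow hγ.ne', mul_zero, add_zero, payoffRate]
      refine mul_le_mul_of_nonneg_left (add_le_add_left (h.utility.monotoneOn
        (mem_Ici.2 (le_min (hdc.nonneg s) hN.le)) (hdc.nonneg s) (min_le_left _ _)) _) (hw0 s).le
    have hvn : ∀ n : ℕ, v - 1 / ((n : ℝ) + 1) ≤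
        (∫ s in Ioi t, H (c n) s) + deriv U N * (x - l) :=
      fun n => (hcK n).2.le.trans (hpay _ (hc n))
    have hvlim : Tendsto (fun n : ℕ => v - 1 / ((n : ℝ) + 1)) atTop (𝓝 v) := by
      simpa using tendsto_one_div_add_atTop_nhds_zero_nat.const_sub v
    have := le_of_tendsto_of_tendsto' hvlim (hHlim.add_const _) hvn
    linarith
  have hlimN : Tendsto (fun N => payoff U G β t x d + deriv U N * (x - l)) atTop
      (𝓝 (payoff U G β t x d)) := by
    simpa using (h.utility.inada_top.mul_const (x - l)).const_add (payoff U G β t x d)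
  refine ge_of_tendsto hlimN ?_
  filter_upwards [eventually_gt_atTop 0] with N hN using main N hN

end IsConsumptionProblem

/-! ### Variations of an optimal control -/

namespace IsConsumptionProblem

variable {U : ℝ → ℝ} {G : ℝ → ℝ → ℝ} {β l γ t x : ℝ} {c : ℝ → ℝ}

/-- Moving the state towards the floor costs at most a proportional loss of running gain. -/
theorem gain_combo_floor_le (h : IsConsumptionProblem U G β l γ) {s y z θ : ℝ} (hs : 0 < s)
    (hy : l ≤ y) (hθ : 0 ≤ θ) (hθ1 : θ ≤ 1) (hz : (1 - θ) * y + θ * l ≤ z) :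
    (1 - θ) * G s y ≤ G s z := by
  have h1 := (h.concave s hs).2 (mem_Ici.2 hy) (mem_Ici.2 le_rfl) (sub_nonneg.2 hθ1) hθ (by ring)
  simp only [smul_eq_mul] at h1
  have h2 : l ≤ (1 - θ) * y + θ * l := by nlinarith
  have h3 := h.mono s hs (mem_Ici.2 h2) (mem_Ici.2 (h2.trans hz)) hz
  have h4 := mul_nonneg hθ (h.nonneg s l)
  linarith

/-- An optimal control is bounded away from zero on compact time intervals. -/
theorem exists_pos_le_optimal (h : IsConsumptionProblem U G β l γ) (ht : 0 ≤ t) (hx : l < x)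
    (hc : IsControl l t x c) (hopt : payoff U G β t x c = consumptionValue U G β l t x) (T : ℝ) :
    ∃ m > 0, ∀ᵐ s, s ∈ Ioc t T → m ≤ c s := by
  set v := consumptionValue U G β l t x with hv
  have hxl : 0 < x - l := sub_pos.2 hx
  -- Below m', one unit of extra consumption before T earns more than v/(x - l), the most that
  -- giving up one unit of capital proportionally can cost.
  obtain ⟨m', hm', hUm'⟩ := h.utility.exists_deriv_gt (v / (x - l) / Real.exp (-β * (T - t)))
  rw [div_lt_iff₀ (Real.exp_pos _), div_lt_iff₀ hxl] at hUm'
  refine ⟨m' / 2, half_pos hm', ?_⟩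
  set m := m' / 2 with hm
  have hm0 : 0 < m := half_pos hm'
  set E : Set ℝ := Ioc t T ∩ {s | c s < m} with hE
  have hEm : MeasurableSet E := measurableSet_Ioc.inter (hc.measurable measurableSet_Iio)
  have hEfin : volume E ≠ ⊤ := ne_top_of_le_ne_top (by simp) (measure_mono inter_subset_left)
  suffices hE0 : volume E = 0 by
    have := measure_eq_zero_iff_ae_notMem.1 hE0
    filter_upwards [this] with s hs hst
    by_contra hcon
    exact hs ⟨hst, not_le.1 hcon⟩
  by_contra hne
  set e := volume.real E with he
  have he0 : 0 < e := ENNReal.toReal_pos hne hEfin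
  -- Scaling consumption by 1 - θ frees the capital θ(x - l) = εe, which finances the extra rate ε
  -- on E. The loss is at most θv and the gain at least eΔ. As m + ε ≤ m', the choice of m' makes
  -- the gain exceed the loss, contradicting optimality.
  set ε := min m ((x - l) / e) with hε
  have hε0 : 0 < ε := lt_min hm0 (div_pos hxl he0)
  have hεe : ε * e ≤ x - l := (le_div_iff₀ he0).1 (min_le_right _ _)
  set θ := ε * e / (x - l) with hθ
  have hθ0 : 0 ≤ θ := by positivity
  have hθ1 : θ ≤ 1 := (div_le_one hxl).2 hεe
  have hθx : θ * (x - l) = ε * e := div_mul_cancel₀ _ hxl.ne'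
  have hind : Integrable (E.indicator fun _ => ε) :=
    (integrable_indicator_iff hEm).2 (integrableOn_const hEfin)
  have hindnn : ∀ s, 0 ≤ E.indicator (fun _ => ε) s := indicator_nonneg fun _ _ => hε0.le
  have hindle : ∀ S : Set ℝ, ∫ s in S, E.indicator (fun _ => ε) s ≤ ε * e := by
    intro S
    rw [setIntegral_indicator hEm, setIntegral_const, smul_eq_mul, mul_comm]
    exact mul_le_mul_of_nonneg_left (measureReal_mono inter_subset_right hEfin) hε0.le
  set c' : ℝ → ℝ := fun s => (1 - θ) * c s + E.indicator (fun _ => ε) s with hc'def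
  have hc' : IsControl l t x c' := by
    refine ⟨(hc.measurable.const_mul _).add (measurable_const.indicator hEm), fun s =>
      add_nonneg (mul_nonneg (sub_nonneg.2 hθ1) (hc.nonneg s)) (hindnn s),
      (hc.integrable.const_mul _).add hind, ?_⟩
    rw [integral_add (hc.integrable.const_mul _).integrableOn hind.integrableOn,
      integral_const_mul]
    have h1 := hindle (Ioi t)
    have h2 := mul_le_mul_of_nonneg_left hc.integral_le (sub_nonneg.2 hθ1)
    linarith
  have hY : ∀ s, t ≤ s →
      (1 - θ) * wealthPath t x c s + θ * l ≤ wealthPath t x c' s := by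
    intro s hs
    simp only [wealthPath, hc'def]
    rw [intervalIntegral.integral_add ((hc.intervalIntegrable t s).const_mul _)
      hind.intervalIntegrable, intervalIntegral.integral_const_mul,
      intervalIntegral.integral_of_le hs (f := E.indicator _)]
    have := hindle (Ioc t s)
    linarith
  set Δ := Real.exp (-β * (T - t)) * (U (m + ε) - U m) with hΔ
  have hUinc : 0 ≤ U (m + ε) - U m := sub_nonneg.2 (h.utility.monotoneOn (mem_Ici.2 hm0.le)
    (mem_Ici.2 (by linarith)) (by linarith))
  have hr : IntegrableOn (E.indicator fun _ => Δ) (Ioi t) :=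
    ((integrable_indicator_iff hEm).2 (integrableOn_const hEfin)).integrableOn
  have key := h.payoff_add_le ht hc hc' (1 - θ) hr
    ((ae_restrict_iff' measurableSet_Ioi).2 (Eventually.of_forall fun s hs => ?_))
  · rw [setIntegral_indicator hEm, inter_eq_right.2 (fun s hs => hs.1.1), setIntegral_const,
      smul_eq_mul, hopt, ← he] at key
    have h1 := key.trans (h.payoff_le_value ht hc')
    have h2 : ε * deriv U (m + ε) ≤ U (m + ε) - U m := by
      have := h.utility.le_tangent (show 0 < m + ε by linarith) hm0.le
      linarith
    have h3 : deriv U m' ≤ deriv U (m + ε) :=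
      h.utility.strictAntiOn_deriv.antitoneOn (show 0 < m + ε by linarith) hm'
        (by have := min_le_left m ((x - l) / e); linarith)
    have h4 : e * Δ ≤ θ * v := by linarith
    have h5 : Real.exp (-β * (T - t)) * (ε * deriv U m') ≤ Δ :=
      mul_le_mul_of_nonneg_left ((mul_le_mul_of_nonneg_left h3 hε0.le).trans h2)
        (Real.exp_nonneg _)
    have h6 : e * (Real.exp (-β * (T - t)) * (ε * deriv U m')) * (x - l) ≤ ε * e * v := by
      rw [← hθx]
      have := mul_le_mul_of_nonneg_right ((mul_le_mul_of_nonneg_left h5 he0.le).trans h4) hxl.le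
      linarith
    have h7 := mul_lt_mul_of_pos_left hUm' (mul_pos hε0 he0)
    linarith
  · have hts : t ≤ s := le_of_lt hs
    have hG := h.gain_combo_floor_le (ht.trans_lt hs) (hc.le_wealthPath hts) hθ0 hθ1 (hY s hts)
    have hθc : 0 ≤ (1 - θ) * c s := mul_nonneg (sub_nonneg.2 hθ1) (hc.nonneg s)
    have hU := h.utility.mul_le_map_mul (hc.nonneg s) (sub_nonneg.2 hθ1) (by linarith)
    simp only [payoffRate]
    by_cases hsE : s ∈ E
    · have hcs : c' s = (1 - θ) * c s + ε := by simp only [hc'def, indicator_of_mem hsE]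
      have h1 : U (m + ε) - U m ≤ U ((1 - θ) * c s + ε) - U ((1 - θ) * c s) := by
        refine h.utility.increment_antitone hθc ?_ hε0.le
        have h2 : c s ≤ m := le_of_lt hsE.2
        have h3 := mul_le_of_le_one_left (hc.nonneg s) (show 1 - θ ≤ 1 by linarith)
        linarith
      have h2 : Real.exp (-β * (T - t)) ≤ Real.exp (-β * (s - t)) := by
        rw [Real.exp_le_exp]
        have := hsE.1.2
        have := h.discount_pos
        nlinarith
      rw [indicator_of_mem hsE, hcs]
      have h3 := mul_le_mul_of_nonneg_right h2 hUinc
      have h4 := mul_le_mul_of_nonneg_left (add_le_add (add_le_add h1 hU) hG)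
        (Real.exp_nonneg (-β * (s - t)))
      linarith
    · have hcs : c' s = (1 - θ) * c s := by
        simp only [hc'def, indicator_of_notMem hsE, add_zero]
      rw [indicator_of_notMem hsE, hcs]
      have h4 := mul_le_mul_of_nonneg_left (add_le_add hU hG) (Real.exp_nonneg (-β * (s - t)))
      linarith

/-- The optimal wealth never reaches the floor. -/
theorem lt_wealthPath_optimal (h : IsConsumptionProblem U G β l γ) (ht : 0 ≤ t) (hx : l < x)
    (hc : IsControl l t x c) (hopt : payoff U G β t x c = consumptionValue U G β l t x) {s : ℝ}
    (hs : t ≤ s) : l < wealthPath t x c s := by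
  -- Consumption at rate at least m on (s, s + 1] must be financed by wealth above the floor at s.
  obtain ⟨m, hm, hmc⟩ := h.exists_pos_le_optimal ht hx hc hopt (s + 1)
  have h1 : m ≤ ∫ r in Ioc s (s + 1), c r := by
    calc m = ∫ r in Ioc s (s + 1), m := by rw [setIntegral_const]; simp
      _ ≤ ∫ r in Ioc s (s + 1), c r := by
        refine setIntegral_mono_ae_restrict (integrableOn_const (by simp))
          hc.integrable.integrableOn ((ae_restrict_iff' measurableSet_Ioc).2 ?_)
        filter_upwards [hmc] with r hr hrs using hr ⟨hs.trans_lt hrs.1, hrs.2⟩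
  have h2 : ∫ r in Ioc s (s + 1), c r ≤ ∫ r in Ioi s, c r :=
    setIntegral_mono_set hc.integrable.integrableOn (Eventually.of_forall hc.nonneg)
      (LE.le.eventuallyLE Ioc_subset_Ioi_self)
  have h3 := (hc.tail hs).integral_le
  linarith

/-- First order lower bound for the value around a point, from spreading a variation of the
initial capital over the consumption on `[t, t + δ]`. -/
theorem exists_value_expansion (h : IsConsumptionProblem U G β l γ) (ht : 0 ≤ t) (hx : l < x)
    (hc : IsControl l t x c) (hopt : payoff U G β t x c = consumptionValue U G β l t x) :
    ∃ L ≥ 0, ∀ δ, 0 < δ → δ ≤ 1 → ∀ ω, 0 < ω → ∃ k₀ > 0, ∀ k, |k| ≤ k₀ →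
      k * (δ⁻¹ * ∫ s in Ioc t (t + δ), Real.exp (-β * (s - t)) * deriv U (c s))
        - (L * δ + ω) * |k| ≤
      consumptionValue U G β l t (x + k) - consumptionValue U G β l t x := by
  obtain ⟨m, hm, hmc⟩ := h.exists_pos_le_optimal ht hx hc hopt (t + 1)
  obtain ⟨Γ, hΓ, hG⟩ := h.exists_gain_bound (t + 1) x
  -- Distance to the floor still left at t + 1. It bounds from below the distance at all earlier
  -- times, so changing wealth by k amounts to a relative change of at most |k|/d, whatever δ is.
  set d := wealthPath t x c (t + 1) - l with hd
  have hd0 : 0 < d := sub_pos.2 (h.lt_wealthPath_optimal ht hx hc hopt (by linarith))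
  refine ⟨Γ / d, by positivity, fun δ hδ hδ1 ω hω => ?_⟩
  obtain ⟨k₁, hk₁, hk₁m, hexp⟩ := h.utility.exists_uniform_expansion hm hω
  refine ⟨min (k₁ * δ) d, by positivity, fun k hk => ?_⟩
  have hkδ : |k / δ| ≤ k₁ := by
    rw [abs_div, abs_of_pos hδ, div_le_iff₀ hδ]
    exact hk.trans (min_le_left _ _)
  have hkd : |k| ≤ d := hk.trans (min_le_right _ _)
  set J := Ioc t (t + δ) with hJ
  have hind : Integrable (J.indicator fun _ => k / δ) :=
    (integrable_indicator_iff measurableSet_Ioc).2 (integrableOn_const (by simp))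
  set b : ℝ → ℝ := fun s => c s + J.indicator (fun _ => k / δ) s with hb
  have hbint : Integrable b := hc.integrable.add hind
  -- The lower bound on c holds only almost everywhere, while controls are nonnegative everywhere;
  -- the maximum changes b after t only on a null set.
  set c' : ℝ → ℝ := fun s => max (b s) 0 with hc'def
  have hae : ∀ᵐ s, s ∈ Ioi t → c' s = b s := by
    filter_upwards [hmc] with s hs hst
    refine max_eq_left ?_
    by_cases hsJ : s ∈ J
    · have h1 := hs ⟨hsJ.1, hsJ.2.trans (by linarith)⟩
      simp only [hb, indicator_of_mem hsJ]
      linarith [neg_abs_le (k / δ)]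
    · simp only [hb, indicator_of_notMem hsJ, add_zero]
      exact hc.nonneg s
  have hc' : IsControl l t (x + k) c' := by
    refine ⟨(hc.measurable.add (measurable_const.indicator measurableSet_Ioc)).max
      measurable_const, fun s => le_max_right _ _, hbint.sup (integrable_zero _ _ _), ?_⟩
    rw [setIntegral_congr_ae measurableSet_Ioi hae, integral_add hc.integrable.integrableOn
      hind.integrableOn, setIntegral_indicator measurableSet_Ioc,
      inter_eq_right.2 Ioc_subset_Ioi_self, setIntegral_const]
    have h1 := hc.integral_le
    have h2 : δ * (k / δ) = k := mul_div_cancel₀ _ hδ.ne'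
    simp [hδ.le, h2]
    linarith
  -- The wealth differs by the part of k not yet spent, so the paths coincide after t + δ.
  have hY : ∀ s, t ≤ s → wealthPath t (x + k) c' s =
      wealthPath t x c s + k * (1 - volume.real (Ioc t s ∩ J) / δ) := by
    intro s hs
    rw [wealthPath, wealthPath, intervalIntegral.integral_of_le hs,
      intervalIntegral.integral_of_le hs, setIntegral_congr_ae (g := b) measurableSet_Ioc
      (by filter_upwards [hae] with r hr hrs using hr hrs.1),
      integral_add hc.integrable.integrableOn hind.integrableOn,
      setIntegral_indicator measurableSet_Ioc, setIntegral_const, smul_eq_mul]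
    ring
  have hρ : ∀ s, volume.real (Ioc t s ∩ J) / δ ≤ 1 := by
    intro s
    rw [div_le_one hδ]
    refine (measureReal_mono inter_subset_right (by simp [hJ])).trans ?_
    simp [hJ, hδ.le]
  have hρ0 : ∀ s, 0 ≤ volume.real (Ioc t s ∩ J) / δ := fun s => by positivity
  -- Per unit of time: the first order gain in utility, its error ω|k/δ|, and the loss |k|Γ/d of
  -- running gain. Over the length δ the two errors become ω|k| and (Γ/d)δ|k|, which explains L =
  -- Γ/d.
  set r : ℝ → ℝ := J.indicator fun s => Real.exp (-β * (s - t)) * deriv U (c s) * (k / δ) -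
    (ω * |k / δ| + |k| * Γ / d) with hr
  have hdint : IntegrableOn (fun s => Real.exp (-β * (s - t)) * deriv U (c s)) J := by
    refine Measure.integrableOn_of_bounded (M := deriv U m) (by simp [hJ])
      (Measurable.mul (by fun_prop)
        ((measurable_deriv U).comp hc.measurable)).aestronglyMeasurable
      ((ae_restrict_iff' measurableSet_Ioc).2 ?_)
    filter_upwards [hmc] with s hs hsJ
    have h1 := hs ⟨hsJ.1, hsJ.2.trans (by linarith)⟩
    have h2 := h.utility.deriv_pos (hm.trans_le h1)
    have h3 : deriv U (c s) ≤ deriv U m :=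
      h.utility.strictAntiOn_deriv.antitoneOn hm (hm.trans_le h1) h1
    have h4 : Real.exp (-β * (s - t)) ≤ 1 := by
      rw [Real.exp_le_one_iff]
      have := h.discount_pos
      have := hsJ.1
      nlinarith
    rw [Real.norm_of_nonneg (by positivity)]
    exact (mul_le_of_le_one_left h2.le h4).trans h3
  have hJfin : volume J ≠ ⊤ := by simp [hJ]
  have hconst : IntegrableOn (fun _ => ω * |k / δ| + |k| * Γ / d) J := integrableOn_const hJfin
  have hrint : IntegrableOn r (Ioi t) :=
    ((integrable_indicator_iff measurableSet_Ioc).2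
      ((hdint.mul_const (k / δ)).sub hconst)).integrableOn
  have key := h.payoff_add_le ht hc hc' 1 hrint ?_
  · have hrval : ∫ s in Ioi t, r s =
        k * (δ⁻¹ * ∫ s in J, Real.exp (-β * (s - t)) * deriv U (c s)) - (Γ / d * δ + ω) * |k| := by
      rw [hr, setIntegral_indicator measurableSet_Ioc, inter_eq_right.2 Ioc_subset_Ioi_self,
        integral_sub (hdint.mul_const (k / δ)) hconst, integral_mul_const, setIntegral_const,
        smul_eq_mul, abs_div, abs_of_pos hδ, Real.volume_real_Ioc_of_le (by linarith)]
      field_simp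
      ring
    have h1 := h.payoff_le_value ht hc'
    rw [hrval, hopt] at key
    linarith
  · rw [ae_restrict_iff' measurableSet_Ioi]
    filter_upwards [hmc, hae] with s hs hcs hst
    have hts : t ≤ s := le_of_lt hst
    have hs0 : 0 < s := ht.trans_lt hst
    rw [one_mul]
    by_cases hsJ : s ∈ J
    · have hs1 : s ≤ t + 1 := hsJ.2.trans (by linarith)
      have hU := hexp (c s) (k / δ) (hs ⟨hsJ.1, hs1⟩) hkδ
      have hcs' : c' s = c s + k / δ := by
        rw [hcs hst]; simp only [hb, indicator_of_mem hsJ]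
      have hYd : d ≤ wealthPath t x c s - l :=
        sub_le_sub_right (hc.antitone_wealthPath hs1) l
      have hGs : G s (wealthPath t x c s) - |k| * Γ / d ≤ G s (wealthPath t (x + k) c' s) := by
        have hGΓ := hG s hs0 hs1 _ (hc.le_wealthPath hts) (hc.wealthPath_le hts)
        have h1 := h.gain_combo_floor_le (θ := |k| / d) (z := wealthPath t (x + k) c' s) hs0
          (hc.le_wealthPath hts) (by positivity) ((div_le_one hd0).2 hkd) (by
            rw [hY s hts]
            have h2 : |k| ≤ |k| / d * (wealthPath t x c s - l) := by
              rw [div_mul_eq_mul_div, le_div_iff₀ hd0]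
              exact mul_le_mul_of_nonneg_left hYd (abs_nonneg k)
            have h3 : -|k| ≤ k * (1 - volume.real (Ioc t s ∩ J) / δ) := by
              have := hρ s
              have := hρ0 s
              have := neg_abs_le k
              have := abs_nonneg k
              nlinarith
            linarith)
        have h2 := mul_le_mul_of_nonneg_left hGΓ (show 0 ≤ |k| / d by positivity)
        have h3 : |k| * Γ / d = |k| / d * Γ := by ring
        linarith
      have hexp1 : Real.exp (-β * (s - t)) ≤ 1 := by
        rw [Real.exp_le_one_iff]
        have := h.discount_pos
        nlinarith
      have hlin : Real.exp (-β * (s - t)) * (ω * |k / δ| + |k| * Γ / d) ≤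
          ω * |k / δ| + |k| * Γ / d := mul_le_of_le_one_left (by positivity) hexp1
      have hsum := mul_le_mul_of_nonneg_left (add_le_add hU hGs) (Real.exp_nonneg (-β * (s - t)))
      simp only [payoffRate, hr, indicator_of_mem hsJ, hcs']
      linarith
    · have hcs' : c' s = c s := by
        rw [hcs hst]; simp only [hb, indicator_of_notMem hsJ, add_zero]
      have hsδ : t + δ < s := by
        by_contra hcon
        exact hsJ ⟨hst, not_lt.1 hcon⟩
      have hYs : wealthPath t (x + k) c' s = wealthPath t x c s := by
        rw [hY s hts, hJ, inter_eq_right.2 (Ioc_subset_Ioc_right hsδ.le),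
          Real.volume_real_Ioc_of_le (by linarith), add_sub_cancel_left, div_self hδ.ne']
        ring
      simp only [payoffRate, hr, indicator_of_notMem hsJ, hcs', hYs, add_zero]
      exact le_rfl

end IsConsumptionProblem

/-! ### Derivatives of concave functions -/

/-- A concave function with almost linear lower expansions at `x` is differentiable there. -/
theorem ConcaveOn.differentiableAt_of_lower_expansion {f : ℝ → ℝ} {l x : ℝ}
    (hf : ConcaveOn ℝ (Ici l) f) (hx : l < x)
    (hexp : ∀ ε > 0, ∃ q, ∃ k₀ > 0, ∀ k, |k| ≤ k₀ → k * q - ε * |k| ≤ f (x + k) - f x) :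
    DifferentiableAt ℝ f x := by
  have hxi : x ∈ interior (Ici l) := by simpa using hx
  have hR := (hf.neg.hasDerivWithinAt_rightDeriv_of_mem_interior hxi).neg
  have hL := (hf.neg.hasDerivWithinAt_leftDeriv_of_mem_interior hxi).neg
  rw [neg_neg] at hR hL
  set R := -derivWithin (-f) (Ioi x) x with hRdef
  set L := -derivWithin (-f) (Iio x) x with hLdef
  have hLR : R ≤ L := neg_le_neg (hf.neg.leftDeriv_le_rightDeriv_of_mem_interior hxi)
  -- The expansion with k > 0 gives q - ε/2 ≤ R, with k < 0 it gives L ≤ q + ε/2; concavity gives R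
  -- ≤ L.
  have heq : L = R := by
    refine le_antisymm (le_of_forall_pos_le_add fun ε hε => ?_) hLR
    obtain ⟨q, k₀, hk₀, hk⟩ := hexp (ε / 2) (half_pos hε)
    have h1 : q - ε / 2 ≤ R := by
      refine ge_of_tendsto ((hasDerivWithinAt_iff_tendsto_slope' self_notMem_Ioi).1 hR) ?_
      filter_upwards [self_mem_nhdsWithin, nhdsWithin_le_nhds (Iio_mem_nhds
        (show x < x + k₀ by linarith))] with y hy hy'
      have hyx : 0 < y - x := sub_pos.2 hy
      have := hk (y - x) (by rw [abs_of_pos hyx]; linarith [mem_Iio.1 hy'])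
      rw [abs_of_pos hyx, add_sub_cancel] at this
      rw [slope_def_field, le_div_iff₀ hyx]
      linarith
    have h2 : L ≤ q + ε / 2 := by
      refine le_of_tendsto ((hasDerivWithinAt_iff_tendsto_slope' self_notMem_Iio).1 hL) ?_
      filter_upwards [self_mem_nhdsWithin, nhdsWithin_le_nhds (Ioi_mem_nhds
        (show x - k₀ < x by linarith))] with y hy hy'
      have hyx : y - x < 0 := sub_neg.2 hy
      have := hk (y - x) (by rw [abs_of_neg hyx]; linarith [mem_Ioi.1 hy'])
      rw [abs_of_neg hyx, add_sub_cancel] at this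
      rw [slope_def_field, div_le_iff_of_neg hyx]
      linarith
    linarith
  have hR' : HasDerivWithinAt f R (Ioi x) x := hR
  have hL' : HasDerivWithinAt f R (Iio x) x := heq ▸ hL
  have := hL'.Iic_of_Iio.union hR'.Ici_of_Ioi
  rw [Iic_union_Ici, hasDerivWithinAt_univ] at this
  exact this.differentiableAt

/-- The expansion bounds difference quotients from below on the right and from above on the left,
and both converge to the derivative. -/
theorem abs_deriv_sub_le_of_lower_expansion {f : ℝ → ℝ} {x q ε k₀ : ℝ}
    (hf : DifferentiableAt ℝ f x) (hk₀ : 0 < k₀)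
    (hk : ∀ k, |k| ≤ k₀ → k * q - ε * |k| ≤ f (x + k) - f x) : |deriv f x - q| ≤ ε := by
  have hd := hf.hasDerivAt
  have h1 : q - ε ≤ deriv f x := by
    refine ge_of_tendsto ((hasDerivWithinAt_iff_tendsto_slope' self_notMem_Ioi).1
      (hd.hasDerivWithinAt (s := Ioi x))) ?_
    filter_upwards [self_mem_nhdsWithin, nhdsWithin_le_nhds (Iio_mem_nhds
      (show x < x + k₀ by linarith))] with y hy hy'
    have hyx : 0 < y - x := sub_pos.2 hy
    have := hk (y - x) (by rw [abs_of_pos hyx]; linarith [mem_Iio.1 hy'])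
    rw [abs_of_pos hyx, add_sub_cancel] at this
    rw [slope_def_field, le_div_iff₀ hyx]
    linarith
  have h2 : deriv f x ≤ q + ε := by
    refine le_of_tendsto ((hasDerivWithinAt_iff_tendsto_slope' self_notMem_Iio).1
      (hd.hasDerivWithinAt (s := Iio x))) ?_
    filter_upwards [self_mem_nhdsWithin, nhdsWithin_le_nhds (Ioi_mem_nhds
      (show x - k₀ < x by linarith))] with y hy hy'
    have hyx : y - x < 0 := sub_neg.2 hy
    have := hk (y - x) (by rw [abs_of_neg hyx]; linarith [mem_Ioi.1 hy'])
    rw [abs_of_neg hyx, add_sub_cancel] at this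
    rw [slope_def_field, div_le_iff_of_neg hyx]
    linarith
  rw [abs_le]
  constructor <;> linarith

/-- The spatial derivative of a family of concave functions that is continuous in the parameter
is jointly continuous. -/
theorem continuousOn_deriv_of_concaveOn {f : ℝ → ℝ → ℝ} {l : ℝ} {S : Set ℝ}
    (hconc : ∀ s ∈ S, ConcaveOn ℝ (Ici l) (f s))
    (hdiff : ∀ s ∈ S, ∀ x, l < x → DifferentiableAt ℝ (f s) x)
    (hcont : ∀ x, l < x → ContinuousOn (fun s => f s x) S) :
    ContinuousOn (fun q : ℝ × ℝ => deriv (f q.1) q.2) (S ×ˢ Ioi l) := by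
  rintro ⟨s, x⟩ ⟨hs, hx⟩
  simp only [mem_Ioi] at hs hx
  have hanti : ∀ r ∈ S, AntitoneOn (deriv (f r)) (Ioi l) := fun r hr =>
    ((hconc r hr).subset Ioi_subset_Ici_self (convex_Ioi l)).antitoneOn_deriv (hdiff r hr)
  have hcq : ∀ z, l < z →
      ContinuousWithinAt (fun q : ℝ × ℝ => f q.1 z) (S ×ˢ Ioi l) (s, x) := fun z hz =>
    ContinuousWithinAt.comp (g := fun r => f r z) (f := Prod.fst) (t := S) (hcont z hz s hs)
      continuousWithinAt_fst fun q hq => hq.1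
  -- Secants over [x + h, x + 2h] (e = 1) and [x - 2h, x - h] (e = -1) avoid x itself. By concavity
  -- the first bounds the derivative below at points left of x + h, the second bounds it above at
  -- points right of x - h. They depend continuously on the parameter and converge to the derivative
  -- at x as h ↓ 0.
  have hquot : ∀ e : ℝ, Tendsto (fun h => (f s (x + 2 * (e * h)) - f s (x + e * h)) / (e * h))
      (𝓝[>] 0) (𝓝 (deriv (f s) x)) ∨ e = 0 := by
    intro e
    rcases eq_or_ne e 0 with he | he
    · exact Or.inr he
    refine Or.inl ?_
    have hd := hasDerivAt_iff_tendsto_slope_zero.1 (hdiff s hs x hx).hasDerivAt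
    have key : ∀ a : ℝ, a ≠ 0 → Tendsto (fun h : ℝ => a * h) (𝓝[>] 0) (𝓝[≠] 0) := by
      intro a ha
      refine tendsto_nhdsWithin_iff.2 ⟨?_, ?_⟩
      · have : Tendsto (fun h : ℝ => a * h) (𝓝 0) (𝓝 (a * 0)) := tendsto_id.const_mul a
        rw [mul_zero] at this
        exact this.mono_left nhdsWithin_le_nhds
      · filter_upwards [self_mem_nhdsWithin] with h hh
        exact mul_ne_zero ha (ne_of_gt hh)
    have h1 := hd.comp (key e he)
    have h2 := hd.comp (key (2 * e) (mul_ne_zero two_ne_zero he))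
    have h3 := (h2.const_mul 2).sub h1
    rw [show 2 * deriv (f s) x - deriv (f s) x = deriv (f s) x by ring] at h3
    refine h3.congr' ?_
    filter_upwards [self_mem_nhdsWithin] with h hh
    have hh' : h ≠ 0 := ne_of_gt hh
    simp only [Function.comp_apply, smul_eq_mul]
    rw [← mul_assoc 2 e h]
    field_simp
    ring
  refine tendsto_order.2 ⟨fun a ha => ?_, fun b hb => ?_⟩
  · have hev := ((hquot 1).resolve_right one_ne_zero).eventually (lt_mem_nhds ha)
    obtain ⟨h, hh, hh0⟩ := (hev.and self_mem_nhdsWithin).exists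
    have hh0 : 0 < h := hh0
    simp only [one_mul] at hh
    have hc : ContinuousWithinAt (fun q : ℝ × ℝ => (f q.1 (x + 2 * h) - f q.1 (x + h)) / h)
        (S ×ˢ Ioi l) (s, x) := by
      exact ((hcq _ (by linarith)).sub (hcq _ (by linarith))).div_const h
    filter_upwards [hc.eventually (lt_mem_nhds hh), self_mem_nhdsWithin,
      nhdsWithin_le_nhds (continuousAt_snd.eventually (gt_mem_nhds (show x < x + h by linarith)))]
      with q hq hqS hqx
    have h1 := (hconc q.1 hqS.1).slope_le_deriv (x := x + h) (y := x + 2 * h)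
      (by simp only [mem_Ici]; linarith) (by simp only [mem_Ici]; linarith) (by linarith)
      (hdiff _ hqS.1 _ (by linarith))
    have h2 := hanti q.1 hqS.1 hqS.2 (show x + h ∈ Ioi l by simp only [mem_Ioi]; linarith) hqx.le
    rw [slope_def_field, show x + 2 * h - (x + h) = h by ring] at h1
    exact hq.trans_le (h1.trans h2)
  · have hev := ((hquot (-1)).resolve_right (by norm_num)).eventually (gt_mem_nhds hb)
    have hsmall : ∀ᶠ h : ℝ in 𝓝[>] 0, h < (x - l) / 2 :=
      nhdsWithin_le_nhds (Iio_mem_nhds (by linarith))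
    obtain ⟨h, ⟨hh, hhs⟩, hh0⟩ := ((hev.and hsmall).and self_mem_nhdsWithin).exists
    have hh0 : 0 < h := hh0
    rw [show x + 2 * (-1 * h) = x - 2 * h by ring, show x + -1 * h = x - h by ring,
      show -1 * h = -h by ring] at hh
    have hc : ContinuousWithinAt (fun q : ℝ × ℝ => (f q.1 (x - 2 * h) - f q.1 (x - h)) / (-h))
        (S ×ˢ Ioi l) (s, x) := by
      exact ((hcq _ (by linarith)).sub (hcq _ (by linarith))).div_const (-h)
    filter_upwards [hc.eventually (gt_mem_nhds hh), self_mem_nhdsWithin,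
      nhdsWithin_le_nhds (continuousAt_snd.eventually (lt_mem_nhds (show x - h < x by linarith)))]
      with q hq hqS hqx
    have h1 := (hconc q.1 hqS.1).deriv_le_slope (x := x - 2 * h) (y := x - h)
      (by simp only [mem_Ici]; linarith) (by simp only [mem_Ici]; linarith) (by linarith)
      (hdiff _ hqS.1 _ (by linarith))
    have h2 := hanti q.1 hqS.1 (show x - h ∈ Ioi l by simp only [mem_Ioi]; linarith) hqS.2 hqx.le
    rw [slope_def_field, show x - h - (x - 2 * h) = h by ring] at h1
    rw [div_neg, ← neg_div, neg_sub] at hq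
    exact (h2.trans h1).trans_lt hq

/-! ### The marginal value and its identity with marginal utility -/

namespace IsConsumptionProblem

variable {U : ℝ → ℝ} {G : ℝ → ℝ → ℝ} {β l γ t x : ℝ} {c : ℝ → ℝ}

/-- An optimal control supplies the expansion; δ makes Lδ at most ε/2, and ω takes the other half.
-/
theorem differentiableAt_value (h : IsConsumptionProblem U G β l γ) (ht : 0 ≤ t) (hx : l < x) :
    DifferentiableAt ℝ (consumptionValue U G β l t) x := by
  obtain ⟨c, hc, hopt⟩ := h.exists_optimal ht hx.le
  obtain ⟨L, hL, hexp⟩ := h.exists_value_expansion ht hx hc hopt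
  refine (h.concaveOn_value ht).differentiableAt_of_lower_expansion hx fun ε hε => ?_
  obtain ⟨δ, hδ, hδ1, hLδ⟩ : ∃ δ, 0 < δ ∧ δ ≤ 1 ∧ L * δ ≤ ε / 2 := by
    refine ⟨min 1 (ε / 2 / (L + 1)), by positivity, min_le_left _ _, ?_⟩
    have h2 : L * min 1 (ε / 2 / (L + 1)) ≤ L * (ε / 2 / (L + 1)) :=
      mul_le_mul_of_nonneg_left (min_le_right _ _) hL
    have h3 : (L + 1) * (ε / 2 / (L + 1)) = ε / 2 := mul_div_cancel₀ _ (by positivity)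
    have h4 : 0 ≤ ε / 2 / (L + 1) := by positivity
    linarith
  obtain ⟨k₀, hk₀, hk⟩ := hexp δ hδ hδ1 (ε / 2) (half_pos hε)
  refine ⟨δ⁻¹ * ∫ s in Ioc t (t + δ), Real.exp (-β * (s - t)) * deriv U (c s), k₀, hk₀,
    fun k hkk => le_trans ?_ (hk k hkk)⟩
  have := abs_nonneg k
  nlinarith

/-- The marginal value is the discounted average marginal utility of optimal consumption over a
short period. -/
theorem tendsto_average_deriv (h : IsConsumptionProblem U G β l γ) (ht : 0 ≤ t) (hx : l < x)
    (hc : IsControl l t x c) (hopt : payoff U G β t x c = consumptionValue U G β l t x) :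
    Tendsto (fun δ => δ⁻¹ * ∫ s in Ioc t (t + δ), Real.exp (-β * (s - t)) * deriv U (c s))
      (𝓝[>] 0) (𝓝 (deriv (consumptionValue U G β l t) x)) := by
  obtain ⟨L, hL, hexp⟩ := h.exists_value_expansion ht hx hc hopt
  rw [tendsto_iff_norm_sub_tendsto_zero]
  refine tendsto_of_tendsto_of_tendsto_of_le_of_le' (h := fun δ => L * δ) tendsto_const_nhds ?_
    (Eventually.of_forall fun δ => norm_nonneg _) ?_
  · have : Tendsto (fun δ : ℝ => L * δ) (𝓝 0) (𝓝 (L * 0)) := tendsto_id.const_mul L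
    rw [mul_zero] at this
    exact this.mono_left nhdsWithin_le_nhds
  · filter_upwards [self_mem_nhdsWithin, nhdsWithin_le_nhds (Iic_mem_nhds one_pos)] with δ hδ hδ1
    -- The average does not involve ω, so for fixed δ the error ω can be sent to 0 and only Lδ
    -- remains.
    refine le_of_forall_pos_le_add fun ω hω => ?_
    obtain ⟨k₀, hk₀, hk⟩ := hexp δ hδ hδ1 ω hω
    have := abs_deriv_sub_le_of_lower_expansion (h.differentiableAt_value ht hx) hk₀ hk
    rwa [Real.norm_eq_abs, abs_sub_comm]

/-- Optimality is inherited by the tails. -/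
theorem optimal_tail (h : IsConsumptionProblem U G β l γ) (ht : 0 ≤ t)
    (hc : IsControl l t x c) (hopt : payoff U G β t x c = consumptionValue U G β l t x) {s : ℝ}
    (hs : t ≤ s) : payoff U G β s (wealthPath t x c s) c =
      consumptionValue U G β l s (wealthPath t x c s) := by
  refine le_antisymm (h.payoff_le_value (ht.trans hs) (hc.tail hs))
    (value_le (hc.le_wealthPath hs) fun c' hc' => ?_)
  classical
  -- Concatenation: a better continuation after s would improve the whole control.
  set d : ℝ → ℝ := (Iic s).piecewise c c' with hd
  have hdc : ∀ r, r ≤ s → d r = c r := fun r hr => piecewise_eq_of_mem _ _ _ hr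
  have hdc' : ∀ r, s < r → d r = c' r := fun r hr => piecewise_eq_of_notMem _ _ _ (not_le.2 hr)
  have hdint : Integrable d :=
    Integrable.piecewise measurableSet_Iic hc.integrable.integrableOn hc'.integrable.integrableOn
  have hIoc : ∀ r, t ≤ r → r ≤ s → wealthPath t x d r = wealthPath t x c r := by
    intro r hr hrs
    rw [wealthPath, wealthPath, intervalIntegral.integral_of_le hr,
      intervalIntegral.integral_of_le hr,
      setIntegral_congr_fun measurableSet_Ioc fun u hu => hdc u (hu.2.trans hrs)]
  have hdC : IsControl l t x d := by
    refine ⟨hc.measurable.piecewise measurableSet_Iic hc'.measurable, fun r => ?_, hdint, ?_⟩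
    · rcases le_or_gt r s with hr | hr
      · rw [hdc r hr]; exact hc.nonneg r
      · rw [hdc' r hr]; exact hc'.nonneg r
    · rw [← Ioc_union_Ioi_eq_Ioi hs, setIntegral_union (Ioc_disjoint_Ioi le_rfl)
        measurableSet_Ioi hdint.integrableOn hdint.integrableOn,
        setIntegral_congr_fun measurableSet_Ioc fun u hu => hdc u hu.2,
        setIntegral_congr_fun measurableSet_Ioi fun u hu => hdc' u hu]
      have := hc'.integral_le
      rw [wealthPath, intervalIntegral.integral_of_le hs] at this
      linarith
  have h1 := h.payoff_le_value ht hdC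
  rw [← hopt, h.payoff_split ht hdC hs, h.payoff_split ht hc hs, hIoc s hs le_rfl] at h1
  have h2 : ∫ r in Ioc t s, payoffRate U G β t x d r = ∫ r in Ioc t s, payoffRate U G β t x c r :=
    setIntegral_congr_fun measurableSet_Ioc fun r hr => by
      simp only [payoffRate, hdc r hr.2, hIoc r hr.1.le hr.2]
  have h3 : payoff U G β s (wealthPath t x c s) d = payoff U G β s (wealthPath t x c s) c' := by
    refine setIntegral_congr_fun measurableSet_Ioi fun r hr => ?_
    simp only [payoffRate, wealthPath, hdc' r hr]
    rw [intervalIntegral.integral_of_le (le_of_lt hr), intervalIntegral.integral_of_le (le_of_lt hr),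
      setIntegral_congr_fun measurableSet_Ioc fun u hu => hdc' u hu.1]
  rw [h2, h3] at h1
  exact le_of_mul_le_mul_left (by linarith) (Real.exp_pos (-β * (s - t)))

/-- Along an optimal path, marginal utility equals marginal value almost everywhere. -/
theorem deriv_utility_optimal (h : IsConsumptionProblem U G β l γ) (ht : 0 ≤ t) (hx : l < x)
    (hc : IsControl l t x c) (hopt : payoff U G β t x c = consumptionValue U G β l t x) :
    ∀ᵐ s, t < s → 0 < c s ∧
      deriv U (c s) = deriv (consumptionValue U G β l s) (wealthPath t x c s) := by
  set f : ℝ → ℝ := fun r => Real.exp (-β * r) * deriv U (c r) with hf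
  have hfint : ∀ T, IntegrableOn f (Ioc t T) := by
    intro T
    obtain ⟨m, hm, hmc⟩ := h.exists_pos_le_optimal ht hx hc hopt T
    refine Measure.integrableOn_of_bounded (M := deriv U m) (by simp)
      (Measurable.mul (by fun_prop)
        ((measurable_deriv U).comp hc.measurable)).aestronglyMeasurable
      ((ae_restrict_iff' measurableSet_Ioc).2 ?_)
    filter_upwards [hmc] with s hs hsT
    have h1 := hs hsT
    have h2 := h.utility.deriv_pos (hm.trans_le h1)
    have h3 : deriv U (c s) ≤ deriv U m :=
      h.utility.strictAntiOn_deriv.antitoneOn hm (hm.trans_le h1) h1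
    have h4 : Real.exp (-β * s) ≤ 1 := by
      rw [Real.exp_le_one_iff]
      have := h.discount_pos
      have : 0 ≤ s := ht.trans hsT.1.le
      nlinarith
    rw [Real.norm_of_nonneg (by positivity)]
    exact (mul_le_of_le_one_left h2.le h4).trans h3
  have hI : ∀ T, t ≤ T → IntervalIntegrable f volume t T := fun T hT =>
    (intervalIntegrable_iff_integrableOn_Ioc_of_le hT).2 (hfint T)
  have hLeb : ∀ᵐ s, ∀ n : ℕ, s ∈ uIcc t (t + n) → ∀ a ∈ uIcc t (t + n),
      HasDerivAt (fun x => ∫ r in a..x, f r) (f s) s :=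
    ae_all_iff.2 fun n => (hI (t + n) (by simp)).ae_hasDerivAt_integral
  have hpos : ∀ᵐ s, ∀ n : ℕ, s ∈ Ioc t (t + n) → 0 < c s := ae_all_iff.2 fun n => by
    obtain ⟨m, hm, hmc⟩ := h.exists_pos_le_optimal ht hx hc hopt (t + n)
    filter_upwards [hmc] with s hs hst using hm.trans_le (hs hst)
  filter_upwards [hLeb, hpos] with s hs hcs hts
  obtain ⟨n, hn⟩ := exists_nat_ge (s - t)
  have hsn : s ∈ Ioc t (t + n) := ⟨hts, by linarith⟩
  refine ⟨hcs n hsn, ?_⟩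
  have hder := hs n (by rw [uIcc_of_le (by simp)]; exact Ioc_subset_Icc_self hsn) t left_mem_uIcc
  have h1 := (hasDerivAt_iff_tendsto_slope_zero.1 hder).mono_left
    (nhdsWithin_mono 0 (fun y hy => ne_of_gt hy : Ioi (0 : ℝ) ⊆ {0}ᶜ))
  have h2 := h.tendsto_average_deriv (ht.trans hts.le)
    (h.lt_wealthPath_optimal ht hx hc hopt hts.le) (hc.tail hts.le)
    (h.optimal_tail ht hc hopt hts.le)
  have h3 := h2.const_mul (Real.exp (-β * s))
  -- The same averages have two limits: f s by Lebesgue differentiation, and the discounted marginal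
  -- value by `tendsto_average_deriv` for the tail problem started at s.
  have h4 : f s = Real.exp (-β * s) * deriv (consumptionValue U G β l s) (wealthPath t x c s) := by
    refine tendsto_nhds_unique h1 (h3.congr' ?_)
    filter_upwards [self_mem_nhdsWithin] with δ hδ
    have hδ : 0 < δ := hδ
    rw [intervalIntegral.integral_interval_sub_left (hI _ (by linarith)) (hI _ hts.le),
      intervalIntegral.integral_of_le (by linarith), smul_eq_mul, mul_left_comm,
      ← integral_const_mul]
    congr 1
    refine setIntegral_congr_fun measurableSet_Ioc fun r _ => ?_
    simp only [hf]
    rw [← mul_assoc, ← Real.exp_add]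
    ring_nf
  exact mul_left_cancel₀ (Real.exp_pos _).ne' h4

/-- Divide `value_increment_ge` by d and let d ↓ 0. The left side is positive and explodes at the
floor, which yields both the sign and the blow-up of the marginal value. -/
theorem deriv_value_ge (h : IsConsumptionProblem U G β l γ) (ht : 0 ≤ t) (hx : l < x) :
    Real.exp (-β) / 2 * deriv U (2 * (x - l)) ≤ deriv (consumptionValue U G β l t) x := by
  have hx2 : 0 < 2 * (x - l) := by linarith
  have h1 := ((hasDerivAt_iff_tendsto_slope_zero.1 (h.utility.hasDerivAt hx2)).mono_left
    (nhdsWithin_mono 0 (fun y hy => ne_of_gt hy : Ioi (0 : ℝ) ⊆ {0}ᶜ))).const_mul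
      (Real.exp (-β) / 2)
  have h2 := (hasDerivAt_iff_tendsto_slope_zero.1
    (h.differentiableAt_value ht hx).hasDerivAt).mono_left
    (nhdsWithin_mono 0 (fun y hy => ne_of_gt hy : Ioi (0 : ℝ) ⊆ {0}ᶜ))
  refine le_of_tendsto_of_tendsto h1 h2 ?_
  filter_upwards [self_mem_nhdsWithin] with d hd
  have hd : 0 < d := hd
  have h3 := h.value_increment_ge ht hx hd.le
  simp only [smul_eq_mul]
  rw [mul_left_comm]
  exact mul_le_mul_of_nonneg_left h3 (inv_nonneg.2 hd.le)

theorem deriv_value_pos (h : IsConsumptionProblem U G β l γ) (ht : 0 ≤ t) (hx : l < x) :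
    0 < deriv (consumptionValue U G β l t) x :=
  (mul_pos (by positivity) (h.utility.deriv_pos (by linarith))).trans_le (h.deriv_value_ge ht hx)

theorem tendsto_deriv_value (h : IsConsumptionProblem U G β l γ) (ht : 0 ≤ t) :
    Tendsto (deriv (consumptionValue U G β l t)) (𝓝[>] l) atTop := by
  have h1 : Tendsto (fun x => 2 * (x - l)) (𝓝[>] l) (𝓝[>] 0) := by
    refine tendsto_nhdsWithin_iff.2 ⟨?_, ?_⟩
    · have : Continuous fun x : ℝ => 2 * (x - l) := by fun_prop
      have h0 := this.tendsto l
      rw [sub_self, mul_zero] at h0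
      exact h0.mono_left nhdsWithin_le_nhds
    · filter_upwards [self_mem_nhdsWithin] with x hx
      have : l < x := hx
      simp only [mem_Ioi]
      linarith
  refine tendsto_atTop_mono' _ ?_ ((h.utility.inada_zero.comp h1).const_mul_atTop
    (show 0 < Real.exp (-β) / 2 by positivity))
  filter_upwards [self_mem_nhdsWithin] with x hx using h.deriv_value_ge ht hx

theorem continuousOn_deriv_value (h : IsConsumptionProblem U G β l γ) :
    ContinuousOn (fun q : ℝ × ℝ => deriv (consumptionValue U G β l q.1) q.2) (Ici 0 ×ˢ Ioi l) :=
  continuousOn_deriv_of_concaveOn (fun _ hs => h.concaveOn_value hs)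
    (fun _ hs _ hx => h.differentiableAt_value hs hx) fun _ hx => h.continuousOn_value_time hx.le

end IsConsumptionProblem

/-! ### The feedback and the closed loop equation -/

/-- The optimal consumption in feedback form. -/
noncomputable def consumptionFeedback (U : ℝ → ℝ) (G : ℝ → ℝ → ℝ) (β l t : ℝ) : ℝ → ℝ :=
  (Ioi l).indicator fun x => inverseMarginal U (deriv (consumptionValue U G β l t) x)

/-- Solutions on `[t, ∞)` of the closed loop equation `Y' = -f(s, Y)`, `Y t = x`. -/
def IsClosedLoop (f : ℝ → ℝ → ℝ) (t x : ℝ) (Y : ℝ → ℝ) : Prop :=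
  Y t = x ∧ ∀ s, t ≤ s → HasDerivWithinAt Y (-f s (Y s)) (Ici t) s

/-- Uniqueness for decreasing right-hand sides. -/
theorem IsClosedLoop.eqOn {f : ℝ → ℝ → ℝ} {t x : ℝ} {Y Z : ℝ → ℝ}
    (hf : ∀ s, t ≤ s → Monotone (f s)) (hY : IsClosedLoop f t x Y) (hZ : IsClosedLoop f t x Z) :
    EqOn Y Z (Ici t) := by
  -- The derivative equals -2(Y - Z)(f(Y) - f(Z)) ≤ 0. Monotonicity alone is enough; no Lipschitz
  -- bound near the floor is required.
  have hder : ∀ s, t ≤ s → HasDerivWithinAt (fun s => (Y s - Z s) ^ 2)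
      (2 * (Y s - Z s) * (-f s (Y s) - -f s (Z s))) (Ici t) s := fun s hs => by
    exact (((hY.2 s hs).fun_sub (hZ.2 s hs)).fun_pow 2).congr_deriv (by simp)
  have hanti : AntitoneOn (fun s => (Y s - Z s) ^ 2) (Ici t) := by
    refine antitoneOn_of_deriv_nonpos (convex_Ici t) (fun s hs => (hder s hs).continuousWithinAt)
      (fun s hs => ?_) fun s hs => ?_
    · rw [interior_Ici] at hs ⊢
      exact ((hder s (le_of_lt hs)).mono Ioi_subset_Ici_self).differentiableWithinAt
    · rw [interior_Ici] at hs
      rw [((hder s (le_of_lt hs)).hasDerivAt (Ici_mem_nhds hs)).deriv]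
      rcases le_total (Y s) (Z s) with hle | hle
      · have := hf s (le_of_lt hs) hle
        nlinarith
      · have := hf s (le_of_lt hs) hle
        nlinarith
  intro s hs
  have h1 := hanti self_mem_Ici hs hs
  simp only [hY.1, hZ.1, sub_self] at h1
  have h2 : (Y s - Z s) ^ 2 = 0 := le_antisymm (by simpa using h1) (sq_nonneg _)
  exact sub_eq_zero.1 (pow_eq_zero_iff two_ne_zero |>.1 h2)

theorem hasDerivWithinAt_sub_integral {φ : ℝ → ℝ} {t : ℝ} (hφ : ContinuousOn φ (Ici t)) (x : ℝ)
    {s : ℝ} (hs : t ≤ s) :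
    HasDerivWithinAt (fun r => x - ∫ u in t..r, φ u) (-φ s) (Ici t) s := by
  -- Constant extension to the left of t, so that the fundamental theorem applies at t too.
  set ψ : ℝ → ℝ := fun u => φ (max u t) with hψ
  have hψc : Continuous ψ := hφ.comp_continuous (continuous_id.max continuous_const)
    fun u => mem_Ici.2 (le_max_right _ _)
  have h1 : HasDerivAt (fun r => x - ∫ u in t..r, ψ u) (-ψ s) s :=
    (hψc.integral_hasStrictDerivAt t s).hasDerivAt.const_sub x
  have h2 : ∀ r, t ≤ r → x - ∫ u in t..r, φ u = x - ∫ u in t..r, ψ u := by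
    intro r hr
    congr 1
    refine intervalIntegral.integral_congr fun u hu => ?_
    rw [uIcc_of_le hr] at hu
    simp only [hψ, max_eq_left hu.1]
  have h3 : ψ s = φ s := by simp only [hψ, max_eq_left hs]
  rw [← h3]
  exact h1.hasDerivWithinAt.congr (fun r hr => h2 r hr) (h2 s hs)

namespace IsConsumptionProblem

variable {U : ℝ → ℝ} {G : ℝ → ℝ → ℝ} {β l γ t x : ℝ} {c : ℝ → ℝ}

theorem feedback_of_lt (hx : l < x) : consumptionFeedback U G β l t x =
    inverseMarginal U (deriv (consumptionValue U G β l t) x) :=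
  indicator_of_mem (mem_Ioi.2 hx) _

theorem feedback_of_le (hx : x ≤ l) : consumptionFeedback U G β l t x = 0 :=
  indicator_of_notMem (not_lt.2 hx) _

theorem feedback_pos (h : IsConsumptionProblem U G β l γ) (ht : 0 ≤ t) (hx : l < x) :
    0 < consumptionFeedback U G β l t x := by
  rw [feedback_of_lt hx]
  exact h.utility.inverseMarginal_pos (h.deriv_value_pos ht hx)

/-- Concavity makes the marginal value nonincreasing, and the inverse marginal utility is
decreasing; up to the floor the feedback is 0. This monotonicity is what gives uniqueness for the
closed loop equation. -/
theorem monotone_feedback (h : IsConsumptionProblem U G β l γ) (ht : 0 ≤ t) :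
    Monotone (consumptionFeedback U G β l t) := by
  intro x y hxy
  rcases le_or_gt x l with hx | hx
  · rw [feedback_of_le hx]
    rcases le_or_gt y l with hy | hy
    · rw [feedback_of_le hy]
    · exact (h.feedback_pos ht hy).le
  · have hy := hx.trans_le hxy
    rw [feedback_of_lt hx, feedback_of_lt hy]
    refine h.utility.strictAntiOn_inverseMarginal.antitoneOn (h.deriv_value_pos ht hy)
      (h.deriv_value_pos ht hx) ?_
    exact ((h.concaveOn_value ht).subset Ioi_subset_Ici_self (convex_Ioi l)).antitoneOn_deriv
      (fun z hz => h.differentiableAt_value ht hz) hx hy hxy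

theorem continuousOn_feedback (h : IsConsumptionProblem U G β l γ) :
    ContinuousOn (fun q : ℝ × ℝ => consumptionFeedback U G β l q.1 q.2) (Ici 0 ×ˢ Ioi l) := by
  refine ContinuousOn.congr (f := fun q : ℝ × ℝ =>
    inverseMarginal U (deriv (consumptionValue U G β l q.1) q.2)) ?_
    fun q hq => feedback_of_lt hq.2
  exact h.utility.continuousOn_inverseMarginal.comp h.continuousOn_deriv_value
    fun q hq => h.deriv_value_pos hq.1 hq.2

theorem measurable_feedback (h : IsConsumptionProblem U G β l γ) :
    Measurable fun q : Ici (0 : ℝ) × Ici l => consumptionFeedback U G β l q.1 q.2 := by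
  have h1 : Measurable ((Ici (0 : ℝ) ×ˢ Ioi l).indicator
      fun q : ℝ × ℝ => consumptionFeedback U G β l q.1 q.2) := by
    classical
    rw [← piecewise_eq_indicator]
    exact h.continuousOn_feedback.measurable_piecewise continuousOn_const
      (measurableSet_Ici.prod measurableSet_Ioi)
  have h2 : Measurable fun q : Ici (0 : ℝ) × Ici l => ((q.1 : ℝ), (q.2 : ℝ)) :=
    (measurable_subtype_coe.comp measurable_fst).prodMk
      (measurable_subtype_coe.comp measurable_snd)
  convert h1.comp h2 using 2 with q
  by_cases hq : l < (q.2 : ℝ)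
  · rw [Function.comp_apply, indicator_of_mem
      (show ((q.1 : ℝ), (q.2 : ℝ)) ∈ Ici 0 ×ˢ Ioi l from ⟨q.1.2, hq⟩)]
  · rw [Function.comp_apply, indicator_of_notMem (fun hmem => hq hmem.2),
      feedback_of_le (not_lt.1 hq)]

/-- Optimal controls are given by the feedback, and optimal paths solve the closed loop
equation. -/
theorem optimal_eq_feedback (h : IsConsumptionProblem U G β l γ) (ht : 0 ≤ t)
    (hc : IsControl l t x c) (hopt : payoff U G β t x c = consumptionValue U G β l t x) :
    (∀ᵐ s, t < s → c s = consumptionFeedback U G β l s (wealthPath t x c s)) ∧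
      IsClosedLoop (consumptionFeedback U G β l) t x (wealthPath t x c) := by
  -- Started at the floor, nothing can be consumed and the path is constant, in agreement with the
  -- value 0 of the feedback there.
  rcases hc.floor_le.eq_or_lt with hx | hx
  · have hY : ∀ s, t ≤ s → wealthPath t x c s = l := fun s hs =>
      le_antisymm ((hc.wealthPath_le hs).trans_eq hx.symm) (hc.le_wealthPath hs)
    have h0 : ∫ s in Ioi t, c s = 0 := le_antisymm (by linarith [hc.integral_le])
      (setIntegral_nonneg measurableSet_Ioi fun s _ => hc.nonneg s)
    rw [integral_eq_zero_iff_of_nonneg hc.nonneg hc.integrable.integrableOn] at h0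
    refine ⟨?_, IsControl.wealthPath_self, fun s hs => ?_⟩
    · filter_upwards [(ae_restrict_iff' measurableSet_Ioi).1 h0] with s hs hst
      rw [hs hst, hY s (le_of_lt hst), feedback_of_le le_rfl, Pi.zero_apply]
    · rw [hY s hs, feedback_of_le le_rfl, neg_zero]
      exact (hasDerivWithinAt_const s (Ici t) l).congr (fun r hr => hY r hr) (hY s hs)
  · have hae : ∀ᵐ s, t < s → c s = consumptionFeedback U G β l s (wealthPath t x c s) := by
      filter_upwards [h.deriv_utility_optimal ht hx hc hopt] with s hs hst
      rw [feedback_of_lt (h.lt_wealthPath_optimal ht hx hc hopt hst.le), ← (hs hst).2,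
        h.utility.inverseMarginal_deriv (hs hst).1]
    refine ⟨hae, IsControl.wealthPath_self, fun s hs => ?_⟩
    have hφ : ContinuousOn (fun s => consumptionFeedback U G β l s (wealthPath t x c s))
        (Ici t) := by
      refine h.continuousOn_feedback.comp (f := fun s => (s, wealthPath t x c s))
        (continuous_id.prodMk hc.continuous_wealthPath).continuousOn fun s hs => ?_
      exact ⟨ht.trans hs, h.lt_wealthPath_optimal ht hx hc hopt hs⟩
    -- The feedback identity holds only almost everywhere, but along the path the feedback is
    -- continuous, so the integrated equation can be differentiated at every time.
    have hint : ∀ r, t ≤ r → wealthPath t x c r =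
        x - ∫ u in t..r, consumptionFeedback U G β l u (wealthPath t x c u) := by
      intro r hr
      rw [wealthPath, intervalIntegral.integral_of_le hr, intervalIntegral.integral_of_le hr,
        setIntegral_congr_ae measurableSet_Ioc]
      filter_upwards [hae] with u hu hur using hu hur.1
    exact (hasDerivWithinAt_sub_integral hφ x hs).congr (fun r hr => hint r hr) (hint s hs)

end IsConsumptionProblem

/-! ### The market: supports of the returns, one-step moments, predictable processes -/

namespace IlliquidMarket

variable {Ω : Type*} [MeasurableSpace Ω] {P : Measure Ω}

theorem zu_toReal_pos (M : IlliquidMarket Ω P) (h : M.zu ≠ ⊤) : 0 < M.zu.toReal :=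
  ENNReal.toReal_pos M.zu_pos.ne' h

theorem Ioo_zl_subset_support (M : IlliquidMarket Ω P) {t : ℝ}
    (h : interior (M.p t).support = {z : ℝ | -M.zl < z ∧ ENNReal.ofReal z < M.zu}) :
    Ioo (-M.zl) 0 ⊆ (M.p t).support := fun z hz => by
  refine interior_subset ?_
  rw [h]
  exact ⟨hz.1, by rw [ENNReal.ofReal_of_nonpos hz.2.le]; exact M.zu_pos⟩

theorem neg_zl_mem_support (M : IlliquidMarket Ω P) {t : ℝ} (ht : 0 < t) :
    -M.zl ∈ (M.p t).support := by
  rcases M.support_p t ht with ⟨-, h⟩ | ⟨-, -, h, -⟩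
  · refine closure_minimal (M.Ioo_zl_subset_support h) Measure.isClosed_support ?_
    have := M.zl_pos
    rw [closure_Ioo (by linarith)]
    exact ⟨le_rfl, by linarith⟩
  · exact h.1

theorem exists_pos_mem_support (M : IlliquidMarket Ω P) {t : ℝ} (ht : 0 < t) :
    ∃ z ∈ (M.p t).support, 0 < z := by
  rcases M.support_p t ht with ⟨-, h⟩ | ⟨hu, -, -, h⟩
  · obtain ⟨r, hr0, hr⟩ := ENNReal.lt_iff_exists_nnreal_btwn.1 M.zu_pos
    have hr0 : 0 < (r : ℝ) := by exact_mod_cast hr0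
    refine ⟨r, interior_subset (h ▸ ⟨?_, ?_⟩), hr0⟩
    · linarith [M.zl_pos]
    · simpa using hr
  · exact ⟨_, h.1, M.zu_toReal_pos hu⟩

theorem neg_zl_le_of_mem_support (M : IlliquidMarket Ω P) {t z : ℝ} (ht : 0 < t)
    (hz : z ∈ (M.p t).support) : -M.zl ≤ z := by
  rcases M.support_p t ht with ⟨hc, h⟩ | ⟨-, -, h, -⟩
  · by_contra! hlt
    have h1 : Ioo z (-M.zl) ⊆ interior (M.p t).support := interior_maximal
      (Ioo_subset_Icc_self.trans (hc.out hz (M.neg_zl_mem_support ht))) isOpen_Ioo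
    obtain ⟨y, hy⟩ := exists_between hlt
    have h2 := h1 hy
    rw [h] at h2
    exact lt_asymm h2.1 hy.2
  · exact h.2 hz

theorem le_zu_of_mem_support (M : IlliquidMarket Ω P) {t z : ℝ} (ht : 0 < t)
    (hz : z ∈ (M.p t).support) (hu : M.zu ≠ ⊤) : z ≤ M.zu.toReal := by
  rcases M.support_p t ht with ⟨hc, h⟩ | ⟨-, -, -, h⟩
  · by_contra! hlt
    have h1 : Ioo (-M.zl) z ⊆ interior (M.p t).support := interior_maximal
      (Ioo_subset_Icc_self.trans (hc.out (M.neg_zl_mem_support ht) hz)) isOpen_Ioo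
    obtain ⟨y, hy⟩ := exists_between hlt
    have hy0 : 0 < y := (M.zu_toReal_pos hu).trans hy.1
    have h2 := h1 ⟨by linarith [M.zl_pos], hy.2⟩
    rw [h] at h2
    have h3 := (ENNReal.ofReal_lt_iff_lt_toReal hy0.le hu).1 h2.2
    exact lt_asymm h3 hy.1
  · exact h.2 hz

theorem l_nonneg (M : IlliquidMarket Ω P) {a : ℝ} (ha : a ∈ M.investments) : 0 ≤ M.l a := by
  unfold l
  have := M.zl_pos
  split_ifs with hu
  · exact mul_nonneg (ha hu) this.le
  · have h2 := M.zu_toReal_pos hu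
    rcases le_total 0 a with h0 | h0
    · exact le_max_of_le_left (mul_nonneg h0 this.le)
    · exact le_max_of_le_right (mul_nonneg (neg_nonneg.2 h0) h2.le)

theorem nonneg_of_mem_support (M : IlliquidMarket Ω P) {t z a x : ℝ} (ht : 0 < t)
    (ha : a ∈ M.investments) (hx : M.l a ≤ x) (hz : z ∈ (M.p t).support) : 0 ≤ x + a * z := by
  have h1 := M.neg_zl_le_of_mem_support ht hz
  have hx' : a * M.zl ≤ x := by
    unfold l at hx
    split_ifs at hx with hu
    · exact hx
    · exact (le_max_left _ _).trans hx
  rcases le_or_gt 0 a with h0 | h0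
  · nlinarith
  · have hu : M.zu ≠ ⊤ := fun hu => not_le.2 h0 (ha hu)
    have h2 := M.le_zu_of_mem_support ht hz hu
    have h3 : -a * M.zu.toReal ≤ x := by
      rw [l, if_neg hu] at hx
      exact (le_max_right _ _).trans hx
    nlinarith

theorem ae_mem_support (M : IlliquidMarket Ω P) (t : ℝ) : ∀ᵐ z ∂(M.p t), z ∈ (M.p t).support :=
  Measure.support_mem_ae

/-- The set where w + αz ≥ 0 is closed, so an almost sure inequality reaches the whole support. -/
theorem forall_support_nonneg (M : IlliquidMarket Ω P) {t w α : ℝ}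
    (h : ∀ᵐ z ∂(M.p t), 0 ≤ w + α * z) : ∀ z ∈ (M.p t).support, 0 ≤ w + α * z :=
  Measure.support_subset_of_isClosed
    (isClosed_le continuous_const (by fun_prop : Continuous fun z : ℝ => w + α * z)) h

/-- The support contains the negative point -zl and a positive point; whatever the sign of α, at one
of them αz ≤ 0. -/
theorem capital_nonneg (M : IlliquidMarket Ω P) {t w α : ℝ} (ht : 0 < t)
    (h : ∀ z ∈ (M.p t).support, 0 ≤ w + α * z) : 0 ≤ w := by
  have h1 := h _ (M.neg_zl_mem_support ht)
  obtain ⟨z, hz, hz0⟩ := M.exists_pos_mem_support ht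
  have h2 := h z hz
  have := M.zl_pos
  rcases le_total 0 α with h0 | h0 <;> nlinarith

/-- The growth factor of capital over a waiting time `t`. -/
noncomputable def growthFactor (M : IlliquidMarket Ω P) (t : ℝ) : ℝ :=
  M.k * Real.exp (M.b * t) / M.zl

theorem growthFactor_nonneg (M : IlliquidMarket Ω P) (t : ℝ) : 0 ≤ M.growthFactor t :=
  div_nonneg (mul_nonneg M.k_nonneg (Real.exp_nonneg _)) M.zl_pos.le

/-- One-step estimate: expected power utility of wealth after a return is controlled by the
capital before it. -/
theorem lintegral_rpow_le (M : IlliquidMarket Ω P) {t w α γ : ℝ} (ht : 0 < t) (hγ : 0 < γ)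
    (hγ1 : γ < 1) (h : ∀ z ∈ (M.p t).support, 0 ≤ w + α * z) :
    ∫⁻ z, ENNReal.ofReal ((w + α * z) ^ γ) ∂(M.p t)
      ≤ ENNReal.ofReal ((w * M.growthFactor t) ^ γ) := by
  have := M.markov
  have hzl := M.zl_pos
  have hw := M.capital_nonneg ht h
  have hα : α * M.zl ≤ w := by linarith [h _ (M.neg_zl_mem_support ht)]
  have hint := M.integrable_p t ht
  set m := ∫ z, z ∂(M.p t) with hm
  have hm0 : 0 ≤ m := M.mean_nonneg t ht
  have hmean : 1 + m ≤ M.k * Real.exp (M.b * t) := by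
    have := M.mean_le t ht
    rw [integral_add (integrable_const _) hint] at this
    simpa using this
  set B := w * M.growthFactor t with hB
  -- Nonnegativity at z = -zl gives α ≤ w/zl; with m ≥ 0 and zl ≤ 1 the mean wealth is at most w(1 +
  -- m)/zl.
  have hwm : w + α * m ≤ B := by
    have h1 : w * (1 + m) / M.zl ≤ B := by
      rw [hB, growthFactor, mul_div_assoc]
      exact mul_le_mul_of_nonneg_left (div_le_div_of_nonneg_right hmean hzl.le) hw
    refine le_trans ?_ h1
    rw [le_div_iff₀ hzl]
    have h2 := mul_le_mul_of_nonneg_right hα hm0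
    have h3 := mul_le_mul_of_nonneg_left M.zl_le_one hw
    nlinarith
  have hB0 : 0 ≤ B := mul_nonneg hw (M.growthFactor_nonneg t)
  have hae : ∀ᵐ z ∂(M.p t), 0 ≤ w + α * z := (M.ae_mem_support t).mono h
  -- If B = 0 then w = 0, because the growth factor is positive, and nonnegativity on both sides of
  -- 0 forces α = 0.
  rcases hB0.eq_or_lt with hB1 | hB1
  · have hg : 0 < M.growthFactor t := div_pos (by linarith) hzl
    have hw0 : w = 0 := by
      rcases mul_eq_zero.1 hB1.symm with h0 | h0
      · exact h0
      · exact absurd h0 hg.ne'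
    obtain ⟨z, hz, hz0⟩ := M.exists_pos_mem_support ht
    have hα0 : α = 0 := by
      have h1 := h z hz
      rw [hw0] at h1 hα
      refine le_antisymm ?_ ?_ <;> by_contra! hcon <;> nlinarith
    simp [hw0, hα0, Real.zero_rpow hγ.ne']
  -- Jensen's inequality through the tangent of y^γ at B: its expectation is at most B^γ since the
  -- mean is at most B.
  · have hpt : ∀ y, 0 ≤ y → y ^ γ ≤ B ^ γ * (γ * (y / B) + (1 - γ)) := by
      intro y hy
      have h1 := Real.geom_mean_le_arith_mean2_weighted hγ.le (sub_nonneg.2 hγ1.le)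
        (div_nonneg hy hB0) zero_le_one (by ring)
      rw [Real.one_rpow, mul_one, mul_one, Real.div_rpow hy hB0,
        div_le_iff₀ (Real.rpow_pos_of_pos hB1 γ)] at h1
      linarith
    have hi : Integrable (fun z => w + α * z) (M.p t) :=
      (integrable_const _).add (hint.const_mul α)
    have hi2 : Integrable (fun z => B ^ γ * (γ * ((w + α * z) / B) + (1 - γ))) (M.p t) :=
      (((hi.div_const B).const_mul γ).add (integrable_const _)).const_mul _
    calc ∫⁻ z, ENNReal.ofReal ((w + α * z) ^ γ) ∂(M.p t)
        ≤ ∫⁻ z, ENNReal.ofReal (B ^ γ * (γ * ((w + α * z) / B) + (1 - γ))) ∂(M.p t) :=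
          lintegral_mono_ae (hae.mono fun z hz => ENNReal.ofReal_le_ofReal (hpt _ hz))
      _ = ENNReal.ofReal (∫ z, B ^ γ * (γ * ((w + α * z) / B) + (1 - γ)) ∂(M.p t)) := by
          refine (ofReal_integral_eq_lintegral_ofReal hi2 (hae.mono fun z hz => ?_)).symm
          have : 0 ≤ 1 - γ := by linarith
          positivity
      _ ≤ ENNReal.ofReal (B ^ γ) := by
          refine ENNReal.ofReal_le_ofReal ?_
          rw [integral_const_mul, integral_add ((hi.div_const B).const_mul γ) (integrable_const _),
            integral_const_mul, integral_div, integral_add (integrable_const _)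
            (hint.const_mul α), integral_const_mul, ← hm]
          simp only [integral_const, probReal_univ, smul_eq_mul, one_mul]
          refine mul_le_of_le_one_right (by positivity) ?_
          have : (w + α * m) / B ≤ 1 := (div_le_one hB1).2 hwm
          nlinarith

/-- The observations up to and including date `n`. -/
def past (M : IlliquidMarket Ω P) (n : ℕ) (ω : Ω) : Fin (n + 1) → ℝ × ℝ :=
  fun i => (M.τ i ω, M.Z i ω)

theorem measurable_past (M : IlliquidMarket Ω P) (n : ℕ) : Measurable (M.past n) :=
  measurable_pi_lambda _ fun i => (M.measurable_τ i).prodMk (M.measurable_Z i)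

theorem τ_nonneg (M : IlliquidMarket Ω P) (n : ℕ) (ω : Ω) : 0 ≤ M.τ n ω := by
  have := (M.τ_strictMono ω).monotone (Nat.zero_le n)
  simpa [M.τ_zero] using this

/-- Up to date `n + 1`, a predictable process is a function of time and of the observations up to
date `n`. -/
theorem exists_eq_past_of_predictable (M : IlliquidMarket Ω P) {c : ℝ≥0 → Ω → ℝ}
    (hc : IsStronglyPredictable M.obs c) (n : ℕ) :
    ∃ F : ℝ≥0 × (Fin (n + 1) → ℝ × ℝ) → ℝ, Measurable F ∧
      ∀ (t : ℝ≥0) ω, (t : ℝ) ≤ M.τ (n + 1) ω → c t ω = F (t, M.past n ω) := by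
  let R := {r : ℝ≥0 × Ω // (r.1 : ℝ) ≤ M.τ (n + 1) r.2}
  let ψ : R → ℝ≥0 × (Fin (n + 1) → ℝ × ℝ) := fun r => (r.1.1, M.past n r.1.2)
  -- R is the region up to date n + 1, with the σ-algebra generated by time and past. It suffices
  -- that the generators of the predictable σ-algebra restrict to sets measurable for `mR`; the
  -- factorization through ψ follows.
  let mR : MeasurableSpace R := MeasurableSpace.comap ψ inferInstance
  have core : ∀ (s : ℝ≥0) (B : Set ℝ≥0), MeasurableSet B →
      (∀ r : R, r.1.1 ∈ B → (s : ℝ) < M.τ (n + 1) r.1.2) → ∀ A, MeasurableSet[M.obs s] A →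
      MeasurableSet[mR] {r : R | r.1.1 ∈ B ∧ r.1.2 ∈ A} := by
    intro s B hB hBs A hA
    have hBm : MeasurableSet[mR] {r : R | r.1.1 ∈ B} :=
      ⟨Prod.fst ⁻¹' B, measurable_fst hB, rfl⟩
    induction A, hA using MeasurableSpace.generateFrom_induction with
    | hC A hA _ =>
      obtain ⟨m, q, C, hq, hC, rfl⟩ := hA
      rcases Nat.lt_or_ge n m with hm | hm
      -- A date m > n is no earlier than date n + 1, which comes after s; having observed it by time
      -- s is impossible here.
      · convert @MeasurableSet.empty R mR using 1
        refine eq_empty_of_forall_notMem fun r hr => ?_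
        have h1 := hBs r hr.1
        have h2 := (M.τ_strictMono r.1.2).monotone (Nat.succ_le_of_lt hm)
        have h3 : M.τ m r.1.2 ≤ q := hr.2.1
        have h4 : (q : ℝ) ≤ s := by exact_mod_cast hq
        have h5 : M.τ (n + 1) r.1.2 ≤ M.τ m r.1.2 := h2
        linarith
      · refine ⟨{u | u.1 ∈ B ∧ (u.2 ⟨m, Nat.lt_succ_of_le hm⟩).1 ≤ q ∧
          (u.2 ⟨m, Nat.lt_succ_of_le hm⟩).2 ∈ C}, ?_, rfl⟩
        have h1 : Measurable fun u : ℝ≥0 × (Fin (n + 1) → ℝ × ℝ) =>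
            u.2 ⟨m, Nat.lt_succ_of_le hm⟩ := (measurable_pi_apply _).comp measurable_snd
        exact (measurable_fst hB).inter (((measurable_fst.comp h1) measurableSet_Iic).inter
          ((measurable_snd.comp h1) hC))
    | empty => simp
    | compl A _ ih =>
      have : {r : R | r.1.1 ∈ B ∧ r.1.2 ∈ Aᶜ} =
          {r : R | r.1.1 ∈ B} \ {r : R | r.1.1 ∈ B ∧ r.1.2 ∈ A} := by
        ext r; simp only [Set.mem_ofPred_eq, Set.mem_compl_iff, Set.mem_sdiff]; tauto
      rw [this]
      exact hBm.diff ih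
    | iUnion f _ ih =>
      have : {r : R | r.1.1 ∈ B ∧ r.1.2 ∈ ⋃ i, f i} =
          ⋃ i, {r : R | r.1.1 ∈ B ∧ r.1.2 ∈ f i} := by
        ext r; simp
      rw [this]
      exact MeasurableSet.iUnion ih
  have hval : @Measurable R (ℝ≥0 × Ω) mR M.obs.predictable Subtype.val := by
    refine @measurable_generateFrom _ _ mR _ _ ?_
    rintro _ (⟨A, hA, rfl⟩ | ⟨s, A, hA, rfl⟩)
    · refine core ⊥ {⊥} (measurableSet_singleton _) (fun r _ => ?_) A hA
      have := M.τ_strictMono r.1.2 (Nat.succ_pos n)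
      simpa [M.τ_zero] using this
    · refine core s (Ioi s) measurableSet_Ioi (fun r hr => ?_) A hA
      exact lt_of_lt_of_le (by exact_mod_cast (mem_Ioi.1 hr)) r.2
  have hm : @Measurable R ℝ mR _ fun r => c r.1.1 r.1.2 :=
    (StronglyMeasurable.measurable hc).comp hval
  obtain ⟨F, hF, hFeq⟩ := hm.exists_eq_measurable_comp
  exact ⟨F, hF, fun t ω h => congrFun hFeq ⟨(t, ω), h⟩⟩

end IlliquidMarket

/-! ### Finiteness of the market value function -/

theorem lintegral_exp_expMeasure {r θ : ℝ} (hr : 0 < r) (hθ : 0 < r + θ) :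
    ∫⁻ s, ENNReal.ofReal (Real.exp (-θ * s)) ∂(expMeasure r) = ENNReal.ofReal (r / (r + θ)) := by
  have h1 : expMeasure r = volume.withDensity (exponentialPDF r) := rfl
  have hm : Measurable (exponentialPDF r) := (measurable_exponentialPDFReal r).ennreal_ofReal
  rw [h1, lintegral_withDensity_eq_lintegral_mul _ hm (by fun_prop)]
  have h2 : ∀ᵐ s : ℝ, (exponentialPDF r * fun s => ENNReal.ofReal (Real.exp (-θ * s))) s =
      (Ioi (0 : ℝ)).indicator
        (fun s => ENNReal.ofReal (r * Real.exp (-(r + θ) * (s - 0)))) s := by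
    filter_upwards [compl_mem_ae_iff.2 (measure_singleton (0 : ℝ))] with s hs
    rcases lt_or_gt_of_ne (show s ≠ 0 from hs) with h0 | h0
    · rw [Pi.mul_apply, exponentialPDF_of_neg h0, zero_mul,
        indicator_of_notMem (show s ∉ Ioi (0 : ℝ) from not_lt.2 h0.le)]
    · rw [Pi.mul_apply, exponentialPDF_of_nonneg h0.le, indicator_of_mem (mem_Ioi.2 h0),
        ← ENNReal.ofReal_mul (by positivity), mul_assoc, ← Real.exp_add]
      ring_nf
  rw [lintegral_congr_ae h2, lintegral_indicator measurableSet_Ioi,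
    ← ofReal_integral_eq_lintegral_ofReal ((integrableOn_exp_discount hθ 0).const_mul r)
      (Eventually.of_forall fun s => by positivity), integral_const_mul,
    integral_exp_discount hθ, mul_one_div]

/-- Discounted utility of consumption over one period, from a bound on total consumption. -/
theorem IsUtility.lintegral_period_le {U : ℝ → ℝ} {γ : ℝ} (hU : IsUtility U γ) {rho : ℝ}
    (hrho : 0 < rho) : ∃ K ≥ 0, ∀ (a b W : ℝ) (f : ℝ → ℝ), a ≤ b → (∀ t, 0 ≤ f t) → 0 ≤ W →
      IntegrableOn f (Ioc a b) → ∫ t in Ioc a b, f t ≤ W →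
      ∫⁻ t in Ioc a b, ENNReal.ofReal (Real.exp (-rho * t) * U (f t)) ≤
        ENNReal.ofReal K * ENNReal.ofReal (Real.exp (-rho * a) * W ^ γ) := by
  obtain ⟨K, hK, hb⟩ := hU.exists_power_bound
  refine ⟨K * (1 / rho + 1), by positivity, fun a b W f hab hf hW hfi hfW => ?_⟩
  rw [← ENNReal.ofReal_mul (by positivity)]
  -- The power bound needs a positive threshold while W may vanish, so M > W is used and then M ↓ W.
  have main : ∀ M, W < M → ∫⁻ t in Ioc a b, ENNReal.ofReal (Real.exp (-rho * t) * U (f t)) ≤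
      ENNReal.ofReal (K * (1 / rho + 1) * (Real.exp (-rho * a) * M ^ γ)) := by
    intro M hM
    have hM0 : 0 < M := hW.trans_lt hM
    have hi : IntegrableOn (fun t => Real.exp (-rho * (t - a))) (Ioc a b) :=
      (integrableOn_exp_discount hrho a).mono_set Ioc_subset_Ioi_self
    have hi2 := (hi.const_mul (K * M ^ γ * Real.exp (-rho * a))).add
      (hfi.const_mul (K * M ^ (γ - 1) * Real.exp (-rho * a)))
    have hnn : ∀ t, 0 ≤ (K * M ^ γ * Real.exp (-rho * a)) * Real.exp (-rho * (t - a)) +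
        (K * M ^ (γ - 1) * Real.exp (-rho * a)) * f t := fun t => by
      have := hf t
      positivity
    calc ∫⁻ t in Ioc a b, ENNReal.ofReal (Real.exp (-rho * t) * U (f t))
        ≤ ∫⁻ t in Ioc a b, ENNReal.ofReal
          ((K * M ^ γ * Real.exp (-rho * a)) * Real.exp (-rho * (t - a)) +
            (K * M ^ (γ - 1) * Real.exp (-rho * a)) * f t) := by
          refine setLIntegral_mono' measurableSet_Ioc fun t ht => ENNReal.ofReal_le_ofReal ?_
          have e1 := mul_le_mul_of_nonneg_left (hb (f t) M (hf t) hM0)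
            (Real.exp_nonneg (-rho * t))
          have e2 : Real.exp (-rho * t) = Real.exp (-rho * a) * Real.exp (-rho * (t - a)) := by
            rw [← Real.exp_add]; ring_nf
          have e3 : Real.exp (-rho * t) ≤ Real.exp (-rho * a) :=
            Real.exp_le_exp.2 (by nlinarith [ht.1])
          have e4 := mul_le_mul_of_nonneg_right e3
            (show 0 ≤ K * M ^ (γ - 1) * f t by have := hf t; positivity)
          have e5 : Real.exp (-rho * t) * (K * M ^ γ) =
            (K * M ^ γ * Real.exp (-rho * a)) * Real.exp (-rho * (t - a)) := by rw [e2]; ring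
          linarith
      _ = ENNReal.ofReal (∫ t in Ioc a b, (K * M ^ γ * Real.exp (-rho * a)) *
            Real.exp (-rho * (t - a)) + (K * M ^ (γ - 1) * Real.exp (-rho * a)) * f t) :=
          (ofReal_integral_eq_lintegral_ofReal hi2 (Eventually.of_forall hnn)).symm
      _ ≤ ENNReal.ofReal (K * (1 / rho + 1) * (Real.exp (-rho * a) * M ^ γ)) := by
          refine ENNReal.ofReal_le_ofReal ?_
          rw [integral_add (hi.const_mul _) (hfi.const_mul _), integral_const_mul,
            integral_const_mul]
          have e1 : ∫ t in Ioc a b, Real.exp (-rho * (t - a)) ≤ 1 / rho := by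
            rw [← integral_exp_discount hrho a]
            exact setIntegral_mono_set (integrableOn_exp_discount hrho a)
              (Eventually.of_forall fun t => (Real.exp_nonneg _))
              (LE.le.eventuallyLE Ioc_subset_Ioi_self)
          have e2 : M ^ (γ - 1) * M = M ^ γ := by rw [Real.rpow_sub_one hM0.ne']; field_simp
          have e3 := mul_le_mul_of_nonneg_left e1
            (show 0 ≤ K * M ^ γ * Real.exp (-rho * a) by positivity)
          have e4 := mul_le_mul_of_nonneg_left (hfW.trans hM.le)
            (show 0 ≤ K * M ^ (γ - 1) * Real.exp (-rho * a) by positivity)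
          have e5 : K * M ^ (γ - 1) * Real.exp (-rho * a) * M =
            K * Real.exp (-rho * a) * M ^ γ := by rw [← e2]; ring
          linarith
  have hlim : Tendsto (fun M : ℝ => ENNReal.ofReal (K * (1 / rho + 1) *
      (Real.exp (-rho * a) * M ^ γ))) (𝓝[>] W)
      (𝓝 (ENNReal.ofReal (K * (1 / rho + 1) * (Real.exp (-rho * a) * W ^ γ)))) := by
    have : Continuous fun M : ℝ => ENNReal.ofReal (K * (1 / rho + 1) *
        (Real.exp (-rho * a) * M ^ γ)) :=
      ENNReal.continuous_ofReal.comp (continuous_const.mul (continuous_const.mul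
        (Real.continuous_rpow_const hU.γ_pos.le)))
    exact (this.tendsto W).mono_left nhdsWithin_le_nhds
  exact ge_of_tendsto hlim (eventually_mem_nhdsWithin.mono fun M hM => main M hM)

namespace IlliquidMarket

variable {Ω : Type*} [MeasurableSpace Ω] {P : Measure Ω}

/-- Wealth gross of consumption. -/
noncomputable def grossWealth (M : IlliquidMarket Ω P) (x : ℝ) (α : ℕ → Ω → ℝ) (n : ℕ) (ω : Ω) :
    ℝ := x + ∑ i ∈ Finset.range n, α i ω * M.Z (i + 1) ω

theorem grossWealth_succ (M : IlliquidMarket Ω P) (x : ℝ) (α : ℕ → Ω → ℝ) (n : ℕ) (ω : Ω) :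
    M.grossWealth x α (n + 1) ω = M.grossWealth x α n ω + α n ω * M.Z (n + 1) ω := by
  rw [grossWealth, grossWealth, Finset.sum_range_succ, add_assoc]

variable {M : IlliquidMarket Ω P} {x : ℝ} {α : ℕ → Ω → ℝ} {c : ℝ≥0 → Ω → ℝ}

theorem IsAdmissiblePolicy.exists_α_eq (h : M.IsAdmissiblePolicy x α c) (n : ℕ) :
    ∃ f : (Fin (n + 1) → ℝ × ℝ) → ℝ, Measurable f ∧ ∀ ω, α n ω = f (M.past n ω) := by
  obtain ⟨f, hf, heq⟩ := (h.measurable_α n).exists_eq_measurable_comp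
  exact ⟨f, hf, fun ω => congrFun heq ω⟩

theorem IsAdmissiblePolicy.exists_grossWealth_eq (h : M.IsAdmissiblePolicy x α c) (n : ℕ) :
    ∃ f : (Fin (n + 1) → ℝ × ℝ) → ℝ, Measurable f ∧
      ∀ ω, M.grossWealth x α n ω = f (M.past n ω) := by
  induction n with
  | zero => exact ⟨fun _ => x, measurable_const, fun ω => by simp [grossWealth]⟩
  | succ n ih =>
    obtain ⟨f, hf, hfeq⟩ := ih
    obtain ⟨g, hg, hgeq⟩ := h.exists_α_eq n
    let ρ : (Fin (n + 1 + 1) → ℝ × ℝ) → (Fin (n + 1) → ℝ × ℝ) := fun q i => q i.castSucc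
    have hρ : Measurable ρ := measurable_pi_lambda _ fun i => measurable_pi_apply _
    refine ⟨fun q => f (ρ q) + g (ρ q) * (q (Fin.last (n + 1))).2, ?_, fun ω => ?_⟩
    · exact (hf.comp hρ).add ((hg.comp hρ).mul (measurable_snd.comp (measurable_pi_apply _)))
    · rw [grossWealth_succ, hfeq, hgeq]
      rfl

/-- The total consumption up to the next date, and the position chosen, are such that the wealth
stays nonnegative whatever the return in the support of its conditional law. -/
theorem IsAdmissiblePolicy.ae_support_nonneg [IsProbabilityMeasure P]
    (h : M.IsAdmissiblePolicy x α c) (n : ℕ) :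
    ∀ᵐ ω ∂P, ∀ z ∈ (M.p (M.τ (n + 1) ω - M.τ n ω)).support,
      0 ≤ (M.grossWealth x α n ω - ∫ t in 0..M.τ (n + 1) ω, c t.toNNReal ω) + α n ω * z := by
  have := M.markov
  obtain ⟨f, hf, hfeq⟩ := h.exists_grossWealth_eq n
  obtain ⟨g, hg, hgeq⟩ := h.exists_α_eq n
  obtain ⟨F, hF, hFeq⟩ := M.exists_eq_past_of_predictable h.predictable_c n
  -- Since c is predictable, consumption up to date n + 1 depends on the past and the waiting time
  -- but not on the return Z (n + 1). This permits conditioning on everything except the return.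
  let κ : (Fin (n + 1) → ℝ × ℝ) × ℝ → ℝ := fun u => ∫ t, {r : ((Fin (n + 1) → ℝ × ℝ) × ℝ) × ℝ |
    0 < r.2 ∧ r.2 ≤ (r.1.1 (Fin.last n)).1 + r.1.2}.indicator
      (fun r => F (r.2.toNNReal, r.1.1)) (u, t)
  have hκ : Measurable κ := by
    refine (StronglyMeasurable.integral_prod_right (ν := volume) (f := fun u t =>
      {r : ((Fin (n + 1) → ℝ × ℝ) × ℝ) × ℝ |
        0 < r.2 ∧ r.2 ≤ (r.1.1 (Fin.last n)).1 + r.1.2}.indicator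
          (fun r => F (r.2.toNNReal, r.1.1)) (u, t)) ?_).measurable
    refine Measurable.stronglyMeasurable (Measurable.indicator (hF.comp
      (measurable_snd.real_toNNReal.prodMk (measurable_fst.comp measurable_fst))) ?_)
    have h1 : Measurable fun r : ((Fin (n + 1) → ℝ × ℝ) × ℝ) × ℝ =>
        (r.1.1 (Fin.last n)).1 + r.1.2 :=
      (measurable_fst.comp ((measurable_pi_apply _).comp
        (measurable_fst.comp measurable_fst))).add (measurable_snd.comp measurable_fst)
    exact (measurableSet_lt measurable_const measurable_snd).inter
      (measurableSet_le measurable_snd h1)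
  have hκeq : ∀ ω, ∫ t in 0..M.τ (n + 1) ω, c t.toNNReal ω =
      κ (M.past n ω, M.τ (n + 1) ω - M.τ n ω) := by
    intro ω
    rw [intervalIntegral.integral_of_le (M.τ_nonneg _ _), ← integral_indicator measurableSet_Ioc]
    refine integral_congr_ae (Eventually.of_forall fun t => ?_)
    have e : ((M.past n ω) (Fin.last n)).1 + (M.τ (n + 1) ω - M.τ n ω) = M.τ (n + 1) ω := by
      simp [past]
    by_cases ht : t ∈ Ioc 0 (M.τ (n + 1) ω)
    · simp only
      rw [indicator_of_mem ht, indicator_of_mem (by exact ⟨ht.1, by simp only [e]; exact ht.2⟩)]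
      exact hFeq _ _ (by rw [Real.coe_toNNReal _ ht.1.le]; exact ht.2)
    · simp only
      rw [indicator_of_notMem ht, indicator_of_notMem]
      rintro ⟨h1, h2⟩
      exact ht ⟨h1, by simpa only [e] using h2⟩
  have hpm : Measurable fun ω => (M.past n ω, M.τ (n + 1) ω - M.τ n ω) :=
    (M.measurable_past n).prodMk ((M.measurable_τ _).sub (M.measurable_τ _))
  let B : Set (((Fin (n + 1) → ℝ × ℝ) × ℝ) × ℝ) := {r | 0 ≤ (f r.1.1 - κ r.1) + g r.1.1 * r.2}
  have hB : MeasurableSet B := measurableSet_le measurable_const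
    (((hf.comp (measurable_fst.comp measurable_fst)).sub (hκ.comp measurable_fst)).add
      ((hg.comp (measurable_fst.comp measurable_fst)).mul measurable_snd))
  -- Nonnegative wealth at date n + 1, read under the joint law. Disintegration by `return_law`
  -- makes it hold for almost every return under the kernel, hence on its support.
  have h1 : ∀ᵐ r ∂(P.map fun ω => ((M.past n ω, M.τ (n + 1) ω - M.τ n ω), M.Z (n + 1) ω)),
      r ∈ B := by
    refine (ae_map_iff (hpm.prodMk (M.measurable_Z _)).aemeasurable hB).2 ?_
    filter_upwards [h.wealth_nonneg (n + 1) (by simp)] with ω hω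
    rw [← hfeq, ← hκeq, ← hgeq]
    have e := M.grossWealth_succ x α n ω
    rw [wealth] at hω
    rw [grossWealth] at e
    linarith
  have hlaw := M.return_law n
  change P.map (fun ω => ((M.past n ω, M.τ (n + 1) ω - M.τ n ω), M.Z (n + 1) ω)) =
    (P.map fun ω => (M.past n ω, M.τ (n + 1) ω - M.τ n ω)) ⊗ₘ (M.p.comap Prod.snd measurable_snd)
    at hlaw
  rw [hlaw] at h1
  filter_upwards [ae_of_ae_map hpm.aemeasurable (Measure.ae_ae_of_ae_compProd h1)] with ω hω
  refine M.forall_support_nonneg ?_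
  rw [Kernel.comap_apply] at hω
  filter_upwards [hω] with z hz
  rw [hfeq, hκeq, hgeq]
  exact hz

end IlliquidMarket

namespace IlliquidMarket

variable {Ω : Type*} [MeasurableSpace Ω] {P : Measure Ω}

theorem waiting_pos (M : IlliquidMarket Ω P) (n : ℕ) (ω : Ω) :
    0 < M.τ (n + 1) ω - M.τ n ω :=
  sub_pos.2 (M.τ_strictMono ω (Nat.lt_succ_self n))

theorem measurable_waiting (M : IlliquidMarket Ω P) (n : ℕ) :
    Measurable fun ω => M.τ (n + 1) ω - M.τ n ω :=
  (M.measurable_τ _).sub (M.measurable_τ _)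

/-- Functions of the past and of the next waiting time have product expectations. -/
theorem lintegral_past_mul_waiting (M : IlliquidMarket Ω P) (n : ℕ)
    {f : (Fin (n + 1) → ℝ × ℝ) → ℝ≥0∞} (hf : Measurable f) {g : ℝ → ℝ≥0∞} (hg : Measurable g) :
    ∫⁻ ω, f (M.past n ω) * g (M.τ (n + 1) ω - M.τ n ω) ∂P =
      (∫⁻ ω, f (M.past n ω) ∂P) * ∫⁻ s, g s ∂(expMeasure M.lam) := by
  have hi : IndepFun (fun ω => f (M.past n ω)) (fun ω => g (M.τ (n + 1) ω - M.τ n ω)) P :=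
    ((M.interarrival_indep n).comp hg hf).symm
  have h := lintegral_mul_eq_lintegral_mul_lintegral_of_indepFun
    (hf.comp (M.measurable_past n)) (hg.comp (M.measurable_waiting n)) hi
  simp only [Pi.mul_apply] at h
  have h2 : ∫⁻ ω, g (M.τ (n + 1) ω - M.τ n ω) ∂P = ∫⁻ s, g s ∂(expMeasure M.lam) := by
    rw [← M.interarrival_law n, lintegral_map hg (M.measurable_waiting n)]
  rw [← h2]
  exact h

/-- The trading dates tend to infinity. -/
theorem ae_exists_lt_τ (M : IlliquidMarket Ω P) [IsProbabilityMeasure P] :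
    ∀ᵐ ω ∂P, ∀ T : ℝ, ∃ n, T < M.τ n ω := by
  have hl := M.lam_pos
  set r : ℝ≥0∞ := ENNReal.ofReal (M.lam / (M.lam + 1)) with hr
  have hr1 : r < 1 := by
    rw [hr, ENNReal.ofReal_lt_one, div_lt_one (by linarith)]
    linarith
  have hm : ∀ n, Measurable fun ω => ENNReal.ofReal (Real.exp (-M.τ n ω)) := fun n =>
    (Real.measurable_exp.comp (M.measurable_τ n).neg).ennreal_ofReal
  -- By independence the Laplace transform at 1 is multiplicative over waiting times. It tends to 0,
  -- so the infimum of e^{-τ n} vanishes almost surely.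
  have hd : ∀ n, ∫⁻ ω, ENNReal.ofReal (Real.exp (-M.τ n ω)) ∂P = r ^ n := by
    intro n
    induction n with
    | zero => simp [M.τ_zero]
    | succ n ih =>
      have h := M.lintegral_past_mul_waiting n
        (f := fun q => ENNReal.ofReal (Real.exp (-(q (Fin.last n)).1)))
        (Real.measurable_exp.comp
          (measurable_fst.comp (measurable_pi_apply _)).neg).ennreal_ofReal
        (g := fun s => ENNReal.ofReal (Real.exp (-1 * s))) (by fun_prop)
      rw [lintegral_exp_expMeasure hl (by linarith)] at h
      rw [pow_succ, ← ih, hr]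
      refine Eq.trans (lintegral_congr fun ω => ?_) h
      rw [← ENNReal.ofReal_mul (Real.exp_nonneg _), ← Real.exp_add]
      simp only [past, Fin.val_last]
      ring_nf
  have h0 : ∫⁻ ω, ⨅ n, ENNReal.ofReal (Real.exp (-M.τ n ω)) ∂P = 0 := by
    refine le_antisymm (ge_of_tendsto' (ENNReal.tendsto_pow_atTop_nhds_zero_of_lt_one hr1)
      fun n => ?_) zero_le
    rw [← hd n]
    exact lintegral_mono fun ω => iInf_le _ n
  rw [lintegral_eq_zero_iff (Measurable.iInf hm)] at h0
  filter_upwards [h0] with ω hω T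
  have : ⨅ n, ENNReal.ofReal (Real.exp (-M.τ n ω)) < ENNReal.ofReal (Real.exp (-T)) := by
    rw [hω]
    simpa using Real.exp_pos _
  obtain ⟨n, hn⟩ := iInf_lt_iff.1 this
  have h1 := (ENNReal.ofReal_lt_ofReal_iff (Real.exp_pos _)).1 hn
  exact ⟨n, by linarith [Real.exp_lt_exp.1 h1]⟩

variable {M : IlliquidMarket Ω P} {x : ℝ} {α : ℕ → Ω → ℝ} {c : ℝ≥0 → Ω → ℝ}

theorem IsAdmissiblePolicy.integral_nonneg (h : M.IsAdmissiblePolicy x α c) (n : ℕ) (ω : Ω) :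
    0 ≤ ∫ t in 0..M.τ n ω, c t.toNNReal ω :=
  intervalIntegral.integral_nonneg (M.τ_nonneg n ω) fun _ _ => h.c_nonneg _ ω

theorem IsAdmissiblePolicy.ae_integral_le [IsProbabilityMeasure P]
    (h : M.IsAdmissiblePolicy x α c) (n : ℕ) :
    ∀ᵐ ω ∂P, ∫ t in 0..M.τ (n + 1) ω, c t.toNNReal ω ≤ M.grossWealth x α n ω := by
  filter_upwards [h.ae_support_nonneg n] with ω hω
  exact sub_nonneg.1 (M.capital_nonneg (M.waiting_pos n ω) hω)

/-- The factor by which discounted moments of wealth shrink over one period. -/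
noncomputable def contraction (M : IlliquidMarket Ω P) (γ rho : ℝ) : ℝ :=
  (M.k / M.zl) ^ γ * (M.lam / (M.lam + (rho - M.b * γ)))

theorem discount_margin (M : IlliquidMarket Ω P) {γ rho : ℝ}
    (hdiscount : rho > M.b * γ + M.lam * (M.k ^ γ / M.zl ^ γ - 1)) :
    M.lam * (M.k / M.zl) ^ γ < M.lam + (rho - M.b * γ) ∧ 0 < M.lam + (rho - M.b * γ) := by
  have h1 : 0 ≤ M.lam * (M.k / M.zl) ^ γ :=
    mul_nonneg M.lam_pos.le (Real.rpow_nonneg (div_nonneg M.k_nonneg M.zl_pos.le) _)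
  have h2 : M.lam * (M.k / M.zl) ^ γ < M.lam + (rho - M.b * γ) := by
    rw [Real.div_rpow M.k_nonneg M.zl_pos.le]
    linarith
  exact ⟨h2, h1.trans_lt h2⟩

theorem contraction_nonneg (M : IlliquidMarket Ω P) {γ rho : ℝ}
    (hdiscount : rho > M.b * γ + M.lam * (M.k ^ γ / M.zl ^ γ - 1)) :
    0 ≤ M.contraction γ rho :=
  mul_nonneg (Real.rpow_nonneg (div_nonneg M.k_nonneg M.zl_pos.le) _)
    (div_nonneg M.lam_pos.le (M.discount_margin hdiscount).2.le)

theorem contraction_lt_one (M : IlliquidMarket Ω P) {γ rho : ℝ}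
    (hdiscount : rho > M.b * γ + M.lam * (M.k ^ γ / M.zl ^ γ - 1)) :
    M.contraction γ rho < 1 := by
  have h := M.discount_margin hdiscount
  rw [contraction, ← mul_div_assoc, div_lt_one h.2, mul_comm]
  exact h.1

theorem growthFactor_rpow (M : IlliquidMarket Ω P) (t γ : ℝ) :
    M.growthFactor t ^ γ = (M.k / M.zl) ^ γ * Real.exp (M.b * γ * t) := by
  have h : M.growthFactor t = M.k / M.zl * Real.exp (M.b * t) := by rw [growthFactor]; ring
  rw [h, Real.mul_rpow (div_nonneg M.k_nonneg M.zl_pos.le) (Real.exp_nonneg _), ← Real.exp_mul]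
  ring_nf

theorem lintegral_growthFactor (M : IlliquidMarket Ω P) {γ rho : ℝ}
    (hdiscount : rho > M.b * γ + M.lam * (M.k ^ γ / M.zl ^ γ - 1)) :
    ∫⁻ s, ENNReal.ofReal (Real.exp (-rho * s) * M.growthFactor s ^ γ) ∂(expMeasure M.lam) =
      ENNReal.ofReal (M.contraction γ rho) := by
  have hk : 0 ≤ (M.k / M.zl) ^ γ := Real.rpow_nonneg (div_nonneg M.k_nonneg M.zl_pos.le) _
  have h : ∀ s, ENNReal.ofReal (Real.exp (-rho * s) * M.growthFactor s ^ γ) =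
      ENNReal.ofReal ((M.k / M.zl) ^ γ) * ENNReal.ofReal (Real.exp (-(rho - M.b * γ) * s)) := by
    intro s
    rw [← ENNReal.ofReal_mul hk, growthFactor_rpow, mul_left_comm, ← Real.exp_add]
    ring_nf
  simp only [h]
  rw [lintegral_const_mul _ (by fun_prop), lintegral_exp_expMeasure M.lam_pos
    (M.discount_margin hdiscount).2, ← ENNReal.ofReal_mul hk]
  rfl

/-- Given the past and the waiting time, `lintegral_rpow_le` integrates out the return at the cost
of a growth factor to the power γ. The waiting time is independent of the past, so the discounted
factor integrates to `contraction`. Working gross of consumption is possible because adding back a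
nonnegative amount preserves nonnegativity on the support. -/
theorem IsAdmissiblePolicy.lintegral_grossWealth_succ_le [IsProbabilityMeasure P]
    (h : M.IsAdmissiblePolicy x α c) {γ rho : ℝ} (hγ : 0 < γ) (hγ1 : γ < 1)
    (hdiscount : rho > M.b * γ + M.lam * (M.k ^ γ / M.zl ^ γ - 1)) (n : ℕ) :
    ∫⁻ ω, ENNReal.ofReal (Real.exp (-rho * M.τ (n + 1) ω) * M.grossWealth x α (n + 1) ω ^ γ) ∂P ≤
      (∫⁻ ω, ENNReal.ofReal (Real.exp (-rho * M.τ n ω) * M.grossWealth x α n ω ^ γ) ∂P) *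
        ENNReal.ofReal (M.contraction γ rho) := by
  have := M.markov
  obtain ⟨f, hf, hfeq⟩ := h.exists_grossWealth_eq n
  obtain ⟨g, hg, hgeq⟩ := h.exists_α_eq n
  have hpm : Measurable fun ω => (M.past n ω, M.τ (n + 1) ω - M.τ n ω) :=
    (M.measurable_past n).prodMk (M.measurable_waiting n)
  have hrpow : Measurable fun y : ℝ => y ^ γ := by fun_prop
  let d : (Fin (n + 1) → ℝ × ℝ) × ℝ → ℝ := fun u =>
    Real.exp (-rho * ((u.1 (Fin.last n)).1 + u.2))
  have hd : Measurable d := Real.measurable_exp.comp (((measurable_fst.comp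
    ((measurable_pi_apply _).comp measurable_fst)).add measurable_snd).const_mul _)
  let H : ((Fin (n + 1) → ℝ × ℝ) × ℝ) × ℝ → ℝ≥0∞ := fun r =>
    ENNReal.ofReal (d r.1) * ENNReal.ofReal ((f r.1.1 + g r.1.1 * r.2) ^ γ)
  have hH2 : Measurable fun r : ((Fin (n + 1) → ℝ × ℝ) × ℝ) × ℝ =>
      ENNReal.ofReal ((f r.1.1 + g r.1.1 * r.2) ^ γ) :=
    (hrpow.comp ((hf.comp (measurable_fst.comp measurable_fst)).add
      ((hg.comp (measurable_fst.comp measurable_fst)).mul measurable_snd))).ennreal_ofReal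
  have hH : Measurable H := (hd.comp measurable_fst).ennreal_ofReal.mul hH2
  have hlast : ∀ ω, ((M.past n ω) (Fin.last n)).1 = M.τ n ω := fun ω => by simp [past]
  have e1 : ∀ ω, ENNReal.ofReal (Real.exp (-rho * M.τ (n + 1) ω) *
      M.grossWealth x α (n + 1) ω ^ γ) =
      H ((M.past n ω, M.τ (n + 1) ω - M.τ n ω), M.Z (n + 1) ω) := by
    intro ω
    simp only [H, d, hlast, ← hfeq, ← hgeq, ← grossWealth_succ]
    rw [ENNReal.ofReal_mul (Real.exp_nonneg _)]
    ring_nf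
  have hlaw := M.return_law n
  change P.map (fun ω => ((M.past n ω, M.τ (n + 1) ω - M.τ n ω), M.Z (n + 1) ω)) =
    (P.map fun ω => (M.past n ω, M.τ (n + 1) ω - M.τ n ω)) ⊗ₘ (M.p.comap Prod.snd measurable_snd)
    at hlaw
  have hpr : IsProbabilityMeasure (P.map fun ω => (M.past n ω, M.τ (n + 1) ω - M.τ n ω)) :=
    Measure.isProbabilityMeasure_map hpm.aemeasurable
  simp only [e1]
  rw [← lintegral_map hH (hpm.prodMk (M.measurable_Z _)), hlaw, Measure.lintegral_compProd hH,
    lintegral_map (Measurable.lintegral_kernel_prod_right' hH) hpm]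
  calc ∫⁻ ω, ∫⁻ z, H ((M.past n ω, M.τ (n + 1) ω - M.τ n ω), z)
        ∂((M.p.comap Prod.snd measurable_snd) (M.past n ω, M.τ (n + 1) ω - M.τ n ω)) ∂P
      ≤ ∫⁻ ω, ENNReal.ofReal (Real.exp (-rho * M.τ n ω) * M.grossWealth x α n ω ^ γ) *
          ENNReal.ofReal (Real.exp (-rho * (M.τ (n + 1) ω - M.τ n ω)) *
            M.growthFactor (M.τ (n + 1) ω - M.τ n ω) ^ γ) ∂P := by
        refine lintegral_mono_ae ?_
        filter_upwards [h.ae_support_nonneg n] with ω hω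
        have hS := M.waiting_pos n ω
        have hC := h.integral_nonneg (n + 1) ω
        have hs : ∀ z ∈ (M.p (M.τ (n + 1) ω - M.τ n ω)).support,
            0 ≤ M.grossWealth x α n ω + α n ω * z := fun z hz => by linarith [hω z hz]
        have hW := M.capital_nonneg hS hs
        have hG := M.growthFactor_nonneg (M.τ (n + 1) ω - M.τ n ω)
        rw [Kernel.comap_apply]
        simp only [H]
        rw [lintegral_const_mul' _ _ ENNReal.ofReal_ne_top]
        refine (mul_le_mul_right (M.lintegral_rpow_le hS hγ hγ1 (by
          simpa only [← hfeq, ← hgeq] using hs)) _).trans_eq ?_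
        simp only [d, hlast]
        rw [← hfeq, ← ENNReal.ofReal_mul (Real.exp_nonneg _), ← ENNReal.ofReal_mul
          (by positivity), Real.mul_rpow hW hG, mul_add, Real.exp_add]
        ring_nf
    _ = _ := by
        have hm1 : Measurable fun q : Fin (n + 1) → ℝ × ℝ =>
            ENNReal.ofReal (Real.exp (-rho * (q (Fin.last n)).1) * f q ^ γ) :=
          ((Real.measurable_exp.comp ((measurable_fst.comp
            (measurable_pi_apply _)).const_mul _)).mul (hrpow.comp hf)).ennreal_ofReal
        have hm2 : Measurable fun s => ENNReal.ofReal (Real.exp (-rho * s) *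
            M.growthFactor s ^ γ) := by
          unfold growthFactor
          fun_prop
        have e := M.lintegral_past_mul_waiting n hm1 hm2
        simp only [hlast, ← hfeq] at e
        rw [e, M.lintegral_growthFactor hdiscount]

theorem IsAdmissiblePolicy.lintegral_grossWealth_le [IsProbabilityMeasure P]
    (h : M.IsAdmissiblePolicy x α c) {γ rho : ℝ} (hγ : 0 < γ) (hγ1 : γ < 1)
    (hdiscount : rho > M.b * γ + M.lam * (M.k ^ γ / M.zl ^ γ - 1)) (n : ℕ) :
    ∫⁻ ω, ENNReal.ofReal (Real.exp (-rho * M.τ n ω) * M.grossWealth x α n ω ^ γ) ∂P ≤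
      ENNReal.ofReal (x ^ γ) * ENNReal.ofReal (M.contraction γ rho) ^ n := by
  induction n with
  | zero => simp [grossWealth, M.τ_zero]
  | succ n ih =>
    refine (h.lintegral_grossWealth_succ_le hγ hγ1 hdiscount n).trans ?_
    rw [pow_succ, ← mul_assoc]
    exact mul_le_mul_left ih _

/-- The value function is finite, with growth exponent `γ`. -/
theorem exists_value_le (M : IlliquidMarket Ω P) [IsProbabilityMeasure P] {U : ℝ → ℝ}
    {γ rho : ℝ} (hU : IsUtility U γ) (hrho : 0 < rho)
    (hdiscount : rho > M.b * γ + M.lam * (M.k ^ γ / M.zl ^ γ - 1)) :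
    ∃ K ≥ 0, ∀ x, 0 ≤ x → M.value U rho x ≤ ENNReal.ofReal (K * x ^ γ) := by
  obtain ⟨K, hK, hper⟩ := hU.lintegral_period_le hrho
  have hq0 := M.contraction_nonneg hdiscount
  have hq1 := M.contraction_lt_one hdiscount
  have hq2 : 0 < 1 - M.contraction γ rho := sub_pos.2 hq1
  refine ⟨K * (1 - M.contraction γ rho)⁻¹, by positivity, fun x hx => ?_⟩
  refine iSup_le fun α => iSup_le fun c => iSup_le fun h => ?_
  -- The half line is cut at the trading dates, which tend to infinity. Consumption within a period
  -- is at most the gross wealth at its start, and the expectations of the resulting bounds form a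
  -- geometric series.
  have hae : ∀ᵐ ω ∂P, ∫⁻ t in Ioi (0 : ℝ),
      ENNReal.ofReal (Real.exp (-rho * t) * U (c t.toNNReal ω)) ≤
      ∑' n, ENNReal.ofReal K *
        ENNReal.ofReal (Real.exp (-rho * M.τ n ω) * M.grossWealth x α n ω ^ γ) := by
    filter_upwards [M.ae_exists_lt_τ, ae_all_iff.2 h.ae_integral_le, ae_all_iff.2 h.integrable_c]
      with ω hτ hle hint
    have hcov : Ioi (0 : ℝ) ⊆ ⋃ n, Ioc (M.τ n ω) (M.τ (n + 1) ω) := by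
      intro t ht
      obtain ⟨N, hN⟩ := hτ t
      induction N with
      | zero => rw [M.τ_zero] at hN; exact absurd hN (not_lt.2 (le_of_lt ht))
      | succ N ih =>
        rcases lt_or_ge (M.τ N ω) t with h1 | h1
        · exact mem_iUnion.2 ⟨N, h1, hN.le⟩
        · rcases h1.eq_or_lt with h2 | h2
          · rcases N with _ | N
            · rw [M.τ_zero] at h2; exact absurd h2 (ne_of_gt ht)
            · exact mem_iUnion.2 ⟨N, h2 ▸ M.τ_strictMono ω (Nat.lt_succ_self N), h2.le⟩
          · exact ih h2
    refine (lintegral_mono_set hcov).trans ((lintegral_iUnion_le _ _).trans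
      (ENNReal.tsum_le_tsum fun n => ?_))
    have hi : IntegrableOn (fun t : ℝ => c t.toNNReal ω) (Ioc 0 (M.τ (n + 1) ω)) :=
      (hint (n + 1)).mono_set Ioc_subset_Icc_self
    have hsub : Ioc (M.τ n ω) (M.τ (n + 1) ω) ⊆ Ioc 0 (M.τ (n + 1) ω) :=
      Ioc_subset_Ioc_left (M.τ_nonneg n ω)
    refine hper _ _ _ _ (M.τ_strictMono ω (Nat.lt_succ_self n)).le (fun t => h.c_nonneg _ ω)
      ((h.integral_nonneg _ ω).trans (hle n)) (hi.mono_set hsub) (le_trans ?_ (hle n))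
    rw [intervalIntegral.integral_of_le (M.τ_nonneg _ _)]
    exact setIntegral_mono_set hi (Eventually.of_forall fun t => h.c_nonneg _ ω)
      (LE.le.eventuallyLE hsub)
  have hm : ∀ n, Measurable fun ω =>
      ENNReal.ofReal (Real.exp (-rho * M.τ n ω) * M.grossWealth x α n ω ^ γ) := by
    intro n
    obtain ⟨f, hf, hfeq⟩ := h.exists_grossWealth_eq n
    simp only [hfeq]
    have h1 := hf.comp (M.measurable_past n)
    have h2 := M.measurable_τ n
    have hrpow : Measurable fun y : ℝ => y ^ γ := by fun_prop
    exact ((Real.measurable_exp.comp (h2.const_mul _)).mul (hrpow.comp h1)).ennreal_ofReal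
  refine (lintegral_mono_ae hae).trans ?_
  rw [lintegral_tsum fun n => ((hm n).const_mul _).aemeasurable]
  calc ∑' n, ∫⁻ ω, ENNReal.ofReal K *
        ENNReal.ofReal (Real.exp (-rho * M.τ n ω) * M.grossWealth x α n ω ^ γ) ∂P
      ≤ ∑' n, ENNReal.ofReal K * (ENNReal.ofReal (x ^ γ) *
          ENNReal.ofReal (M.contraction γ rho) ^ n) := by
        refine ENNReal.tsum_le_tsum fun n => ?_
        rw [lintegral_const_mul _ (hm n)]
        exact mul_le_mul_right (h.lintegral_grossWealth_le hU.γ_pos hU.γ_lt_one hdiscount n) _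
    _ = ENNReal.ofReal (K * (1 - M.contraction γ rho)⁻¹ * x ^ γ) := by
        rw [ENNReal.tsum_mul_left, ENNReal.tsum_mul_left, ENNReal.tsum_geometric,
          ← ENNReal.ofReal_one, ← ENNReal.ofReal_sub _ hq0, ← ENNReal.ofReal_inv_of_pos hq2,
          ← ENNReal.ofReal_mul (by positivity), ← ENNReal.ofReal_mul hK]
        ring_nf

end IlliquidMarket

/-! ### Concavity of the market value and properties of the running reward -/

theorem concaveOn_toReal {s : Set ℝ} {f : ℝ → ℝ≥0∞} (hs : Convex ℝ s) (hf : ∀ x ∈ s, f x ≠ ⊤)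
    (h : ∀ x ∈ s, ∀ y ∈ s, ∀ u v : ℝ, 0 ≤ u → 0 ≤ v → u + v = 1 →
      ENNReal.ofReal u * f x + ENNReal.ofReal v * f y ≤ f (u * x + v * y)) :
    ConcaveOn ℝ s fun x => (f x).toReal := by
  refine ⟨hs, fun x hx y hy u v hu hv huv => ?_⟩
  have h1 := ENNReal.toReal_mono (hf _ (hs hx hy hu hv huv)) (h x hx y hy u v hu hv huv)
  rwa [ENNReal.toReal_add (ENNReal.mul_ne_top ENNReal.ofReal_ne_top (hf x hx))
    (ENNReal.mul_ne_top ENNReal.ofReal_ne_top (hf y hy)), ENNReal.toReal_mul, ENNReal.toReal_mul,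
    ENNReal.toReal_ofReal hu, ENNReal.toReal_ofReal hv] at h1

namespace IlliquidMarket

variable {Ω : Type*} [MeasurableSpace Ω] {P : Measure Ω}
variable {M : IlliquidMarket Ω P} {x y : ℝ} {α α' : ℕ → Ω → ℝ} {c c' : ℝ≥0 → Ω → ℝ}

theorem isAdmissiblePolicy_zero (M : IlliquidMarket Ω P) {x : ℝ} (hx : 0 ≤ x) :
    M.IsAdmissiblePolicy x (fun _ _ => 0) (fun _ _ => 0) where
  measurable_α _ := measurable_const
  predictable_c := stronglyMeasurable_const
  c_nonneg _ _ := le_rfl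
  integrable_c _ := Eventually.of_forall fun _ => integrableOn_zero
  wealth_nonneg _ _ := Eventually.of_forall fun _ => by simpa [wealth] using hx

theorem IsAdmissiblePolicy.mono (h : M.IsAdmissiblePolicy x α c) (hxy : x ≤ y) :
    M.IsAdmissiblePolicy y α c where
  measurable_α := h.measurable_α
  predictable_c := h.predictable_c
  c_nonneg := h.c_nonneg
  integrable_c := h.integrable_c
  wealth_nonneg n hn := (h.wealth_nonneg n hn).mono fun ω hω => by
    rw [wealth] at hω ⊢
    linarith

theorem IsAdmissiblePolicy.combination (h : M.IsAdmissiblePolicy x α c)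
    (h' : M.IsAdmissiblePolicy y α' c') {u v : ℝ} (hu : 0 ≤ u) (hv : 0 ≤ v) :
    M.IsAdmissiblePolicy (u * x + v * y) (fun n ω => u * α n ω + v * α' n ω)
      (fun t ω => u * c t ω + v * c' t ω) where
  measurable_α n := ((h.measurable_α n).const_mul u).add ((h'.measurable_α n).const_mul v)
  predictable_c := (StronglyMeasurable.const_mul h.predictable_c u).add
    (StronglyMeasurable.const_mul h'.predictable_c v)
  c_nonneg t ω := add_nonneg (mul_nonneg hu (h.c_nonneg t ω)) (mul_nonneg hv (h'.c_nonneg t ω))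
  integrable_c n := by
    filter_upwards [h.integrable_c n, h'.integrable_c n] with ω h1 h2
    exact (h1.const_mul u).add (h2.const_mul v)
  wealth_nonneg n hn := by
    filter_upwards [h.integrable_c n, h'.integrable_c n, h.wealth_nonneg n hn,
      h'.wealth_nonneg n hn] with ω h1 h2 h3 h4
    have i1 : IntervalIntegrable (fun t : ℝ => c t.toNNReal ω) volume 0 (M.τ n ω) :=
      (intervalIntegrable_iff_integrableOn_Icc_of_le (M.τ_nonneg n ω)).2 h1
    have i2 : IntervalIntegrable (fun t : ℝ => c' t.toNNReal ω) volume 0 (M.τ n ω) :=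
      (intervalIntegrable_iff_integrableOn_Icc_of_le (M.τ_nonneg n ω)).2 h2
    have e : M.wealth (u * x + v * y) (fun n ω => u * α n ω + v * α' n ω)
        (fun t ω => u * c t ω + v * c' t ω) n ω =
        u * M.wealth x α c n ω + v * M.wealth y α' c' n ω := by
      simp only [wealth]
      rw [intervalIntegral.integral_add (i1.const_mul u) (i2.const_mul v),
        intervalIntegral.integral_const_mul, intervalIntegral.integral_const_mul]
      have : ∑ i ∈ Finset.range n, (u * α i ω + v * α' i ω) * M.Z (i + 1) ω =
          u * ∑ i ∈ Finset.range n, α i ω * M.Z (i + 1) ω +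
            v * ∑ i ∈ Finset.range n, α' i ω * M.Z (i + 1) ω := by
        rw [Finset.mul_sum, Finset.mul_sum, ← Finset.sum_add_distrib]
        exact Finset.sum_congr rfl fun i _ => by ring
      rw [this]
      ring
    rw [e]
    positivity

theorem value_monotone (M : IlliquidMarket Ω P) (U : ℝ → ℝ) (rho : ℝ) :
    Monotone (M.value U rho) := fun _ _ hxy =>
  iSup_le fun α => iSup_le fun c => iSup_le fun h =>
    le_iSup_of_le α (le_iSup_of_le c (le_iSup_of_le (h.mono hxy) le_rfl))

/-- Wealth is linear in the policy and U is concave, so mixing two policies does at least as well as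
mixing their payoffs. The inequalities for sums and multiples of lower integrals used here require
no measurability. -/
theorem value_combination_le (M : IlliquidMarket Ω P) {U : ℝ → ℝ} {γ : ℝ} (hU : IsUtility U γ)
    (rho : ℝ) {x y u v : ℝ} (hx : 0 ≤ x) (hy : 0 ≤ y) (hu : 0 ≤ u) (hv : 0 ≤ v)
    (huv : u + v = 1) :
    ENNReal.ofReal u * M.value U rho x + ENNReal.ofReal v * M.value U rho y ≤
      M.value U rho (u * x + v * y) := by
  let J : (ℕ → Ω → ℝ) × (ℝ≥0 → Ω → ℝ) → ℝ≥0∞ := fun q => ∫⁻ ω, (∫⁻ t in Ioi (0 : ℝ),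
      ENNReal.ofReal (Real.exp (-rho * t) * U (q.2 t.toNNReal ω))) ∂P
  have hval : ∀ x, M.value U rho x =
      ⨆ (q : (ℕ → Ω → ℝ) × (ℝ≥0 → Ω → ℝ)) (_ : M.IsAdmissiblePolicy x q.1 q.2), J q := fun x =>
    (iSup_prod (f := fun q => ⨆ (_ : M.IsAdmissiblePolicy x q.1 q.2), J q)).symm
  rw [hval x, hval y, ENNReal.mul_iSup, ENNReal.mul_iSup]
  simp only [ENNReal.mul_iSup]
  refine ENNReal.biSup_add_biSup_le' ⟨(_, _), M.isAdmissiblePolicy_zero hx⟩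
    ⟨(_, _), M.isAdmissiblePolicy_zero hy⟩ fun q hq r hr => ?_
  rw [hval]
  refine le_trans ?_ (le_iSup₂_of_le
    (⟨fun n ω => u * q.1 n ω + v * r.1 n ω, fun t ω => u * q.2 t ω + v * r.2 t ω⟩ :
      (ℕ → Ω → ℝ) × (ℝ≥0 → Ω → ℝ)) (hq.combination hr hu hv) le_rfl)
  refine (add_le_add (lintegral_const_mul_le _ _) (lintegral_const_mul_le _ _)).trans
    ((le_lintegral_add _ _).trans (lintegral_mono fun ω => ?_))
  refine (add_le_add (lintegral_const_mul_le _ _) (lintegral_const_mul_le _ _)).trans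
    ((le_lintegral_add _ _).trans (lintegral_mono fun t => ?_))
  have h1 := hq.c_nonneg t.toNNReal ω
  have h2 := hr.c_nonneg t.toNNReal ω
  have h3 := hU.strictConcave.concaveOn.2 (mem_Ici.2 h1) (mem_Ici.2 h2) hu hv huv
  have h4 := hU.nonneg h1
  have h5 := hU.nonneg h2
  have h6 := mul_le_mul_of_nonneg_left h3 (Real.exp_nonneg (-rho * t))
  simp only [smul_eq_mul] at h6
  rw [← ENNReal.ofReal_mul hu, ← ENNReal.ofReal_mul hv, ← ENNReal.ofReal_add (by positivity)
    (by positivity)]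
  exact ENNReal.ofReal_le_ofReal (by linarith)

/-- A nonnegative concave function is subadditive: y and h are complementary fractions of y + h, and
the terms with v(0) are dropped. The power bound on v(h) then gives the modulus required of the
running gain. -/
theorem value_add_le (M : IlliquidMarket Ω P) {U : ℝ → ℝ} {γ rho K : ℝ} (hU : IsUtility U γ)
    (hK : ∀ x, 0 ≤ x → M.value U rho x ≤ ENNReal.ofReal (K * x ^ γ)) {y h : ℝ} (hy : 0 ≤ y)
    (hh : 0 ≤ h) :
    M.value U rho (y + h) ≤ M.value U rho y + ENNReal.ofReal (K * h ^ γ) := by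
  refine le_trans ?_ (add_le_add le_rfl (hK h hh))
  rcases (add_nonneg hy hh).eq_or_lt with h0 | h0
  · have : y = 0 ∧ h = 0 := by constructor <;> linarith
    rw [this.1, this.2, add_zero]
    exact le_self_add
  · have hs : (y + h) ≠ 0 := h0.ne'
    have e1 := M.value_combination_le hU rho (add_nonneg hy hh) le_rfl (u := y / (y + h))
      (v := h / (y + h)) (by positivity) (by positivity) (by field_simp)
    have e2 := M.value_combination_le hU rho (add_nonneg hy hh) le_rfl (u := h / (y + h))
      (v := y / (y + h)) (by positivity) (by positivity) (by field_simp; ring)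
    have e3 := add_le_add (le_self_add.trans e1) (le_self_add.trans e2)
    rw [← add_mul, ← ENNReal.ofReal_add (by positivity) (by positivity), ← add_div, div_self hs,
      ENNReal.ofReal_one, one_mul] at e3
    simpa [div_mul_cancel₀ _ hs] using e3

theorem measurable_value (M : IlliquidMarket Ω P) (U : ℝ → ℝ) (rho : ℝ) :
    Measurable (M.value U rho) := (M.value_monotone U rho).measurable

variable {U : ℝ → ℝ} {γ rho a : ℝ}

theorem measurable_g (M : IlliquidMarket Ω P) (U : ℝ → ℝ) (rho a : ℝ) :
    Measurable fun q : ℝ × ℝ => M.g U rho q.1 q.2 a := by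
  have := M.markov
  have h : Measurable fun r : (ℝ × ℝ) × ℝ => M.value U rho (r.1.2 + a * r.2) :=
    (M.measurable_value U rho).comp (by fun_prop)
  exact (Measurable.lintegral_kernel_prod_right' (κ := M.p.comap Prod.fst measurable_fst)
    h).const_mul _

theorem g_mono (M : IlliquidMarket Ω P) (U : ℝ → ℝ) (rho s a : ℝ) :
    Monotone fun y => M.g U rho s y a := fun _ _ h =>
  mul_le_mul_right (lintegral_mono fun _ => M.value_monotone U rho (add_le_add h le_rfl)) _

theorem g_le (M : IlliquidMarket Ω P) {K : ℝ} (hK0 : 0 ≤ K) (hγ : 0 < γ) (hγ1 : γ < 1)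
    (hK : ∀ x, 0 ≤ x → M.value U rho x ≤ ENNReal.ofReal (K * x ^ γ)) (ha : a ∈ M.investments)
    {s y : ℝ} (hs : 0 < s) (hy : M.l a ≤ y) :
    M.g U rho s y a ≤ ENNReal.ofReal
      (M.lam * K * (M.k / M.zl) ^ γ * (1 + |y|) * Real.exp (M.b * γ * s)) := by
  have hl := M.lam_pos
  have hy0 : 0 ≤ y := (M.l_nonneg ha).trans hy
  have hk : 0 ≤ (M.k / M.zl) ^ γ := Real.rpow_nonneg (div_nonneg M.k_nonneg M.zl_pos.le) _
  have hsup : ∀ z ∈ (M.p s).support, 0 ≤ y + a * z := fun z hz =>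
    M.nonneg_of_mem_support hs ha hy hz
  have h1 : ∫⁻ z, M.value U rho (y + a * z) ∂(M.p s) ≤
      ENNReal.ofReal K * ENNReal.ofReal ((y * M.growthFactor s) ^ γ) := by
    refine le_trans ?_ (mul_le_mul_right (M.lintegral_rpow_le hs hγ hγ1 hsup) _)
    rw [← lintegral_const_mul' _ _ ENNReal.ofReal_ne_top]
    refine lintegral_mono_ae ((M.ae_mem_support s).mono fun z hz => ?_)
    rw [← ENNReal.ofReal_mul hK0]
    exact hK _ (hsup z hz)
  refine (mul_le_mul_right h1 _).trans ?_
  rw [← ENNReal.ofReal_mul hK0, ← ENNReal.ofReal_mul hl.le]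
  refine ENNReal.ofReal_le_ofReal ?_
  rw [Real.mul_rpow hy0 (M.growthFactor_nonneg s), growthFactor_rpow]
  have h2 : y ^ γ ≤ 1 + |y| := by
    have := Real.geom_mean_le_arith_mean2_weighted hγ.le (sub_nonneg.2 hγ1.le) hy0 zero_le_one
      (by ring)
    rw [Real.one_rpow, mul_one, mul_one] at this
    rw [abs_of_nonneg hy0]
    nlinarith
  have h3 := mul_le_mul_of_nonneg_left h2
    (show 0 ≤ M.lam * K * (M.k / M.zl) ^ γ * Real.exp (M.b * γ * s) by positivity)
  linarith

/-- The auxiliary problem is a deterministic consumption problem with running reward `g`. -/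
theorem isConsumptionProblem (M : IlliquidMarket Ω P) [IsProbabilityMeasure P] (hU : IsUtility U γ) (hrho : 0 < rho)
    (hdiscount : rho > M.b * γ + M.lam * (M.k ^ γ / M.zl ^ γ - 1)) (ha : a ∈ M.investments) :
    IsConsumptionProblem U (fun s y => (M.g U rho s y a).toReal) (rho + M.lam) (M.l a) γ ∧
      ∀ s > 0, ∀ y, M.l a ≤ y → M.g U rho s y a ≠ ⊤ := by
  have := M.markov
  have hl := M.lam_pos
  obtain ⟨K, hK0, hK⟩ := M.exists_value_le hU hrho hdiscount
  have hle : ∀ s > 0, ∀ y, M.l a ≤ y → M.g U rho s y a ≤ ENNReal.ofReal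
      (M.lam * K * (M.k / M.zl) ^ γ * (1 + |y|) * Real.exp (M.b * γ * s)) := fun s hs y hy =>
    M.g_le hK0 hU.γ_pos hU.γ_lt_one hK ha hs hy
  have hfin : ∀ s > 0, ∀ y, M.l a ≤ y → M.g U rho s y a ≠ ⊤ := fun s hs y hy =>
    ne_top_of_le_ne_top ENNReal.ofReal_ne_top (hle s hs y hy)
  have hk : 0 ≤ (M.k / M.zl) ^ γ := Real.rpow_nonneg (div_nonneg M.k_nonneg M.zl_pos.le) _
  refine ⟨⟨hU, by linarith, ?_, ?_, ?_, ?_, ?_, ?_⟩, hfin⟩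
  · exact (M.measurable_g U rho a).ennreal_toReal
  · exact fun _ _ => ENNReal.toReal_nonneg
  · exact fun s hs y hy z hz hyz => ENNReal.toReal_mono (hfin s hs z hz) (M.g_mono U rho s a hyz)
  · refine fun s hs => concaveOn_toReal (convex_Ici _) (hfin s hs)
      fun x hx y hy u v hu hv huv => ?_
    have e : ∀ (w : ℝ) (r : ℝ≥0∞), r * (ENNReal.ofReal M.lam * ∫⁻ z, M.value U rho (w + a * z)
        ∂(M.p s)) = ENNReal.ofReal M.lam * (r * ∫⁻ z, M.value U rho (w + a * z) ∂(M.p s)) :=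
      fun w r => mul_left_comm _ _ _
    rw [g, g, g, e, e, ← mul_add]
    refine mul_le_mul_right ((add_le_add (lintegral_const_mul_le _ _)
      (lintegral_const_mul_le _ _)).trans ((le_lintegral_add _ _).trans
        (lintegral_mono_ae ((M.ae_mem_support s).mono fun z hz => ?_)))) _
    refine (M.value_combination_le hU rho (M.nonneg_of_mem_support hs ha hx hz)
      (M.nonneg_of_mem_support hs ha hy hz) hu hv huv).trans_eq ?_
    congr 1
    linear_combination (a * z) * huv
  -- Here κ = bγ, and κ < ρ + λ is the positive margin in the discount condition.
  · refine ⟨M.b * γ, M.lam * K * (M.k / M.zl) ^ γ, by linarith [(M.discount_margin hdiscount).2],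
      mul_nonneg M.b_nonneg hU.γ_pos.le, by positivity, fun s hs y hy => ?_⟩
    exact ENNReal.toReal_le_of_le_ofReal (by positivity) (hle s hs y hy)
  · refine ⟨M.lam * K, by positivity, fun s hs y h hy hh => ?_⟩
    have h1 : M.g U rho s (y + h) a ≤ M.g U rho s y a + ENNReal.ofReal (M.lam * K * h ^ γ) := by
      have h2 : ∫⁻ z, M.value U rho (y + h + a * z) ∂(M.p s) ≤
          ∫⁻ z, (M.value U rho (y + a * z) + ENNReal.ofReal (K * h ^ γ)) ∂(M.p s) := by
        refine lintegral_mono_ae ((M.ae_mem_support s).mono fun z hz => ?_)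
        rw [add_right_comm]
        exact M.value_add_le hU hK (M.nonneg_of_mem_support hs ha hy hz) hh
      rw [lintegral_add_right _ measurable_const, lintegral_const, measure_univ, mul_one] at h2
      refine (mul_le_mul_right h2 _).trans_eq ?_
      rw [mul_add, ← ENNReal.ofReal_mul hl.le, mul_assoc M.lam]
      rfl
    have h2 := ENNReal.toReal_mono (ENNReal.add_ne_top.2 ⟨hfin s hs y hy, ENNReal.ofReal_ne_top⟩) h1
    rwa [ENNReal.toReal_add (hfin s hs y hy) ENNReal.ofReal_ne_top,
      ENNReal.toReal_ofReal (by positivity)] at h2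

end IlliquidMarket

/-! ### Transfer to the auxiliary problem of the market -/

namespace IlliquidMarket

variable {Ω : Type*} [MeasurableSpace Ω] {P : Measure Ω} {M : IlliquidMarket Ω P}
variable {U : ℝ → ℝ} {γ rho a t x : ℝ} {c : ℝ → ℝ}

theorem _root_.IsControl.isAdmissibleConsumption (h : IsControl (M.l a) t x c) :
    M.IsAdmissibleConsumption a t x c where
  measurable := h.measurable.comp measurable_subtype_coe
  nonneg s _ := h.nonneg s
  integrable _ _ := h.integrable.integrableOn
  integral_le s hs := by
    have := h.le_wealthPath hs
    rw [wealthPath] at this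
    linarith

theorem integral_indicator_Ici (c : ℝ → ℝ) {s : ℝ} (hs : t ≤ s) :
    ∫ u in t..s, (Ici t).indicator c u = ∫ u in t..s, c u := by
  refine intervalIntegral.integral_congr fun u hu => ?_
  rw [uIcc_of_le hs] at hu
  exact indicator_of_mem (mem_Ici.2 hu.1) c

/-- The bound on all partial integrals of a nonnegative function gives integrability on the half
line. Values before t are unconstrained in one notion and must be nonnegative and integrable in the
other, hence the extension by 0. -/
theorem IsAdmissibleConsumption.isControl (h : M.IsAdmissibleConsumption a t x c) :
    IsControl (M.l a) t x ((Ici t).indicator c) := by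
  have hint : IntegrableOn c (Ioi t) := by
    refine integrableOn_Ioi_of_intervalIntegral_norm_bounded (x - M.l a) t (b := fun s : ℝ => s)
      (l := atTop) (fun s => ?_) tendsto_id ?_
    · rcases le_or_gt t s with hs | hs
      · exact (h.integrable s hs).mono_set Ioc_subset_Icc_self
      · rw [Ioc_eq_empty (not_lt.2 hs.le)]
        exact integrableOn_empty
    · filter_upwards [eventually_ge_atTop t] with s hs
      refine le_trans (le_of_eq (intervalIntegral.integral_congr fun u hu => ?_))
        (h.integral_le s hs)
      rw [uIcc_of_le hs] at hu
      exact Real.norm_of_nonneg (h.nonneg u hu.1)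
  refine ⟨?_, fun s => indicator_nonneg (fun u hu => h.nonneg u hu) s, ?_, ?_⟩
  · refine measurable_of_restrict_of_restrict_compl (s := Ici t) measurableSet_Ici ?_ ?_
    · convert h.measurable using 2 with s
      exact indicator_of_mem s.2 c
    · convert (measurable_const : Measurable fun _ : ((Ici t)ᶜ : Set ℝ) => (0 : ℝ)) using 2 with s
      exact indicator_of_notMem s.2 c
  · exact (integrable_indicator_iff measurableSet_Ici).2
      ((integrableOn_Ici_iff_integrableOn_Ioi).2 hint)
  · have e : ∫ s in Ioi t, (Ici t).indicator c s = ∫ s in Ioi t, c s :=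
      setIntegral_congr_fun measurableSet_Ioi fun s hs =>
        indicator_of_mem (mem_Ici.2 (le_of_lt hs)) c
    rw [e]
    refine le_of_tendsto (intervalIntegral_tendsto_integral_Ioi t hint tendsto_id) ?_
    filter_upwards [eventually_ge_atTop t] with s hs using h.integral_le s hs

theorem gain_congr {c' Y Y' : ℝ → ℝ} (hc : ∀ᵐ s, t < s → c s = c' s)
    (hY : ∀ s, t ≤ s → Y s = Y' s) : M.gain U rho a t c Y = M.gain U rho a t c' Y' := by
  refine setLIntegral_congr_fun_ae measurableSet_Ioi ?_
  filter_upwards [hc] with s hs hst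
  rw [hs hst, hY s (le_of_lt hst)]

variable [IsProbabilityMeasure P]

/-- Along an admissible path g is finite, because wealth stays above the floor and s > 0, so passing
to real numbers loses nothing. -/
theorem gain_eq_payoff (hU : IsUtility U γ) (hrho : 0 < rho)
    (hdiscount : rho > M.b * γ + M.lam * (M.k ^ γ / M.zl ^ γ - 1)) (ha : a ∈ M.investments)
    (ht : 0 ≤ t) (hc : IsControl (M.l a) t x c) :
    M.gain U rho a t c (wealthPath t x c) = ENNReal.ofReal
      (payoff U (fun s y => (M.g U rho s y a).toReal) (rho + M.lam) t x c) := by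
  obtain ⟨h, hfin⟩ := M.isConsumptionProblem hU hrho hdiscount ha
  rw [payoff, ofReal_integral_eq_lintegral_ofReal (h.integrableOn_payoffRate ht hc)
    (Eventually.of_forall fun s => h.payoffRate_nonneg hc.nonneg s)]
  refine setLIntegral_congr_fun measurableSet_Ioi fun s hs => ?_
  have hg := hfin s (ht.trans_lt hs) _ (hc.le_wealthPath (le_of_lt hs))
  simp only [payoffRate]
  rw [ENNReal.ofReal_mul (Real.exp_nonneg _), ENNReal.ofReal_add (hU.nonneg (hc.nonneg s))
    ENNReal.toReal_nonneg, ENNReal.ofReal_toReal hg]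

theorem gain_eq_payoff_indicator (hU : IsUtility U γ) (hrho : 0 < rho)
    (hdiscount : rho > M.b * γ + M.lam * (M.k ^ γ / M.zl ^ γ - 1)) (ha : a ∈ M.investments)
    (ht : 0 ≤ t) (hc : M.IsAdmissibleConsumption a t x c) {Y : ℝ → ℝ}
    (hY : ∀ s, t ≤ s → Y s = x - ∫ u in t..s, c u) :
    M.gain U rho a t c Y = ENNReal.ofReal (payoff U (fun s y => (M.g U rho s y a).toReal)
      (rho + M.lam) t x ((Ici t).indicator c)) := by
  rw [← gain_eq_payoff hU hrho hdiscount ha ht hc.isControl]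
  refine gain_congr (Eventually.of_forall fun s hs =>
    (indicator_of_mem (mem_Ici.2 (le_of_lt hs)) c).symm) fun s hs => ?_
  rw [hY s hs, wealthPath, integral_indicator_Ici c hs]

theorem auxValue_eq (hU : IsUtility U γ) (hrho : 0 < rho)
    (hdiscount : rho > M.b * γ + M.lam * (M.k ^ γ / M.zl ^ γ - 1)) (ha : a ∈ M.investments)
    (ht : 0 ≤ t) (hx : M.l a ≤ x) :
    M.auxValue U rho t x a = ENNReal.ofReal (consumptionValue U
      (fun s y => (M.g U rho s y a).toReal) (rho + M.lam) (M.l a) t x) := by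
  obtain ⟨h, -⟩ := M.isConsumptionProblem hU hrho hdiscount ha
  refine le_antisymm (iSup₂_le fun c hc => ?_) ?_
  · rw [gain_eq_payoff_indicator hU hrho hdiscount ha ht hc fun _ _ => rfl]
    exact ENNReal.ofReal_le_ofReal (h.payoff_le_value ht hc.isControl)
  -- The real supremum is attained, so it is reached by a single term of the supremum in [0, ∞].
  · obtain ⟨c, hc, hopt⟩ := h.exists_optimal ht hx
    rw [← hopt, ← gain_eq_payoff hU hrho hdiscount ha ht hc]
    exact le_iSup₂_of_le c hc.isAdmissibleConsumption le_rfl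

theorem auxValue_toReal_eventuallyEq (hU : IsUtility U γ) (hrho : 0 < rho)
    (hdiscount : rho > M.b * γ + M.lam * (M.k ^ γ / M.zl ^ γ - 1)) (ha : a ∈ M.investments)
    (ht : 0 ≤ t) (hx : M.l a < x) :
    (fun y => (M.auxValue U rho t y a).toReal) =ᶠ[𝓝 x] consumptionValue U
      (fun s y => (M.g U rho s y a).toReal) (rho + M.lam) (M.l a) t := by
  filter_upwards [Ioi_mem_nhds hx] with y hy
  rw [auxValue_eq hU hrho hdiscount ha ht (le_of_lt hy), ENNReal.toReal_ofReal
    ((M.isConsumptionProblem hU hrho hdiscount ha).1.value_nonneg ht (le_of_lt hy))]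

theorem auxSlope_eq (hU : IsUtility U γ) (hrho : 0 < rho)
    (hdiscount : rho > M.b * γ + M.lam * (M.k ^ γ / M.zl ^ γ - 1)) (ha : a ∈ M.investments)
    (ht : 0 ≤ t) (hx : M.l a < x) :
    M.auxSlope U rho t x a = deriv (consumptionValue U
      (fun s y => (M.g U rho s y a).toReal) (rho + M.lam) (M.l a) t) x :=
  (auxValue_toReal_eventuallyEq hU hrho hdiscount ha ht hx).deriv_eq

theorem feedback_eq (hU : IsUtility U γ) (hrho : 0 < rho)
    (hdiscount : rho > M.b * γ + M.lam * (M.k ^ γ / M.zl ^ γ - 1)) (ha : a ∈ M.investments)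
    (ht : 0 ≤ t) (x : ℝ) :
    M.feedback U rho t x a = consumptionFeedback U
      (fun s y => (M.g U rho s y a).toReal) (rho + M.lam) (M.l a) t x := by
  rw [feedback]
  split_ifs with hx
  · rw [IsConsumptionProblem.feedback_of_lt hx, auxSlope_eq hU hrho hdiscount ha ht hx]
  · rw [IsConsumptionProblem.feedback_of_le (not_lt.1 hx)]

theorem isFeedbackSolution_iff (hU : IsUtility U γ) (hrho : 0 < rho)
    (hdiscount : rho > M.b * γ + M.lam * (M.k ^ γ / M.zl ^ γ - 1)) (ha : a ∈ M.investments)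
    (ht : 0 ≤ t) {Y : ℝ → ℝ} :
    M.IsFeedbackSolution U rho a t x Y ↔ IsClosedLoop (consumptionFeedback U
      (fun s y => (M.g U rho s y a).toReal) (rho + M.lam) (M.l a)) t x Y := by
  refine and_congr_right fun _ => forall₂_congr fun s hs => ?_
  rw [feedback_eq hU hrho hdiscount ha (ht.trans hs)]

theorem measurable_feedback (hU : IsUtility U γ) (hrho : 0 < rho)
    (hdiscount : rho > M.b * γ + M.lam * (M.k ^ γ / M.zl ^ γ - 1)) (ha : a ∈ M.investments) :
    Measurable fun q : Ici (0 : ℝ) × Ici (M.l a) => M.feedback U rho q.1 q.2 a := by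
  convert (M.isConsumptionProblem hU hrho hdiscount ha).1.measurable_feedback using 2 with q
  exact feedback_eq hU hrho hdiscount ha q.1.2 _

theorem feedback_nonneg (hU : IsUtility U γ) (hrho : 0 < rho)
    (hdiscount : rho > M.b * γ + M.lam * (M.k ^ γ / M.zl ^ γ - 1)) (ha : a ∈ M.investments)
    (ht : 0 ≤ t) (x : ℝ) : 0 ≤ M.feedback U rho t x a := by
  rw [feedback_eq hU hrho hdiscount ha ht]
  rcases lt_or_ge (M.l a) x with hx | hx
  · exact ((M.isConsumptionProblem hU hrho hdiscount ha).1.feedback_pos ht hx).le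
  · exact (IsConsumptionProblem.feedback_of_le hx).ge

/-- Optimal couples follow the feedback. -/
theorem IsOptimalCouple.eq_feedback {Y : ℝ → ℝ} (hU : IsUtility U γ) (hrho : 0 < rho)
    (hdiscount : rho > M.b * γ + M.lam * (M.k ^ γ / M.zl ^ γ - 1)) (ha : a ∈ M.investments)
    (ht : 0 ≤ t) (hx : M.l a ≤ x) (h : M.IsOptimalCouple U rho a t x c Y) :
    (∀ᵐ s, t < s → c s = M.feedback U rho s (Y s) a) ∧ ∃ Z, EqOn Y Z (Ici t) ∧
      M.IsFeedbackSolution U rho a t x Z := by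
  have hp := (M.isConsumptionProblem hU hrho hdiscount ha).1
  have hc := h.admissible.isControl
  have hopt := h.optimal
  rw [gain_eq_payoff_indicator hU hrho hdiscount ha ht h.admissible h.state,
    auxValue_eq hU hrho hdiscount ha ht hx, ENNReal.ofReal_eq_ofReal_iff
    (hp.payoff_nonneg hc.nonneg) (hp.value_nonneg ht hx)] at hopt
  have hY : EqOn Y (wealthPath t x ((Ici t).indicator c)) (Ici t) := fun s hs => by
    rw [h.state s hs, wealthPath, integral_indicator_Ici c hs]
  obtain ⟨h1, h2⟩ := hp.optimal_eq_feedback ht hc hopt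
  refine ⟨?_, _, hY, (isFeedbackSolution_iff hU hrho hdiscount ha ht).2 h2⟩
  filter_upwards [h1] with s hs hst
  have hst' : s ∈ Ici t := le_of_lt hst
  rw [feedback_eq hU hrho hdiscount ha (ht.trans hst'), hY hst', ← hs hst, indicator_of_mem hst']

theorem IsFeedbackSolution.eqOn {Y Z : ℝ → ℝ} (hU : IsUtility U γ) (hrho : 0 < rho)
    (hdiscount : rho > M.b * γ + M.lam * (M.k ^ γ / M.zl ^ γ - 1)) (ha : a ∈ M.investments)
    (ht : 0 ≤ t) (hY : M.IsFeedbackSolution U rho a t x Y)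
    (hZ : M.IsFeedbackSolution U rho a t x Z) : EqOn Y Z (Ici t) := by
  rw [isFeedbackSolution_iff hU hrho hdiscount ha ht] at hY hZ
  exact hY.eqOn (fun s hs => (M.isConsumptionProblem hU hrho hdiscount ha).1.monotone_feedback
    (ht.trans hs)) hZ

/-- The closed loop equation has a solution, which is optimal. -/
theorem exists_isOptimalCouple_feedback (hU : IsUtility U γ) (hrho : 0 < rho)
    (hdiscount : rho > M.b * γ + M.lam * (M.k ^ γ / M.zl ^ γ - 1)) (ha : a ∈ M.investments)
    (ht : 0 ≤ t) (hx : M.l a ≤ x) :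
    ∃ Y, M.IsFeedbackSolution U rho a t x Y ∧ (∀ s, t ≤ s → M.l a ≤ Y s) ∧
      M.IsOptimalCouple U rho a t x (fun s => M.feedback U rho s (Y s) a) Y := by
  have hp := (M.isConsumptionProblem hU hrho hdiscount ha).1
  -- The solution of the closed loop equation is the wealth of an optimal control. Replacing that
  -- control by the feedback along the path changes it only on a null set after t, which leaves
  -- integrals and gain unchanged.
  obtain ⟨c, hc, hopt⟩ := hp.exists_optimal ht hx
  obtain ⟨h1, h2⟩ := hp.optimal_eq_feedback ht hc hopt
  set Y := wealthPath t x c with hY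
  have hlY : ∀ s, t ≤ s → M.l a ≤ Y s := fun s hs => hc.le_wealthPath hs
  have hae : ∀ᵐ s, t < s → M.feedback U rho s (Y s) a = c s := by
    filter_upwards [h1] with s hs hst
    rw [feedback_eq hU hrho hdiscount ha (ht.trans hst.le), hs hst]
  have hint : ∀ s, t ≤ s → ∫ u in t..s, M.feedback U rho u (Y u) a = ∫ u in t..s, c u := by
    intro s hs
    rw [intervalIntegral.integral_of_le hs, intervalIntegral.integral_of_le hs]
    refine setIntegral_congr_ae measurableSet_Ioc ?_
    filter_upwards [hae] with u hu hus using hu hus.1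
  refine ⟨Y, (isFeedbackSolution_iff hU hrho hdiscount ha ht).2 h2, hlY,
    ⟨?_, fun s hs => ?_, fun s hs => ?_, fun s hs => ?_⟩, fun s hs => ?_, ?_⟩
  · have h3 : Measurable fun s : Ici t =>
        ((⟨s, ht.trans s.2⟩, ⟨Y s, hlY s s.2⟩) : Ici (0 : ℝ) × Ici (M.l a)) :=
      (measurable_subtype_coe.subtype_mk).prodMk
        ((hc.continuous_wealthPath.measurable.comp measurable_subtype_coe).subtype_mk)
    exact (measurable_feedback hU hrho hdiscount ha).comp h3
  · exact feedback_nonneg hU hrho hdiscount ha (ht.trans hs) _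
  · rw [integrableOn_Icc_iff_integrableOn_Ioc]
    refine (hc.integrable.integrableOn (s := Ioc t s)).congr ?_
    refine (ae_restrict_iff' measurableSet_Ioc).2 ?_
    filter_upwards [hae] with u hu hus using (hu hus.1).symm
  · rw [hint s hs]
    exact hc.isAdmissibleConsumption.integral_le s hs
  · rw [hint s hs]
    rfl
  · rw [gain_congr hae fun _ _ => rfl, gain_eq_payoff hU hrho hdiscount ha ht hc, hopt,
      auxValue_eq hU hrho hdiscount ha ht hx]

end IlliquidMarket

theorem mainTheorem6 {Ω : Type*} [MeasurableSpace Ω] (P : Measure Ω) [IsProbabilityMeasure P]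
    (M : IlliquidMarket Ω P) (U : ℝ → ℝ) (γ rho : ℝ)
    (hU : IsUtility U γ) (hrho : 0 < rho)
    (hdiscount : rho > M.b * γ + M.lam * (M.k ^ γ / M.zl ^ γ - 1))
    (hsemi : M.SemiconcaveReturns) (a : ℝ) (ha : a ∈ M.investments) :
    BijOn (inverseMarginal U) (Ioi 0) (Ioi 0) ∧
    (∀ y ∈ Ioi (0 : ℝ), deriv U (inverseMarginal U y) = y) ∧
    (∀ t, 0 ≤ t → ∀ x, M.l a ≤ x → M.auxValue U rho t x a ≠ ⊤) ∧
    (∀ t, 0 ≤ t → ∀ x, M.l a < x →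
      DifferentiableAt ℝ (fun y => (M.auxValue U rho t y a).toReal) x ∧
      0 < M.auxSlope U rho t x a ∧
      ∀ c, 0 ≤ c → c ≠ M.feedback U rho t x a →
        U c - c * M.auxSlope U rho t x a <
          U (M.feedback U rho t x a) - M.feedback U rho t x a * M.auxSlope U rho t x a) ∧
    (∀ t, 0 ≤ t → Tendsto (fun x => M.auxSlope U rho t x a) (𝓝[>] M.l a) atTop) ∧
    (Measurable fun q : Ici (0 : ℝ) × Ici (M.l a) => M.feedback U rho q.1 q.2 a) ∧
    ∀ t, 0 ≤ t → ∀ x, M.l a ≤ x →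
      ∃ Y : ℝ → ℝ,
        M.IsFeedbackSolution U rho a t x Y ∧
        (∀ Y', M.IsFeedbackSolution U rho a t x Y' → EqOn Y' Y (Ici t)) ∧
        (∀ s, t ≤ s → M.l a ≤ Y s) ∧
        M.IsOptimalCouple U rho a t x (fun s => M.feedback U rho s (Y s) a) Y ∧
        ∀ c' Y', M.IsOptimalCouple U rho a t x c' Y' →
          (∀ᵐ s ∂(volume.restrict (Ici t)), c' s = M.feedback U rho s (Y s) a) ∧
          EqOn Y' Y (Ici t) := by
  have hp := (M.isConsumptionProblem hU hrho hdiscount ha).1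
  refine ⟨hU.bijOn_inverseMarginal, fun y hy => hU.deriv_inverseMarginal hy,
    fun t ht x hx => ?_, fun t ht x hx => ?_, fun t ht => ?_,
    M.measurable_feedback hU hrho hdiscount ha, fun t ht x hx => ?_⟩
  · rw [M.auxValue_eq hU hrho hdiscount ha ht hx]
    exact ENNReal.ofReal_ne_top
  · have hslope : 0 < M.auxSlope U rho t x a := by
      rw [M.auxSlope_eq hU hrho hdiscount ha ht hx]
      exact hp.deriv_value_pos ht hx
    refine ⟨(M.auxValue_toReal_eventuallyEq hU hrho hdiscount ha ht hx).differentiableAt_iff.2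
      (hp.differentiableAt_value ht hx), hslope, fun c hc hne => ?_⟩
    rw [IlliquidMarket.feedback, if_pos hx] at hne ⊢
    -- The tangent of U at I(slope) has exactly this slope, so strict concavity makes that point the
    -- unique maximizer.
    have h1 := hU.lt_tangent (hU.inverseMarginal_pos hslope) hc hne
    rw [hU.deriv_inverseMarginal hslope] at h1
    linarith
  · refine (hp.tendsto_deriv_value ht).congr' ?_
    filter_upwards [self_mem_nhdsWithin] with x hx
    exact (M.auxSlope_eq hU hrho hdiscount ha ht hx).symm
  · obtain ⟨Y, hY, hlY, hopt⟩ := M.exists_isOptimalCouple_feedback hU hrho hdiscount ha ht hx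
    refine ⟨Y, hY, fun Y' hY' => hY'.eqOn hU hrho hdiscount ha ht hY, hlY, hopt,
      fun c' Y' h' => ?_⟩
    obtain ⟨h1, Z, hZ, hZsol⟩ := h'.eq_feedback hU hrho hdiscount ha ht hx
    -- Any optimal path is a closed loop solution with the same starting point; uniqueness of the
    -- solution identifies the paths, and then the controls through the feedback.
    have hYY : EqOn Y' Y (Ici t) := hZ.trans (hZsol.eqOn hU hrho hdiscount ha ht hY)
    refine ⟨?_, hYY⟩
    rw [← restrict_Ioi_eq_restrict_Ici, ae_restrict_iff' measurableSet_Ioi]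
    filter_upwards [h1] with s hs hst
    rw [hs hst, hYY (mem_Ici.2 (le_of_lt hst))]
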